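/- **Setting.** Let the base stations (BSs) form a homogeneous Poisson point process in $\mathbb R^2$ of density $\lambda_{\mathrm{BS}}>0$, let the target be at a fixed point, and let $R_1<R_2<\cdots$ be the ordered distances of the BSs from the target; the nearest BS, at distance $R_1$, is the sensing BS. Given the BS locations, independently over all BSs and all marks, a BS at distance $r$ from the target has a line-of-sight link to it with probability $p_{\mathrm{LOS}}(r)=e^{-\eta_b r}$ ($\eta_b>0$), illuminates it with one of its $N_b\ge 1$ non-overlapping beams of width $\theta_b>0$ with probability $\frac{N_b\theta_b}{2\pi}\le 1$, and sees a bistatic radar cross section that is exponential with mean $\sigma_{\mathrm{av,bi}}>0$. Let $\Phi_{I_T}$ be the set of BSs that illuminate the target over line-of-sight, a thinned process of intensity $\lambda_{\mathrm{BS}}\,p_{\mathrm{LOS}}(r)\frac{N_b\theta_b}{2\pi}$, and write $R_i$, $\sigma_{b,i}$ for the distance and the cross section of its members. Let $N_c\ge 1$, $\alpha_L>0$, $P_s\ge 0$, $G_m,\lambda>0$. For $r_1>0$ and $D\subseteq[0,\infty)$ put $$I(r_1,D)=\frac{P_sG_m^2\lambda^2}{(4\pi)^3r_1^{\alpha_L}}\sum_{i\in\Phi_{I_T},\,R_i\in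 D}\sigma_{b,i}R_i^{-\alpha_L},\qquad \ell_{r_1,s}(r)=1-\frac{1}{1+s\frac{P_sG_m^2\lambda^2\sigma_{\mathrm{av,bi}}}{(4\pi)^3r_1^{\alpha_L}r^{\alpha_L}}},$$ $$g_{r_1,s}(\rho)=\exp\Big(-\lambda_{\mathrm{BS}}N_b\theta_b\int_\rho^\infty p_{\mathrm{LOS}}(r)\,\ell_{r_1,s}(r)\,r\,dr\Big),$$ $$f_{r_1}(\rho)=\frac{2(\pi\lambda_{\mathrm{BS}})^{N_c}}{(N_c-1)!}(\rho^2-r_1^2)^{N_c-1}\rho\,e^{-\pi\lambda_{\mathrm{BS}}(\rho^2-r_1^2)}\quad(\rho\ge r_1),\qquad f_{r_1}(\rho)=0\quad(\rho<r_1).$$ **Lemma.** Almost surely $0<R_1<R_{N_c+1}$ and the sums over $R_i\ge\rho$ converge for every $\rho>0$; $R_1$, $R_{N_c+1}$ and the interferences $I(R_1,(R_{N_c+1},\infty))$ and $I(R_1,[R_{N_c+1},\infty))$ are random variables. Moreover: 1. The conditional law of the exclusion radius $R_{N_c+1}$ given $R_1=r_1$ has density $f_{r_1}$, for almost every $r_1$.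 2. For all $r_1,\rho>0$ and $s\ge0$, $\mathbb E\big[e^{-sI(r_1,[\rho,\infty))}\big]=g_{r_1,s}(\rho)$. 3. The target-reflected interference $I_T=I(R_1,(R_{N_c+1},\infty))$ of the BSs outside the exclusion disc of radius $R_{N_c+1}$ around the target has, given $R_1=r_1$, the Laplace transform $$\mathcal L_{I_T}(s)=\int_{r_1}^\infty \exp\Big(-\lambda_{\mathrm{BS}}N_b\theta_b\int_\rho^\infty p_{\mathrm{LOS}}(r)\Big(1-\frac{1}{1+s\frac{P_sG_m^2\lambda^2\sigma_{\mathrm{av,bi}}}{(4\pi)^3r_1^{\alpha_L}r^{\alpha_L}}}\Big)r\,dr\Big)f_{r_1}(\rho)\,d\rho\qquad\text{for all } s\ge0,$$ for almost every $r_1$. 4. If the $(N_c+1)$-th nearest BS, which lies on the rim of that disc, is also counted as an interferer when it belongs to $\Phi_{I_T}$, i.e. for $I_T'=I(R_1,[R_{N_c+1},\infty))$, then for almost every $r_1$ and all $s\ge 0$, given $R_1=r_1$, $$\mathcal L_{I_T'}(s)=\int_{r_1}^\infty\Big(1-\tfrac{N_b\theta_b}{2\pi}\,p_{\mathrm{LOS}}(\rho)\,\ell_{r_1,s}(\rho)\Big)\,g_{r_1,s}(\rho)\,f_{r_1}(\rho)\,d\rho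 .$$ -/

import Mathlib

open MeasureTheory ProbabilityTheory Set

noncomputable section

namespace ISAC

/-- The Euclidean plane. -/
abbrev Plane : Type := EuclideanSpace ℝ (Fin 2)

/-! ### Poisson point processes and independent marking -/

/-- The number of points of the (enumerated) point process `X` that lie in `B`. -/
def pointCount {Ω E : Type*} (X : ℕ → Ω → E) (B : Set E) (ω : Ω) : ℕ∞ :=
  {i : ℕ | X i ω ∈ B}.encard

/-- The random points `X 0, X 1, …` (in any order) form a Poisson point process with intensity
measure `Λ`: the number of points in a measurable set `B` with `Λ B < ∞` is Poisson with mean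
`Λ B`, and the numbers of points in pairwise disjoint such sets are independent. -/
structure IsPoissonPointProcess {Ω E : Type*} [MeasurableSpace Ω] [MeasurableSpace E]
    (μ : Measure Ω) (Λ : Measure E) (X : ℕ → Ω → E) : Prop where
  measurable : ∀ i, Measurable (X i)
  count_law : ∀ B : Set E, MeasurableSet B → Λ B ≠ ⊤ → ∀ n : ℕ,
    μ {ω | pointCount X B ω = n} = poissonMeasure (Λ B).toNNReal {n}
  count_indep : ∀ (k : ℕ) (B : Fin k → Set E), (∀ j, MeasurableSet (B j)) →
    (∀ j, Λ (B j) ≠ ⊤) → Pairwise (fun j l => Disjoint (B j) (B l)) →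
    iIndepFun (fun j ω => pointCount X (B j) ω) μ

/-- Independent marking: conditionally on the whole sequence of points, the marks `M 0, M 1, …`
are independent and the mark of a point located at `x` has law `K x`. -/
structure IsIndependentMarking {Ω E S : Type*} [MeasurableSpace Ω] [MeasurableSpace E]
    [MeasurableSpace S] (μ : Measure Ω) (X : ℕ → Ω → E) (K : E → Measure S)
    (M : ℕ → Ω → S) : Prop where
  measurable : ∀ i, Measurable (M i)
  joint_law : ∀ (A : Set (ℕ → E)), MeasurableSet A → ∀ (J : Finset ℕ) (B : ℕ → Set S),
    (∀ i, MeasurableSet (B i)) →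
    μ {ω | (fun i => X i ω) ∈ A ∧ ∀ i ∈ J, M i ω ∈ B i} =
      ∫⁻ ω in {ω | (fun i => X i ω) ∈ A}, ∏ i ∈ J, K (X i ω) (B i) ∂μ

/-- The distance from `t` to the `n`-th nearest point of the point process `X` (for `n ≥ 1`):
the smallest radius for which the closed disc around `t` holds at least `n` points. -/
def nthDist {Ω : Type*} (X : ℕ → Ω → Plane) (t : Plane) (n : ℕ) (ω : Ω) : ℝ :=
  sInf {r : ℝ | 0 ≤ r ∧ (n : ℕ∞) ≤ pointCount X (Metric.closedBall t r) ω}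

/-! ### The sensing network -/

/-- The parameters of the network. -/
structure Params where
  /-- density of the base stations -/
  lamBS : ℝ
  /-- number of beams of each base station -/
  Nb : ℕ
  /-- beamwidth -/
  thetaB : ℝ
  /-- blockage constant in the line-of-sight probability -/
  etaB : ℝ
  /-- line-of-sight path-loss exponent -/
  alphaL : ℝ
  /-- sensing power -/
  Ps : ℝ
  /-- antenna gain -/
  Gm : ℝ
  /-- wavelength -/
  wavelength : ℝ
  /-- mean bistatic radar cross section -/
  sigmaAv : ℝ
  lamBS_pos : 0 < lamBS
  Nb_pos : 0 < Nb
  thetaB_pos : 0 < thetaB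
  /-- the beams of one base station do not overlap -/
  beams_le : Nb * thetaB ≤ 2 * Real.pi
  etaB_pos : 0 < etaB
  alphaL_pos : 0 < alphaL
  Ps_nonneg : 0 ≤ Ps
  Gm_pos : 0 < Gm
  wavelength_pos : 0 < wavelength
  sigmaAv_pos : 0 < sigmaAv

/-- The probability that a link of length `r` is line-of-sight. -/
def losProb (p : Params) (r : ℝ) : ℝ := Real.exp (-p.etaB * r)

/-- The probability that one of the beams of a base station illuminates the target. -/
def beamProb (p : Params) : ℝ := p.Nb * p.thetaB / (2 * Real.pi)

/-- The marks of a base station: whether its link to the target is line-of-sight, whether one of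
its beams illuminates the target, and the bistatic radar cross section of the target that it
sees. -/
abbrev Mark : Type := Bool × Bool × ℝ

/-- The law of the marks of a base station at `x`, for a target at `t`: the three marks are
independent, the first two Bernoulli with parameters `losProb p (dist x t)` and `beamProb p`, the
third exponential with mean `sigmaAv`. (Both parameters lie in `[0, 1]`, so that `projIcc`
changes nothing.) -/
def markLaw (p : Params) (t x : Plane) : Measure Mark :=
  (bernoulliMeasure true false (projIcc (0 : ℝ) 1 zero_le_one (losProb p (dist x t)))).prod
    ((bernoulliMeasure true false (projIcc (0 : ℝ) 1 zero_le_one (beamProb p))).prod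
      (expMeasure p.sigmaAv⁻¹))

/-- The contribution `σᵢ Rᵢ ^ (-α)` of base station `i`, if it has a line-of-sight link to the
target, illuminates the target, and its distance from the target lies in `D`; else `0`. -/
def echoTerm {Ω : Type*} (p : Params) (t : Plane) (X : ℕ → Ω → Plane) (M : ℕ → Ω → Mark)
    (D : Set ℝ) (i : ℕ) (ω : Ω) : ℝ :=
  open Classical in
  if (M i ω).1 = true ∧ (M i ω).2.1 = true ∧ dist (X i ω) t ∈ D then
    (M i ω).2.2 * dist (X i ω) t ^ (-p.alphaL)
  else 0

/-- The power that a sensing base station at distance `r₁` from the target receives through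
reflections at the target from the illuminating line-of-sight base stations whose distance from
the target lies in `D`. -/
def reflectedPower {Ω : Type*} (p : Params) (t : Plane) (X : ℕ → Ω → Plane)
    (M : ℕ → Ω → Mark) (r₁ : ℝ) (D : Set ℝ) (ω : Ω) : ℝ :=
  p.Ps * p.Gm ^ 2 * p.wavelength ^ 2 / ((4 * Real.pi) ^ 3 * r₁ ^ p.alphaL) *
    ∑' i, echoTerm p t X M D i ω

/-- Target-reflected interference from the illuminating line-of-sight base stations in the
exterior of the exclusion disc, whose radius is the distance `R_{Nc+1}` from the target to its
`(Nc+1)`-th nearest base station. -/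
def interferenceExterior {Ω : Type*} (p : Params) (t : Plane) (Nc : ℕ) (X : ℕ → Ω → Plane)
    (M : ℕ → Ω → Mark) (ω : Ω) : ℝ :=
  reflectedPower p t X M (nthDist X t 1 ω) (Ioi (nthDist X t (Nc + 1) ω)) ω

/-- The same interference with the base station on the rim of the exclusion disc, the
`(Nc+1)`-th nearest one, counted as an interferer (if it illuminates the target over
line-of-sight). -/
def interferenceWithRim {Ω : Type*} (p : Params) (t : Plane) (Nc : ℕ) (X : ℕ → Ω → Plane)
    (M : ℕ → Ω → Mark) (ω : Ω) : ℝ :=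
  reflectedPower p t X M (nthDist X t 1 ω) (Ici (nthDist X t (Nc + 1) ω)) ω

/-! ### The explicit expressions -/

/-- `1 - 1 / (1 + s Pₛ Gₘ² λ² σ_av / ((4π)³ r₁^α r^α))`. -/
def lossFactor (p : Params) (r₁ s r : ℝ) : ℝ :=
  1 - 1 / (1 + s * (p.Ps * p.Gm ^ 2 * p.wavelength ^ 2 * p.sigmaAv /
    ((4 * Real.pi) ^ 3 * r₁ ^ p.alphaL * r ^ p.alphaL)))

/-- The generating functional of the interferers at distance at least `ρ` from the target. -/
def pgflFactor (p : Params) (r₁ s ρ : ℝ) : ℝ :=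
  Real.exp (-(p.lamBS * p.Nb * p.thetaB *
    ∫ r in Ioi ρ, losProb p r * lossFactor p r₁ s r * r))

/-- The density of `R_{Nc+1}` given `R_1 = r₁`. -/
def condDensity (p : Params) (Nc : ℕ) (r₁ ρ : ℝ) : ℝ :=
  open Classical in
  if r₁ ≤ ρ then
    2 * (Real.pi * p.lamBS) ^ Nc / (Nat.factorial (Nc - 1)) * (ρ ^ 2 - r₁ ^ 2) ^ (Nc - 1) * ρ *
      Real.exp (-(Real.pi * p.lamBS * (ρ ^ 2 - r₁ ^ 2)))
  else 0

/-- The explicit Laplace transform: the generating functional averaged over the exclusion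
radius. -/
def explicitLT (p : Params) (Nc : ℕ) (r₁ s : ℝ) : ℝ :=
  ∫ ρ in Ioi r₁, pgflFactor p r₁ s ρ * condDensity p Nc r₁ ρ

/-- The explicit Laplace transform with the additional factor for a base station on the rim of
the exclusion disc. -/
def explicitLTWithRim (p : Params) (Nc : ℕ) (r₁ s : ℝ) : ℝ :=
  ∫ ρ in Ioi r₁, (1 - beamProb p * losProb p ρ * lossFactor p r₁ s ρ) *
    pgflFactor p r₁ s ρ * condDensity p Nc r₁ ρ

end ISAC

end

/-!
Thinning by the marks is absorbed into a deterministic cost: averaging `exp (-c σ r ^ (-α))` over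
the independent marks of a base station at distance `r` gives `1 - p_LOS p_beam ℓ`, so Laplace
transforms of the interference are Laplace functionals of the unmarked Poisson process.

The exclusion radius is random, but it depends on the process in the closed disc only. Rounding it
up to a multiple of `2 ^ (-k)` leaves countably many deterministic radii `ρ`. For each of them, by
independence over disjoint sets, the points outside the disc of radius `ρ` are Poisson given those
inside; letting `k → ∞` yields the Laplace functional of the tail beyond `R_n` given `(R_1, R_n)`.

The joint law of `(R_1, R_{n+1})` comes from the counting events `{R_1 > a, R_{n+1} > b}`. Finally
the gain of the sensing base station depends on `R_1`, so the Laplace variable is itself random; it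
is frozen by disintegrating along `(R_1, R_{n+1})`.
-/

noncomputable section

namespace ISAC

open Filter Topology
open scoped ENNReal NNReal

/-- `exp (-x)` for an extended nonnegative real `x`, with `exp (-∞) = 0`. Laplace transforms are
written with it so that sums and integrals need no convergence hypotheses. -/
def expNeg (x : ℝ≥0∞) : ℝ≥0∞ := EReal.exp (-(x : EReal))

@[simp] lemma expNeg_zero : expNeg 0 = 1 := by simp [expNeg]

@[simp] lemma expNeg_top : expNeg ∞ = 0 := by simp [expNeg]

lemma expNeg_ofReal {a : ℝ} (ha : 0 ≤ a) :
    expNeg (ENNReal.ofReal a) = ENNReal.ofReal (Real.exp (-a)) := by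
  rw [expNeg, EReal.coe_ennreal_ofReal, max_eq_left ha, ← EReal.coe_neg, EReal.exp_coe]

lemma expNeg_of_ne_top {x : ℝ≥0∞} (hx : x ≠ ∞) :
    expNeg x = ENNReal.ofReal (Real.exp (-x.toReal)) := by
  conv_lhs => rw [← ENNReal.ofReal_toReal hx]
  exact expNeg_ofReal ENNReal.toReal_nonneg

lemma expNeg_add (x y : ℝ≥0∞) : expNeg (x + y) = expNeg x * expNeg y := by
  rcases eq_or_ne x ∞ with rfl | hx
  · simp
  rcases eq_or_ne y ∞ with rfl | hy
  · simp
  rw [expNeg_of_ne_top (ENNReal.add_ne_top.2 ⟨hx, hy⟩), expNeg_of_ne_top hx, expNeg_of_ne_top hy,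
    ← ENNReal.ofReal_mul (Real.exp_nonneg _), ← Real.exp_add, ENNReal.toReal_add hx hy, neg_add]

lemma expNeg_sum {ι : Type*} (s : Finset ι) (f : ι → ℝ≥0∞) :
    expNeg (∑ i ∈ s, f i) = ∏ i ∈ s, expNeg (f i) := by
  classical
  induction s using Finset.induction_on with
  | empty => simp
  | insert a s ha ih => rw [Finset.sum_insert ha, Finset.prod_insert ha, expNeg_add, ih]

lemma expNeg_natCast_mul (n : ℕ) (c : ℝ≥0∞) : expNeg (n * c) = expNeg c ^ n := by
  simpa using expNeg_sum (Finset.range n) fun _ => c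

lemma continuous_expNeg : Continuous expNeg :=
  ENNReal.continuous_exp.comp (continuous_neg.comp continuous_coe_ennreal_ereal)

@[fun_prop]
lemma measurable_expNeg : Measurable expNeg := continuous_expNeg.measurable

lemma antitone_expNeg : Antitone expNeg := fun _ _ h =>
  EReal.exp_monotone (EReal.neg_le_neg_iff.2 (EReal.coe_ennreal_le_coe_ennreal_iff.2 h))

lemma expNeg_le_one (x : ℝ≥0∞) : expNeg x ≤ 1 := by
  simpa using antitone_expNeg (zero_le (a := x))

lemma expNeg_ne_top (x : ℝ≥0∞) : expNeg x ≠ ∞ :=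
  ne_top_of_le_ne_top ENNReal.one_ne_top (expNeg_le_one x)

lemma tendsto_lintegral_mul_expNeg {Ω : Type*} [MeasurableSpace Ω] {μ : Measure Ω}
    [IsFiniteMeasure μ] {F : Ω → ℝ≥0∞} (hF : Measurable F) (hF1 : ∀ ω, F ω ≤ 1)
    {g : ℕ → Ω → ℝ≥0∞} {G : Ω → ℝ≥0∞} (hg : ∀ n, Measurable (g n))
    (h : ∀ᵐ ω ∂μ, Tendsto (fun n => g n ω) atTop (𝓝 (G ω))) :
    Tendsto (fun n => ∫⁻ ω, F ω * expNeg (g n ω) ∂μ) atTop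
      (𝓝 (∫⁻ ω, F ω * expNeg (G ω) ∂μ)) := by
  refine tendsto_lintegral_of_dominated_convergence (fun _ => 1)
    (fun n => hF.mul (measurable_expNeg.comp (hg n)))
    (fun n => Eventually.of_forall fun ω => mul_le_one' (hF1 ω) (expNeg_le_one _)) (by simp) ?_
  filter_upwards [h] with ω hω
  exact ENNReal.Tendsto.const_mul ((continuous_expNeg.tendsto _).comp hω)
    (Or.inr (ne_top_of_le_ne_top ENNReal.one_ne_top (hF1 ω)))

section Points

variable {Ω E : Type*}

/-- The sum `∑ f x` over the points `x` of the point process `X`, with multiplicity: the integral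
of `f` against the random counting measure that `X` enumerates. -/
def pointSum (X : ℕ → Ω → E) (f : E → ℝ≥0∞) (ω : Ω) : ℝ≥0∞ := ∑' i, f (X i ω)

lemma pointSum_add (X : ℕ → Ω → E) (f g : E → ℝ≥0∞) (ω : Ω) :
    pointSum X (f + g) ω = pointSum X f ω + pointSum X g ω :=
  ENNReal.tsum_add

lemma pointSum_mono (X : ℕ → Ω → E) {f g : E → ℝ≥0∞} (h : f ≤ g) (ω : Ω) :
    pointSum X f ω ≤ pointSum X g ω :=
  ENNReal.tsum_le_tsum fun i => h (X i ω)

lemma pointSum_iSup (X : ℕ → Ω → E) {f : ℕ → E → ℝ≥0∞} (hf : Monotone f) (ω : Ω) :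
    pointSum X (fun x => ⨆ n, f n x) ω = ⨆ n, pointSum X (f n) ω := by
  simp only [pointSum, ← lintegral_count]
  exact lintegral_iSup (fun _ => measurable_of_countable _) fun n m h i => hf h (X i ω)

lemma toENNReal_pointCount (X : ℕ → Ω → E) (B : Set E) (ω : Ω) :
    (pointCount X B ω : ℝ≥0∞) = pointSum X (B.indicator 1) ω := by
  rw [pointCount, ← ENNReal.tsum_set_one, tsum_subtype {i | X i ω ∈ B} fun _ => (1 : ℝ≥0∞),
    pointSum]
  exact tsum_congr fun i => rfl

lemma pointSum_indicator_const (X : ℕ → Ω → E) (B : Set E) (c : ℝ≥0∞) (ω : Ω) :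
    pointSum X (B.indicator fun _ => c) ω = pointCount X B ω * c := by
  rw [toENNReal_pointCount, pointSum, pointSum, ← ENNReal.tsum_mul_right]
  refine tsum_congr fun i => ?_
  by_cases h : X i ω ∈ B <;> simp [h]

lemma pointCount_mono (X : ℕ → Ω → E) {A B : Set E} (h : A ⊆ B) (ω : Ω) :
    pointCount X A ω ≤ pointCount X B ω :=
  Set.encard_le_encard fun _ hi => h hi

/-- The atom of the algebra generated by the sets `B i` that is selected by the truth values
`c i`. Points outside all of the sets are discarded, so that an atom has finite measure when the
sets have. -/
def atomSet {ι : Type*} (B : ι → Set E) (c : ι → Prop) : Set E :=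
  {x | (∃ i, x ∈ B i) ∧ ∀ i, x ∈ B i ↔ c i}

lemma pairwise_disjoint_atomSet {ι : Type*} (B : ι → Set E) :
    Pairwise fun c d => Disjoint (atomSet B c) (atomSet B d) := fun _ _ hcd =>
  Set.disjoint_left.2 fun _ hc hd => hcd (funext fun i => propext ((hc.2 i).symm.trans (hd.2 i)))

lemma atomSet_subset_iUnion {ι : Type*} (B : ι → Set E) (c : ι → Prop) :
    atomSet B c ⊆ ⋃ i, B i := fun _ hx => mem_iUnion.2 hx.1

open Classical in
lemma indicator_eq_sum_atomSet {ι : Type*} [Fintype ι] (B : ι → Set E) (i : ι) (x : E) :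
    (B i).indicator (1 : E → ℝ≥0∞) x =
      ∑ c : ι → Prop with c i, (atomSet B c).indicator 1 x := by
  by_cases hx : x ∈ B i
  · have hmem : x ∈ atomSet B fun j => x ∈ B j := ⟨⟨i, hx⟩, fun _ => Iff.rfl⟩
    rw [Finset.sum_eq_single fun j => x ∈ B j, indicator_of_mem hx, indicator_of_mem hmem]
    · exact fun c _ hc => indicator_of_notMem
        (fun h => hc (funext fun j => propext (h.2 j).symm)) _
    · simp [hx]
  · rw [indicator_of_notMem hx, Finset.sum_eq_zero]
    exact fun c hc => indicator_of_notMem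
      (fun h => hx ((h.2 i).2 (Finset.mem_filter.1 hc).2)) _

open Classical in
lemma pointCount_eq_sum_atomSet {ι : Type*} [Fintype ι] (X : ℕ → Ω → E) (B : ι → Set E) (i : ι)
    (ω : Ω) :
    pointCount X (B i) ω = ∑ c : ι → Prop with c i, pointCount X (atomSet B c) ω := by
  rw [← ENat.toENNReal_inj]
  trans ∑ c : ι → Prop with c i, (pointCount X (atomSet B c) ω : ℝ≥0∞)
  · simp only [toENNReal_pointCount, pointSum, indicator_eq_sum_atomSet B i]
    exact Summable.tsum_finsetSum fun _ _ => ENNReal.summable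
  · exact (map_sum ENat.toENNRealRingHom _ _).symm

lemma measurable_iSup_comap_pointCount {ι κ : Type*} [Finite ι] (X : ℕ → Ω → E) (B : ι → Set E)
    {G : κ → Set E} {S : Set κ} (hG : ∀ c, ∃ k ∈ S, G k = atomSet B c) :
    Measurable[⨆ k ∈ S, MeasurableSpace.comap (pointCount X (G k)) ⊤]
      fun ω i => pointCount X (B i) ω := by
  classical
  have := Fintype.ofFinite ι
  let m : MeasurableSpace Ω := ⨆ k ∈ S, MeasurableSpace.comap (pointCount X (G k)) ⊤
  change Measurable fun ω i => pointCount X (B i) ω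
  refine measurable_pi_lambda _ fun i => ?_
  simp only [pointCount_eq_sum_atomSet X B i]
  refine Finset.measurable_sum _ fun c _ => ?_
  obtain ⟨k, hk, hGk⟩ := hG c
  rw [← hGk]
  exact (comap_measurable _).mono (le_iSup₂_of_le k hk le_rfl) le_top

/-- The `σ`-algebra of the process inside `V`: it is generated by the numbers of points in the
subsets of `V` of finite intensity. -/
@[reducible] def countAlgebra [MeasurableSpace E] (Λ : Measure E) (X : ℕ → Ω → E) (V : Set E) :
    MeasurableSpace Ω :=
  MeasurableSpace.comap
    (fun ω (B : {B : Set E // MeasurableSet B ∧ B ⊆ V ∧ Λ B ≠ ∞}) => pointCount X B ω)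
    MeasurableSpace.pi

lemma measurable_countAlgebra_pointCount [MeasurableSpace E] {Λ : Measure E} {X : ℕ → Ω → E}
    {B V : Set E} (hB : MeasurableSet B) (hBV : B ⊆ V) (hΛ : Λ B ≠ ∞) :
    Measurable[countAlgebra Λ X V] (pointCount X B) :=
  (measurable_pi_apply (⟨B, hB, hBV, hΛ⟩ : {B : Set E // MeasurableSet B ∧ B ⊆ V ∧ Λ B ≠ ∞})).comp
    (comap_measurable fun ω (B : {B : Set E // MeasurableSet B ∧ B ⊆ V ∧ Λ B ≠ ∞}) =>
      pointCount X B ω)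

variable [MeasurableSpace Ω] [MeasurableSpace E] {μ : Measure Ω} {Λ : Measure E} {X : ℕ → Ω → E}

lemma measurable_pointSum (hX : ∀ i, Measurable (X i)) {f : E → ℝ≥0∞} (hf : Measurable f) :
    Measurable (pointSum X f) :=
  Measurable.tsum fun i => hf.comp (hX i)

lemma measurable_pointCount (hX : ∀ i, Measurable (X i)) {B : Set E} (hB : MeasurableSet B) :
    Measurable (pointCount X B) :=
  measurable_encard.comp (measurable_set_iff.2 fun i => hB.mem.comp (hX i))

lemma measurableSet_atomSet {ι : Type*} [Finite ι] {B : ι → Set E} (hB : ∀ i, MeasurableSet (B i))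
    (c : ι → Prop) : MeasurableSet (atomSet B c) :=
  (Measurable.exists fun i => (hB i).mem).setOf.inter
    (Measurable.forall fun i => (hB i).mem.iff measurable_const).setOf

lemma measure_atomSet_ne_top {ι : Type*} [Finite ι] {B : ι → Set E} (hB : ∀ i, Λ (B i) ≠ ∞)
    (c : ι → Prop) : Λ (atomSet B c) ≠ ∞ :=
  have := Fintype.ofFinite ι
  ne_top_of_le_ne_top (ENNReal.sum_ne_top.2 fun i (_ : i ∈ Finset.univ) => hB i)
    ((measure_mono (atomSet_subset_iUnion B c)).trans (measure_iUnion_fintype_le Λ B))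

lemma IsPoissonPointProcess.iIndepFun_pointCount (hX : IsPoissonPointProcess μ Λ X) {ι : Type*}
    [Finite ι] {B : ι → Set E} (hB : ∀ i, MeasurableSet (B i)) (hΛ : ∀ i, Λ (B i) ≠ ∞)
    (hd : Pairwise fun i j => Disjoint (B i) (B j)) :
    iIndepFun (fun i => pointCount X (B i)) μ := by
  obtain ⟨n, ⟨e⟩⟩ := Finite.exists_equiv_fin ι
  have h := hX.count_indep n (fun k => B (e.symm k)) (fun _ => hB _) (fun _ => hΛ _)
    fun k l hkl => hd (e.symm.injective.ne hkl)
  simpa using h.precomp e.injective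

lemma IsPoissonPointProcess.indepFun_pointCount_of_disjoint (hX : IsPoissonPointProcess μ Λ X)
    {ι κ : Type*} [Finite ι] [Finite κ] {A : ι → Set E} {B : κ → Set E}
    (hA : ∀ i, MeasurableSet (A i)) (hB : ∀ i, MeasurableSet (B i)) (hΛA : ∀ i, Λ (A i) ≠ ∞)
    (hΛB : ∀ i, Λ (B i) ≠ ∞) (hd : ∀ i j, Disjoint (A i) (B j)) :
    IndepFun (fun ω i => pointCount X (A i) ω) (fun ω j => pointCount X (B j) ω) μ := by
  have := Fintype.ofFinite ι
  have := Fintype.ofFinite κ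
  let G : (ι → Prop) ⊕ (κ → Prop) → Set E := Sum.elim (atomSet A) (atomSet B)
  have hGm : ∀ k, MeasurableSet (G k) :=
    Sum.rec (measurableSet_atomSet hA) (measurableSet_atomSet hB)
  have hAB : ∀ c d, Disjoint (atomSet A c) (atomSet B d) := fun c d =>
    (disjoint_iUnion_left.2 fun i => disjoint_iUnion_right.2 (hd i)).mono
      (atomSet_subset_iUnion A c) (atomSet_subset_iUnion B d)
  have hGd : Pairwise fun k l => Disjoint (G k) (G l) := by
    rintro (c | c) (d | d) hcd
    · exact pairwise_disjoint_atomSet A fun h => hcd (congrArg _ h)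
    · exact hAB c d
    · exact (hAB d c).symm
    · exact pairwise_disjoint_atomSet B fun h => hcd (congrArg _ h)
  have hG := hX.iIndepFun_pointCount hGm
    (Sum.rec (measure_atomSet_ne_top hΛA) (measure_atomSet_ne_top hΛB)) hGd
  refine (IndepFun_iff_Indep _ _ μ).2 (indep_of_indep_of_le_left (indep_of_indep_of_le_right
    (indep_iSup_of_disjoint (fun k => (measurable_pointCount hX.measurable (hGm k)).comap_le)
      hG isCompl_range_inl_range_inr.disjoint) ?_) ?_)
  · exact (measurable_iSup_comap_pointCount X B (G := G) fun d =>
      ⟨_, mem_range_self d, rfl⟩).comap_le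
  · exact (measurable_iSup_comap_pointCount X A (G := G) fun c =>
      ⟨_, mem_range_self c, rfl⟩).comap_le

lemma countAlgebra_le (hX : ∀ i, Measurable (X i)) (V : Set E) :
    countAlgebra Λ X V ≤ ‹MeasurableSpace Ω› :=
  Measurable.comap_le (measurable_pi_lambda _ fun B => measurable_pointCount hX B.2.1)

lemma IsPoissonPointProcess.indep_countAlgebra [IsProbabilityMeasure μ]
    (hX : IsPoissonPointProcess μ Λ X) {U V : Set E} (hd : Disjoint U V) :
    Indep (countAlgebra Λ X U) (countAlgebra Λ X V) μ :=
  IndepFun.process_indepFun_process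
    (X := fun (B : {B : Set E // MeasurableSet B ∧ B ⊆ U ∧ Λ B ≠ ∞}) ω => pointCount X B ω)
    (Y := fun (B : {B : Set E // MeasurableSet B ∧ B ⊆ V ∧ Λ B ≠ ∞}) ω => pointCount X B ω)
    (fun B => measurable_pointCount hX.measurable B.2.1)
    (fun B => measurable_pointCount hX.measurable B.2.1) fun _ _ =>
      hX.indepFun_pointCount_of_disjoint (fun i => i.1.2.1) (fun j => j.1.2.1)
        (fun i => i.1.2.2.2) (fun j => j.1.2.2.2) fun i j => hd.mono i.1.2.2.1 j.1.2.2.1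

end Points

lemma lintegral_pow_poissonMeasure (r q : ℝ≥0) :
    ∫⁻ n, (q : ℝ≥0∞) ^ n ∂poissonMeasure r = ENNReal.ofReal (Real.exp (-(r * (1 - q)))) := by
  have hsum : HasSum (fun n : ℕ => Real.exp (-r) * ((r * q : ℝ) ^ n / n.factorial))
      (Real.exp (-r) * Real.exp (r * q)) := by
    have h := NormedSpace.expSeries_div_hasSum_exp (r * q : ℝ)
    rw [← Real.exp_eq_exp_ℝ] at h
    exact h.mul_left _
  have hterm (n : ℕ) : (q : ℝ≥0∞) ^ n * poissonMeasure r {n} =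
      ENNReal.ofReal (Real.exp (-r) * ((r * q : ℝ) ^ n / n.factorial)) := by
    rw [poissonMeasure_singleton, ← ENNReal.ofReal_coe_nnreal, ← ENNReal.ofReal_pow q.coe_nonneg,
      ← ENNReal.ofReal_mul (by positivity)]
    ring_nf
  rw [lintegral_countable', tsum_congr hterm,
    ← ENNReal.ofReal_tsum_of_nonneg (fun n => by positivity) hsum.summable, hsum.tsum_eq,
    ← Real.exp_add]
  ring_nf

section Laplace

variable {Ω E : Type*} [MeasurableSpace E] {Λ : Measure E}

lemma iSup_indicator_spanningSets (Λ : Measure E) [SigmaFinite Λ] (f : E → ℝ≥0∞) :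
    (fun x => ⨆ n, (spanningSets Λ n).indicator f x) = f := by
  ext x
  refine le_antisymm (iSup_le fun n => indicator_le_self _ _ _) ?_
  refine le_iSup_of_le (spanningSetsIndex Λ x) ?_
  rw [indicator_of_mem (mem_spanningSetsIndex Λ x)]

lemma monotone_indicator_spanningSets (Λ : Measure E) [SigmaFinite Λ] (f : E → ℝ≥0∞) :
    Monotone fun n => (spanningSets Λ n).indicator f := fun _ _ h =>
  indicator_le_indicator_of_subset (monotone_spanningSets Λ h) fun _ => zero_le

lemma measure_spanningSets_inter_ne_top (Λ : Measure E) [SigmaFinite Λ] (n : ℕ) (B : Set E) :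
    Λ (spanningSets Λ n ∩ B) ≠ ∞ :=
  measure_ne_top_of_subset inter_subset_left (measure_spanningSets_lt_top Λ n).ne

lemma measurable_countAlgebra_pointSum_indicator_const [SigmaFinite Λ] (X : ℕ → Ω → E)
    {B V : Set E} (hB : MeasurableSet B) (hBV : B ⊆ V) (c : ℝ≥0∞) :
    Measurable[countAlgebra Λ X V] (pointSum X (B.indicator fun _ => c)) := by
  have hsum : pointSum X (B.indicator fun _ => c) = fun ω =>
      ⨆ n, (pointCount X (spanningSets Λ n ∩ B) ω : ℝ≥0∞) * c := by
    ext ω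
    conv_lhs => rw [← iSup_indicator_spanningSets Λ (B.indicator fun _ => c)]
    rw [pointSum_iSup X (monotone_indicator_spanningSets Λ _)]
    simp only [indicator_indicator, pointSum_indicator_const]
  rw [hsum]
  refine Measurable.iSup fun n => Measurable.mul_const ?_ _
  exact (measurable_of_countable fun n : ℕ∞ => (n : ℝ≥0∞)).comp
    (measurable_countAlgebra_pointCount ((measurableSet_spanningSets Λ n).inter hB)
      (inter_subset_right.trans hBV) (measure_spanningSets_inter_ne_top Λ n B))

lemma measurable_countAlgebra_pointSum [SigmaFinite Λ] (X : ℕ → Ω → E) {V : Set E}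
    (hV : MeasurableSet V) {f : E → ℝ≥0∞} (hf : Measurable f) :
    Measurable[countAlgebra Λ X V] (pointSum X (V.indicator f)) := by
  refine Measurable.ennreal_induction (fun c B hB => ?_) (fun f g _ _ _ hf hg => ?_)
    (fun f _ hm hf => ?_) hf
  · rw [indicator_indicator]
    exact measurable_countAlgebra_pointSum_indicator_const X (hV.inter hB) inter_subset_left c
  · rw [indicator_add', funext (pointSum_add X _ _)]
    exact hf.add hg
  · have hsup : V.indicator (fun x => ⨆ n, f n x) = fun x => ⨆ n, V.indicator (f n) x := by
      ext x
      by_cases hx : x ∈ V <;> simp [hx]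
    have hmono : Monotone fun n => V.indicator (f n) := fun n m hnm x =>
      indicator_le_indicator (hm hnm x)
    rw [hsup, funext (pointSum_iSup X hmono)]
    exact Measurable.iSup hf

variable [MeasurableSpace Ω] {μ : Measure Ω} [IsProbabilityMeasure μ] {X : ℕ → Ω → E}

lemma IsPoissonPointProcess.map_pointCount (hX : IsPoissonPointProcess μ Λ X) {B : Set E}
    (hB : MeasurableSet B) (hΛ : Λ B ≠ ∞) :
    μ.map (pointCount X B) = (poissonMeasure (Λ B).toNNReal).map (Nat.cast : ℕ → ℕ∞) := by
  have hm := measurable_pointCount hX.measurable hB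
  have hc : Measurable (Nat.cast : ℕ → ℕ∞) := measurable_of_countable _
  have := Measure.isProbabilityMeasure_map (μ := μ) hm.aemeasurable
  have := Measure.isProbabilityMeasure_map (μ := poissonMeasure (Λ B).toNNReal) hc.aemeasurable
  have hnat (n : ℕ) : μ.map (pointCount X B) {(n : ℕ∞)} =
      (poissonMeasure (Λ B).toNNReal).map (Nat.cast : ℕ → ℕ∞) {(n : ℕ∞)} := by
    rw [Measure.map_apply hm (measurableSet_singleton _),
      Measure.map_apply hc (measurableSet_singleton _),
      show (Nat.cast : ℕ → ℕ∞) ⁻¹' {(n : ℕ∞)} = {n} by ext; simp]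
    exact hX.count_law B hB hΛ n
  have hrange : ({⊤}ᶜ : Set ℕ∞) = ⋃ n : ℕ, {(n : ℕ∞)} := by
    ext a
    simp only [mem_compl_iff, mem_singleton_iff, ENat.ne_top_iff_exists, mem_iUnion, eq_comm]
  refine Measure.ext_iff_singleton.2 fun a => ?_
  induction a with
  | coe n => exact hnat n
  | top =>
    rw [← compl_compl {⊤}, prob_compl_eq_one_sub (measurableSet_singleton _).compl,
      prob_compl_eq_one_sub (measurableSet_singleton _).compl, hrange,
      measure_iUnion (fun _ _ h => by simpa using h) fun _ => measurableSet_singleton _,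
      measure_iUnion (fun _ _ h => by simpa using h) fun _ => measurableSet_singleton _,
      tsum_congr hnat]

lemma IsPoissonPointProcess.ae_pointCount_ne_top (hX : IsPoissonPointProcess μ Λ X) {B : Set E}
    (hB : MeasurableSet B) (hΛ : Λ B ≠ ∞) : ∀ᵐ ω ∂μ, pointCount X B ω ≠ ⊤ := by
  refine ae_of_ae_map (measurable_pointCount hX.measurable hB).aemeasurable (p := (· ≠ ⊤)) ?_
  rw [hX.map_pointCount hB hΛ,
    ae_map_iff (measurable_of_countable _).aemeasurable (MeasurableSet.of_discrete)]
  exact Eventually.of_forall ENat.natCast_ne_top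

lemma IsPoissonPointProcess.lintegral_expNeg_pointCount (hX : IsPoissonPointProcess μ Λ X)
    {B : Set E} (hB : MeasurableSet B) (hΛ : Λ B ≠ ∞) (c : ℝ≥0∞) :
    ∫⁻ ω, expNeg (pointCount X B ω * c) ∂μ = expNeg (Λ B * (1 - expNeg c)) := by
  have hmap := lintegral_map (μ := μ) (f := fun n : ℕ∞ => expNeg (n * c))
    (measurable_of_countable _) (measurable_pointCount hX.measurable hB)
  rw [← hmap, hX.map_pointCount hB hΛ,
    lintegral_map (measurable_of_countable _) (measurable_of_countable _)]
  lift Λ B to ℝ≥0 using hΛ with r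
  lift expNeg c to ℝ≥0 using expNeg_ne_top c with q hq
  have hq1 : q ≤ 1 := by exact_mod_cast hq ▸ expNeg_le_one c
  simp only [ENat.toENNReal_coe, expNeg_natCast_mul, ← hq, ENNReal.toNNReal_coe]
  rw [lintegral_pow_poissonMeasure, ← ENNReal.coe_one, ← ENNReal.coe_sub, ← ENNReal.coe_mul,
    ← ENNReal.ofReal_coe_nnreal, expNeg_ofReal (NNReal.coe_nonneg _), NNReal.coe_mul,
    NNReal.coe_sub hq1, NNReal.coe_one]

lemma lintegral_expNeg_pointSum_iSup (hX : ∀ i, Measurable (X i)) {f : ℕ → E → ℝ≥0∞}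
    (hf : ∀ n, Measurable (f n)) (hm : Monotone f)
    (h : ∀ n, ∫⁻ ω, expNeg (pointSum X (f n) ω) ∂μ = expNeg (∫⁻ x, (1 - expNeg (f n x)) ∂Λ)) :
    ∫⁻ ω, expNeg (pointSum X (fun x => ⨆ n, f n x) ω) ∂μ =
      expNeg (∫⁻ x, (1 - expNeg (⨆ n, f n x)) ∂Λ) := by
  have hleft : Tendsto (fun n => ∫⁻ ω, expNeg (pointSum X (f n) ω) ∂μ) atTop
      (𝓝 (∫⁻ ω, expNeg (pointSum X (fun x => ⨆ n, f n x) ω) ∂μ)) := by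
    simpa using tendsto_lintegral_mul_expNeg (F := fun _ => 1) measurable_const (fun _ => le_rfl)
      (fun n => measurable_pointSum hX (hf n)) (Eventually.of_forall fun ω => by
        rw [pointSum_iSup X hm]
        exact tendsto_atTop_iSup fun n m hnm => pointSum_mono X (hm hnm) ω)
  have hright : Tendsto (fun n => expNeg (∫⁻ x, (1 - expNeg (f n x)) ∂Λ)) atTop
      (𝓝 (expNeg (∫⁻ x, (1 - expNeg (⨆ n, f n x)) ∂Λ))) := by
    refine (continuous_expNeg.tendsto _).comp (lintegral_tendsto_of_tendsto_of_monotone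
      (fun n => (measurable_const.sub (measurable_expNeg.comp (hf n))).aemeasurable)
      (Eventually.of_forall fun x n m hnm => tsub_le_tsub_left (antitone_expNeg (hm hnm x)) _)
      (Eventually.of_forall fun x => ?_))
    exact ENNReal.Tendsto.sub tendsto_const_nhds ((continuous_expNeg.tendsto _).comp
      (tendsto_atTop_iSup fun n m hnm => hm hnm x)) (Or.inl ENNReal.one_ne_top)
  simp only [h] at hleft
  exact tendsto_nhds_unique hleft hright

lemma IsPoissonPointProcess.lintegral_expNeg_pointSum_indicator_const [SigmaFinite Λ]
    (hX : IsPoissonPointProcess μ Λ X) (c : ℝ≥0∞) {B : Set E} (hB : MeasurableSet B) :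
    ∫⁻ ω, expNeg (pointSum X (B.indicator fun _ => c) ω) ∂μ =
      expNeg (∫⁻ x, (1 - expNeg (B.indicator (fun _ => c) x)) ∂Λ) := by
  rw [← iSup_indicator_spanningSets Λ (B.indicator fun _ => c)]
  refine lintegral_expNeg_pointSum_iSup hX.measurable (fun n =>
    (measurable_const.indicator hB).indicator (measurableSet_spanningSets Λ n))
    (monotone_indicator_spanningSets Λ _) fun n => ?_
  have hn := (measurableSet_spanningSets Λ n).inter hB
  have hloss : (fun x => 1 - expNeg ((spanningSets Λ n ∩ B).indicator (fun _ => c) x)) =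
      (spanningSets Λ n ∩ B).indicator fun _ => 1 - expNeg c := by
    ext x
    by_cases hx : x ∈ spanningSets Λ n ∩ B <;> simp [hx]
  simp only [indicator_indicator, pointSum_indicator_const]
  rw [hX.lintegral_expNeg_pointCount hn (measure_spanningSets_inter_ne_top Λ n B), hloss,
    lintegral_indicator_const hn, mul_comm]

lemma IsPoissonPointProcess.lintegral_mul_expNeg_pointSum_of_disjoint [SigmaFinite Λ]
    (hX : IsPoissonPointProcess μ Λ X) {U V : Set E} (hd : Disjoint U V) (hV : MeasurableSet V)
    {F : Ω → ℝ≥0∞} (hF : Measurable[countAlgebra Λ X U] F) {f : E → ℝ≥0∞} (hf : Measurable f) :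
    ∫⁻ ω, F ω * expNeg (pointSum X (V.indicator f) ω) ∂μ =
      (∫⁻ ω, F ω ∂μ) * ∫⁻ ω, expNeg (pointSum X (V.indicator f) ω) ∂μ :=
  lintegral_mul_eq_lintegral_mul_lintegral_of_independent_measurableSpace
    (countAlgebra_le hX.measurable U) (countAlgebra_le hX.measurable V) (hX.indep_countAlgebra hd)
    hF (measurable_expNeg.comp (measurable_countAlgebra_pointSum X hV hf))

theorem IsPoissonPointProcess.lintegral_expNeg_pointSum [SigmaFinite Λ]
    (hX : IsPoissonPointProcess μ Λ X) {f : E → ℝ≥0∞} (hf : Measurable f) :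
    ∫⁻ ω, expNeg (pointSum X f ω) ∂μ = expNeg (∫⁻ x, (1 - expNeg (f x)) ∂Λ) := by
  refine Measurable.ennreal_induction (fun c B => hX.lintegral_expNeg_pointSum_indicator_const c)
    (fun f g hd hf hg ihf ihg => ?_)
    (fun f hf hm => lintegral_expNeg_pointSum_iSup hX.measurable hf hm) hf
  set U := Function.support f
  have hU : MeasurableSet U := measurableSet_support hf
  have hfU : U.indicator f = f := indicator_support
  have hgU : Uᶜ.indicator g = g := indicator_eq_self.2 (subset_compl_iff_disjoint_left.2 hd)
  have hsplit (x : E) : 1 - expNeg ((f + g) x) = (1 - expNeg (f x)) + (1 - expNeg (g x)) := by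
    by_cases hx : f x = 0
    · simp [hx]
    · simp [show g x = 0 from not_not.1 (Set.disjoint_left.1 hd hx)]
  have hindep := hX.lintegral_mul_expNeg_pointSum_of_disjoint disjoint_compl_right hU.compl
    (measurable_expNeg.comp (measurable_countAlgebra_pointSum X hU hf)) hg
  simp only [Function.comp_apply, hfU, hgU] at hindep
  simp only [pointSum_add, expNeg_add, hindep, ihf, ihg, hsplit]
  rw [← expNeg_add, ← lintegral_add_left (by fun_prop)]

end Laplace

section Marks

variable {Ω E S : Type*} [MeasurableSpace Ω] [MeasurableSpace E] [MeasurableSpace S]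

lemma lintegral_pi_prod {ι : Type*} [Fintype ι] (ν : ι → Measure S)
    [∀ i, IsProbabilityMeasure (ν i)] {q : ι → S → ℝ≥0∞} (hq : ∀ i, Measurable (q i)) :
    ∫⁻ m, ∏ i, q i (m i) ∂Measure.pi ν = ∏ i, ∫⁻ m, q i m ∂ν i := by
  have hind := iIndepFun_pi (μ := ν) (X := q) fun i => (hq i).aemeasurable
  rw [lintegral_prod_eq_prod_lintegral_of_indepFun Finset.univ _ hind
    fun i => (hq i).comp (measurable_pi_apply i)]
  refine Finset.prod_congr rfl fun i _ => ?_
  exact (measurePreserving_eval ν i).lintegral_comp (hq i)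

/-- The law of the first `n` marks given the points, for a mark distribution `K`: the kernel form
of independent marking. -/
def markKernel (K : Kernel E S) [IsMarkovKernel K] (n : ℕ) : Kernel (ℕ → E) (Fin n → S) where
  toFun x := Measure.pi fun i => K (x i)
  measurable' := by
    refine Measurable.measure_of_isPiSystem_of_isProbabilityMeasure generateFrom_pi.symm
      isPiSystem_pi ?_
    rintro _ ⟨B, hB, rfl⟩
    simp_rw [Measure.pi_pi]
    refine Finset.measurable_prod _ fun i _ => ?_
    exact (K.measurable_coe (hB i trivial)).comp (measurable_pi_apply _)

instance (K : Kernel E S) [IsMarkovKernel K] (n : ℕ) : IsMarkovKernel (markKernel K n) :=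
  ⟨fun x => inferInstanceAs (IsProbabilityMeasure (Measure.pi fun i : Fin n => K (x i)))⟩

variable {μ : Measure Ω} [IsProbabilityMeasure μ] {X : ℕ → Ω → E} {M : ℕ → Ω → S}
  {K : Kernel E S} [IsMarkovKernel K]

lemma IsIndependentMarking.map_eq_compProd (hX : ∀ i, Measurable (X i))
    (hM : IsIndependentMarking μ X K M) (n : ℕ) :
    μ.map (fun ω => ((fun i => X i ω), (fun i : Fin n => M i ω))) =
      (μ.map fun ω i => X i ω) ⊗ₘ markKernel K n := by
  have hXm : Measurable fun ω i => X i ω := measurable_pi_lambda _ hX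
  have hMm : Measurable fun ω (i : Fin n) => M i ω :=
    measurable_pi_lambda _ fun i => hM.measurable i
  have : IsProbabilityMeasure (μ.map fun ω i => X i ω) :=
    Measure.isProbabilityMeasure_map hXm.aemeasurable
  have : IsProbabilityMeasure (μ.map (fun ω => ((fun i => X i ω), (fun i : Fin n => M i ω)))) :=
    Measure.isProbabilityMeasure_map (hXm.prodMk hMm).aemeasurable
  refine ext_of_generate_finite _ (generateFrom_eq_prod MeasurableSpace.generateFrom_measurableSet
    (generateFrom_pi (α := fun _ : Fin n => S)) isCountablySpanning_measurableSet
    (IsCountablySpanning.pi fun _ => isCountablySpanning_measurableSet)).symm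
    (MeasurableSpace.isPiSystem_measurableSet.prod isPiSystem_pi) ?_ (by simp)
  rintro _ ⟨A, hA : MeasurableSet A, _, ⟨B, hB, rfl⟩, rfl⟩
  have hB' : MeasurableSet (univ.pi B) := MeasurableSet.univ_pi fun i => hB i trivial
  have hjoint := hM.joint_law A hA (Finset.range n)
    (fun i => if h : i < n then B ⟨i, h⟩ else univ) fun i => by
      split_ifs with h
      exacts [hB _ trivial, MeasurableSet.univ]
  rw [Measure.map_apply (hXm.prodMk hMm) (hA.prod hB'), Measure.compProd_apply_prod hA hB',
    setLIntegral_map hA ((markKernel K n).measurable_coe hB') hXm]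
  convert hjoint using 1
  · congr 1
    ext ω
    simp only [mem_preimage, mem_prod, mem_univ_pi, mem_ofPred_eq, Finset.mem_range]
    refine and_congr_right fun _ => ⟨fun h i hi => ?_, fun h i => ?_⟩
    · simpa [hi] using h ⟨i, hi⟩
    · simpa using h i i.2
  · refine lintegral_congr fun ω => ?_
    change Measure.pi _ _ = _
    rw [Measure.pi_pi, Finset.prod_range]
    simp

lemma IsIndependentMarking.lintegral_mul_prod (hX : ∀ i, Measurable (X i))
    (hM : IsIndependentMarking μ X K M) {F : (ℕ → E) → ℝ≥0∞} (hF : Measurable F)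
    {q : ℕ → (ℕ → E) → S → ℝ≥0∞} (hq : ∀ i, Measurable (Function.uncurry (q i))) (n : ℕ) :
    ∫⁻ ω, F (fun j => X j ω) * ∏ i ∈ Finset.range n, q i (fun j => X j ω) (M i ω) ∂μ =
      ∫⁻ ω, F (fun j => X j ω) *
        ∏ i ∈ Finset.range n, ∫⁻ m, q i (fun j => X j ω) m ∂K (X i ω) ∂μ := by
  have hXm : Measurable fun ω i => X i ω := measurable_pi_lambda _ hX
  have hMm : Measurable fun ω (i : Fin n) => M i ω :=
    measurable_pi_lambda _ fun i => hM.measurable i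
  have hG : Measurable fun z : (ℕ → E) × (Fin n → S) => F z.1 * ∏ i : Fin n, q i z.1 (z.2 i) := by
    refine (hF.comp measurable_fst).mul (Finset.measurable_prod _ fun i _ => ?_)
    exact (hq i).comp (measurable_fst.prodMk ((measurable_pi_apply i).comp measurable_snd))
  have h1 := lintegral_map (μ := μ) hG (hXm.prodMk hMm)
  rw [hM.map_eq_compProd hX, Measure.lintegral_compProd hG, lintegral_map
    hG.lintegral_kernel_prod_right' hXm] at h1
  simp_rw [Finset.prod_range]
  rw [← h1]
  refine lintegral_congr fun ω => ?_
  dsimp only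
  rw [lintegral_const_mul]
  · congr 1
    exact lintegral_pi_prod _ fun i => (hq i).comp measurable_prodMk_left
  · exact Finset.measurable_prod _ fun i _ =>
      (hq i).comp (measurable_prodMk_left.comp (measurable_pi_apply i))

theorem IsIndependentMarking.lintegral_mul_expNeg_tsum (hX : ∀ i, Measurable (X i))
    (hM : IsIndependentMarking μ X K M) {F : (ℕ → E) → ℝ≥0∞} (hF : Measurable F)
    (hF1 : ∀ x, F x ≤ 1)
    {a : ℕ → (ℕ → E) → S → ℝ≥0∞} (ha : ∀ i, Measurable (Function.uncurry (a i)))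
    {h : ℕ → (ℕ → E) → ℝ≥0∞} (hm : ∀ i, Measurable (h i))
    (hah : ∀ i x, ∫⁻ m, expNeg (a i x m) ∂K (x i) = expNeg (h i x)) :
    ∫⁻ ω, F (fun j => X j ω) * expNeg (∑' i, a i (fun j => X j ω) (M i ω)) ∂μ =
      ∫⁻ ω, F (fun j => X j ω) * expNeg (∑' i, h i (fun j => X j ω)) ∂μ := by
  have hXm : Measurable fun ω i => X i ω := measurable_pi_lambda _ hX
  have hpartial (n : ℕ) : ∫⁻ ω, F (fun j => X j ω) *
        expNeg (∑ i ∈ Finset.range n, a i (fun j => X j ω) (M i ω)) ∂μ =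
      ∫⁻ ω, F (fun j => X j ω) * expNeg (∑ i ∈ Finset.range n, h i (fun j => X j ω)) ∂μ := by
    simp only [expNeg_sum, ← hah]
    exact hM.lintegral_mul_prod hX hF (q := fun i x m => expNeg (a i x m))
      (fun i => measurable_expNeg.comp (ha i)) n
  have hmarks := tendsto_lintegral_mul_expNeg (μ := μ) (hF.comp hXm) (fun ω => hF1 _)
    (g := fun n ω => ∑ i ∈ Finset.range n, a i (fun j => X j ω) (M i ω))
    (fun n => Finset.measurable_sum _ fun i _ => (ha i).comp (hXm.prodMk (hM.measurable i)))
    (Eventually.of_forall fun ω => ENNReal.tendsto_nat_tsum _)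
  have hpoints := tendsto_lintegral_mul_expNeg (μ := μ) (hF.comp hXm) (fun ω => hF1 _)
    (g := fun n ω => ∑ i ∈ Finset.range n, h i (fun j => X j ω))
    (fun n => Finset.measurable_sum _ fun i _ => (hm i).comp hXm)
    (Eventually.of_forall fun ω => ENNReal.tendsto_nat_tsum _)
  simp only [Function.comp_apply, hpartial] at hmarks hpoints
  exact tendsto_nhds_unique hmarks hpoints

end Marks

section Distances

variable {Ω : Type*} {X : ℕ → Ω → Plane} {t : Plane} {n : ℕ} {ω : Ω}

/-- A configuration in general position with respect to `t`: finitely many points in each disc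
around `t`, at distinct positive distances from `t`. -/
structure IsGeneric (X : ℕ → Ω → Plane) (t : Plane) (ω : Ω) : Prop where
  finite : ∀ r : ℝ, pointCount X (Metric.closedBall t r) ω ≠ ⊤
  injective : Function.Injective fun i => dist (X i ω) t
  ne : ∀ i, X i ω ≠ t

lemma IsGeneric.finite_setOf_dist_le (h : IsGeneric X t ω) (r : ℝ) :
    {i | dist (X i ω) t ≤ r}.Finite :=
  Set.encard_ne_top_iff.1 (h.finite r)

lemma exists_le_pointCount_closedBall (X : ℕ → Ω → Plane) (t : Plane) (n : ℕ) (ω : Ω) :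
    ∃ r : ℝ, 0 ≤ r ∧ (n : ℕ∞) ≤ pointCount X (Metric.closedBall t r) ω := by
  refine ⟨∑ i ∈ Finset.range n, dist (X i ω) t, Finset.sum_nonneg fun _ _ => dist_nonneg, ?_⟩
  have h : (↑(Finset.range n) : Set ℕ) ⊆
      {i | X i ω ∈ Metric.closedBall t (∑ i ∈ Finset.range n, dist (X i ω) t)} := fun i hi =>
    Finset.single_le_sum (f := fun i => dist (X i ω) t) (fun _ _ => dist_nonneg) hi
  simpa only [pointCount, Set.encard_coe_eq_coe_finsetCard, Finset.card_range]
    using Set.encard_le_encard h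

lemma nthDist_nonneg (X : ℕ → Ω → Plane) (t : Plane) (n : ℕ) (ω : Ω) : 0 ≤ nthDist X t n ω :=
  Real.sInf_nonneg fun _ h => h.1

lemma nthDist_le {r : ℝ} (hr : 0 ≤ r)
    (h : (n : ℕ∞) ≤ pointCount X (Metric.closedBall t r) ω) : nthDist X t n ω ≤ r :=
  csInf_le ⟨0, fun _ h => h.1⟩ ⟨hr, h⟩

lemma nthDist_mono (X : ℕ → Ω → Plane) (t : Plane) (ω : Ω) :
    Monotone fun n => nthDist X t n ω := fun _ n hmn =>
  csInf_le_csInf ⟨0, fun _ h => h.1⟩ (exists_le_pointCount_closedBall X t n ω)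
    fun _ h => ⟨h.1, (Nat.cast_le.2 hmn).trans h.2⟩

lemma nthDist_lt_iff {a : ℝ} : nthDist X t n ω < a ↔
    ∃ q : ℚ, (0 ≤ q ∧ (q : ℝ) < a) ∧ (n : ℕ∞) ≤ pointCount X (Metric.closedBall t q) ω := by
  constructor
  · intro h
    obtain ⟨r, ⟨hr, hn⟩, hra⟩ :=
      exists_lt_of_csInf_lt (exists_le_pointCount_closedBall X t n ω) h
    obtain ⟨q, hrq, hqa⟩ := exists_rat_btwn hra
    exact ⟨q, ⟨by exact_mod_cast hr.trans hrq.le, hqa⟩,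
      hn.trans (pointCount_mono X (Metric.closedBall_subset_closedBall hrq.le) ω)⟩
  · rintro ⟨q, ⟨hq, hqa⟩, h⟩
    exact (nthDist_le (by exact_mod_cast hq) h).trans_lt hqa

lemma preimage_nthDist_Iio (X : ℕ → Ω → Plane) (t : Plane) (n : ℕ) (a : ℝ) :
    nthDist X t n ⁻¹' Iio a = ⋃ q : ℚ, ⋃ _ : 0 ≤ q ∧ (q : ℝ) < a,
      pointCount X (Metric.closedBall t q) ⁻¹' Ici (n : ℕ∞) := by
  ext ω
  simp only [mem_preimage, mem_Iio, nthDist_lt_iff, mem_iUnion, mem_Ici, exists_prop]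

lemma measurable_nthDist [MeasurableSpace Ω] (hX : ∀ i, Measurable (X i)) (t : Plane) (n : ℕ) :
    Measurable (nthDist X t n) := by
  refine measurable_of_Iio fun a => ?_
  rw [preimage_nthDist_Iio]
  exact MeasurableSet.iUnion fun q => MeasurableSet.iUnion fun _ =>
    measurable_pointCount hX Metric.isClosed_closedBall.measurableSet .of_discrete

lemma measurable_countAlgebra_min_nthDist {Λ : Measure Plane} [IsLocallyFiniteMeasure Λ]
    (X : ℕ → Ω → Plane) (t : Plane) (n : ℕ) (ρ : ℝ) :
    Measurable[countAlgebra Λ X (Metric.closedBall t ρ)] fun ω => min (nthDist X t n ω) ρ := by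
  let _ := countAlgebra Λ X (Metric.closedBall t ρ)
  refine measurable_of_Iio fun a => ?_
  rcases lt_or_ge ρ a with ha | ha
  · convert MeasurableSet.univ using 1
    exact eq_univ_of_forall fun ω => (min_le_right _ ρ).trans_lt ha
  · have hset : (fun ω => min (nthDist X t n ω) ρ) ⁻¹' Iio a = nthDist X t n ⁻¹' Iio a := by
      ext ω
      simp only [mem_preimage, mem_Iio, min_lt_iff, not_lt.2 ha, or_false]
    rw [hset, preimage_nthDist_Iio]
    exact MeasurableSet.iUnion fun q => MeasurableSet.iUnion fun hq =>
      measurable_countAlgebra_pointCount Metric.isClosed_closedBall.measurableSet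
        (Metric.closedBall_subset_closedBall (hq.2.le.trans ha))
        (isCompact_closedBall t (q : ℝ)).measure_lt_top.ne .of_discrete

/-- Local finiteness makes `r ↦ pointCount X (closedBall t r) ω` continuous from the right, so the
infimum that defines `nthDist` is attained. -/
lemma IsGeneric.nthDist_le_iff (h : IsGeneric X t ω) {r : ℝ} (hr : 0 ≤ r) :
    nthDist X t n ω ≤ r ↔ (n : ℕ∞) ≤ pointCount X (Metric.closedBall t r) ω := by
  refine ⟨fun hle => ?_, nthDist_le hr⟩
  have hright : ∀ᶠ r' in 𝓝[>] r, ∀ i ∈ {i | dist (X i ω) t ≤ r + 1},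
      dist (X i ω) t ≤ r' → dist (X i ω) t ≤ r := by
    refine (eventually_all_finite (h.finite_setOf_dist_le (r + 1))).2 fun i _ => ?_
    by_cases hi : dist (X i ω) t ≤ r
    · exact Eventually.of_forall fun _ _ => hi
    · filter_upwards [mem_nhdsWithin_of_mem_nhds (Iio_mem_nhds (not_le.1 hi))] with r' hr' hle
      exact absurd hle (not_le.2 hr')
  have hnear : ∀ᶠ r' in 𝓝[>] r, r' < r + 1 :=
    mem_nhdsWithin_of_mem_nhds (Iio_mem_nhds (by linarith))
  obtain ⟨r', h1, h2, h3⟩ := (hright.and (hnear.and self_mem_nhdsWithin)).exists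
  obtain ⟨q, ⟨-, hq⟩, hn⟩ := nthDist_lt_iff.1 (hle.trans_lt h3)
  refine hn.trans (Set.encard_le_encard fun i (hi : dist (X i ω) t ≤ q) => ?_)
  have hi' : dist (X i ω) t ≤ r' := hi.trans hq.le
  exact h1 i (hi'.trans h2.le) hi'

lemma IsGeneric.exists_dist_eq_nthDist (h : IsGeneric X t ω) (hn : 1 ≤ n) :
    ∃ i, dist (X i ω) t = nthDist X t n ω := by
  by_contra! hne
  set ρ := nthDist X t n ω
  have hρ0 : 0 ≤ ρ := nthDist_nonneg X t n ω
  have hC : (n : ℕ∞) ≤ pointCount X (Metric.closedBall t ρ) ω := (h.nthDist_le_iff hρ0).1 le_rfl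
  have hleft : ∀ᶠ r in 𝓝[<] ρ, ∀ i ∈ {i | dist (X i ω) t ≤ ρ}, dist (X i ω) t ≤ r := by
    refine (eventually_all_finite (h.finite_setOf_dist_le ρ)).2 fun i (hi : _ ≤ ρ) => ?_
    filter_upwards [mem_nhdsWithin_of_mem_nhds (Ioi_mem_nhds (hi.lt_of_ne (hne i)))] with r hr
    exact hr.le
  obtain ⟨r, h1, h2⟩ := (hleft.and self_mem_nhdsWithin).exists
  have hr : (n : ℕ∞) ≤ pointCount X (Metric.closedBall t r) ω :=
    hC.trans (Set.encard_le_encard fun i hi => h1 i hi)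
  obtain ⟨i, hi⟩ : {i | X i ω ∈ Metric.closedBall t r}.Nonempty :=
    Set.encard_pos.1 ((Nat.cast_pos.2 hn).trans_le hr)
  exact (nthDist_le (dist_nonneg.trans hi) hr).not_gt h2

lemma IsGeneric.nthDist_pos (h : IsGeneric X t ω) (hn : 1 ≤ n) : 0 < nthDist X t n ω := by
  obtain ⟨i, hi⟩ := h.exists_dist_eq_nthDist hn
  exact hi ▸ dist_pos.2 (h.ne i)

lemma nthDist_one_le_dist (X : ℕ → Ω → Plane) (t : Plane) (i : ℕ) (ω : Ω) :
    nthDist X t 1 ω ≤ dist (X i ω) t := by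
  refine nthDist_le dist_nonneg (Nat.cast_one.trans_le (Set.one_le_encard_iff_nonempty.2 ⟨i, ?_⟩))
  exact Metric.mem_closedBall.2 le_rfl

lemma IsGeneric.nthDist_one_lt (h : IsGeneric X t ω) (hn : 2 ≤ n) :
    nthDist X t 1 ω < nthDist X t n ω := by
  by_contra hle
  rw [not_lt, h.nthDist_le_iff (nthDist_nonneg _ _ _ _)] at hle
  obtain ⟨i, j, hi, hj, hij⟩ :=
    Set.one_lt_encard_iff.1 ((Nat.one_lt_cast.2 hn).trans_le hle)
  have hdist : ∀ {k}, X k ω ∈ Metric.closedBall t (nthDist X t 1 ω) →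
      dist (X k ω) t = nthDist X t 1 ω := fun hk =>
    le_antisymm hk (nthDist_one_le_dist X t _ ω)
  exact hij (h.injective ((hdist hi).trans (hdist hj).symm))

end Distances

/-- The probability `∑ k < n, exp (-m) m ^ k / k!` that a Poisson variable with mean `m` is less
than `n`. -/
def poissonBelow (n : ℕ) (m : ℝ) : ℝ :=
  ∑ k ∈ Finset.range n, Real.exp (-m) * m ^ k / (k.factorial : ℝ)

lemma poissonBelow_succ (n : ℕ) (m : ℝ) :
    poissonBelow (n + 1) m = poissonBelow n m + Real.exp (-m) * m ^ n / (n.factorial : ℝ) :=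
  Finset.sum_range_succ _ _

lemma poissonBelow_nonneg (n : ℕ) {m : ℝ} (hm : 0 ≤ m) : 0 ≤ poissonBelow n m :=
  Finset.sum_nonneg fun _ _ => by positivity

lemma poissonBelow_one (m : ℝ) : poissonBelow 1 m = Real.exp (-m) := by
  simp [poissonBelow]

lemma poissonBelow_zero_right {n : ℕ} (hn : 1 ≤ n) : poissonBelow n 0 = 1 := by
  obtain ⟨n, rfl⟩ := Nat.exists_eq_add_of_le' hn
  rw [poissonBelow, Finset.sum_range_succ']
  simp

lemma one_sub_poissonBelow_two_le {m : ℝ} (hm : 0 ≤ m) : 1 - poissonBelow 2 m ≤ m ^ 2 := by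
  have hexp : 1 - m ≤ Real.exp (-m) := by linarith [Real.add_one_le_exp (-m)]
  have htwo : poissonBelow 2 m = Real.exp (-m) * (1 + m) := by
    rw [poissonBelow_succ, poissonBelow_one]
    simp
    ring
  rw [htwo]
  nlinarith

lemma pointCount_sdiff_of_eq_zero {Ω E : Type*} {X : ℕ → Ω → E} {A B : Set E} {ω : Ω}
    (h : pointCount X A ω = 0) : pointCount X (B \ A) ω = pointCount X B ω := by
  have hA : ∀ i, X i ω ∉ A := eq_empty_iff_forall_notMem.1 (Set.encard_eq_zero.1 h)
  simp only [pointCount, Set.mem_sdiff, hA, not_false_eq_true, and_true]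

section Counts

variable {Ω E : Type*} [MeasurableSpace Ω] [MeasurableSpace E] {μ : Measure Ω}
  [IsProbabilityMeasure μ] {Λ : Measure E} {X : ℕ → Ω → E}

lemma IsPoissonPointProcess.measure_pointCount_lt (hX : IsPoissonPointProcess μ Λ X) {B : Set E}
    (hB : MeasurableSet B) (hΛ : Λ B ≠ ∞) (n : ℕ) :
    μ {ω | pointCount X B ω < n} = ENNReal.ofReal (poissonBelow n (Λ B).toReal) := by
  have hcast : ((↑) : ℕ → ℕ∞) ⁻¹' Iio (n : ℕ∞) = Finset.range n := by
    ext k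
    simp
  calc μ {ω | pointCount X B ω < n}
      = μ.map (pointCount X B) (Iio (n : ℕ∞)) :=
        (Measure.map_apply (measurable_pointCount hX.measurable hB) .of_discrete).symm
    _ = poissonMeasure (Λ B).toNNReal (Finset.range n : Set ℕ) := by
        rw [hX.map_pointCount hB hΛ, Measure.map_apply .of_discrete .of_discrete, hcast]
    _ = ∑ k ∈ Finset.range n, poissonMeasure (Λ B).toNNReal {k} :=
        (sum_measure_singleton ..).symm
    _ = ENNReal.ofReal (poissonBelow n (Λ B).toReal) := by
        simp only [poissonMeasure_singleton]
        rw [poissonBelow, ENNReal.ofReal_sum_of_nonneg fun k _ => by positivity]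
        rfl

lemma IsPoissonPointProcess.ae_pointCount_eq_zero (hX : IsPoissonPointProcess μ Λ X) {B : Set E}
    (hB : MeasurableSet B) (hΛ : Λ B = 0) : ∀ᵐ ω ∂μ, pointCount X B ω = 0 := by
  have hlt : ∀ᵐ ω ∂μ, pointCount X B ω < (1 : ℕ) := by
    refine (prob_compl_eq_zero_iff ?_).2 ?_
    · exact measurable_pointCount hX.measurable hB (.of_discrete (s := Iio ((1 : ℕ) : ℕ∞)))
    · rw [hX.measure_pointCount_lt hB (by simp [hΛ]), hΛ, poissonBelow_one]
      simp
  filter_upwards [hlt] with ω hω using Order.lt_one_iff.1 hω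

lemma IsPoissonPointProcess.measure_two_le_pointCount_le (hX : IsPoissonPointProcess μ Λ X)
    {B : Set E} (hB : MeasurableSet B) (hΛ : Λ B ≠ ∞) :
    μ {ω | 2 ≤ pointCount X B ω} ≤ Λ B ^ 2 := by
  have hcompl : {ω | 2 ≤ pointCount X B ω} = {ω | pointCount X B ω < (2 : ℕ)}ᶜ := by
    ext ω
    exact (not_lt (a := pointCount X B ω) (b := 2)).symm
  have hmeas : MeasurableSet {ω | pointCount X B ω < (2 : ℕ)} :=
    measurable_pointCount hX.measurable hB (.of_discrete (s := Iio ((2 : ℕ) : ℕ∞)))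
  calc μ {ω | 2 ≤ pointCount X B ω}
      = ENNReal.ofReal (1 - poissonBelow 2 (Λ B).toReal) := by
        rw [hcompl, prob_compl_eq_one_sub hmeas, hX.measure_pointCount_lt hB hΛ,
          ← ENNReal.ofReal_one,
          ← ENNReal.ofReal_sub _ (poissonBelow_nonneg 2 ENNReal.toReal_nonneg)]
    _ ≤ ENNReal.ofReal ((Λ B).toReal ^ 2) :=
        ENNReal.ofReal_le_ofReal (one_sub_poissonBelow_two_le ENNReal.toReal_nonneg)
    _ = Λ B ^ 2 := by rw [ENNReal.ofReal_pow ENNReal.toReal_nonneg, ENNReal.ofReal_toReal hΛ]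

/-- Among `n` sets of intensity at most `c / n` each, one contains two points with probability at
most `n (c / n) ^ 2 → 0`. -/
lemma IsPoissonPointProcess.ae_exists_forall_pointCount_lt_two (hX : IsPoissonPointProcess μ Λ X)
    {A : ℕ → ℕ → Set E} (hA : ∀ n j, MeasurableSet (A n j)) (c : ℝ≥0)
    (hΛ : ∀ n j, 0 < n → Λ (A n j) ≤ c / n) :
    ∀ᵐ ω ∂μ, ∃ n, 0 < n ∧ ∀ j < n, pointCount X (A n j) ω < 2 := by
  have hbound : ∀ n : ℕ, 0 < n →
      μ {ω | ¬ ∃ n, 0 < n ∧ ∀ j < n, pointCount X (A n j) ω < 2} ≤ c ^ 2 / n := by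
    intro n hn
    have hn0 : (n : ℝ≥0∞) ≠ 0 := Nat.cast_ne_zero.2 hn.ne'
    calc μ {ω | ¬ ∃ n, 0 < n ∧ ∀ j < n, pointCount X (A n j) ω < 2}
        ≤ μ (⋃ j ∈ Finset.range n, {ω | 2 ≤ pointCount X (A n j) ω}) := by
          refine measure_mono fun ω hω => ?_
          push Not at hω
          obtain ⟨j, hj, h⟩ := hω n hn
          exact mem_iUnion₂.2 ⟨j, Finset.mem_range.2 hj, h⟩
      _ ≤ ∑ j ∈ Finset.range n, μ {ω | 2 ≤ pointCount X (A n j) ω} :=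
          measure_biUnion_finset_le _ _
      _ ≤ ∑ _j ∈ Finset.range n, ((c : ℝ≥0∞) / n) ^ 2 := Finset.sum_le_sum fun j _ =>
          (hX.measure_two_le_pointCount_le (hA n j) (ne_top_of_le_ne_top
            (ENNReal.div_ne_top ENNReal.coe_ne_top hn0) (hΛ n j hn))).trans
            (pow_le_pow_left₀ zero_le (hΛ n j hn) 2)
      _ = c ^ 2 / n := by
          rw [Finset.sum_const, Finset.card_range, nsmul_eq_mul, sq, sq, div_eq_mul_inv,
            div_eq_mul_inv, mul_mul_mul_comm, mul_left_comm, ← mul_assoc (n : ℝ≥0∞),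
            ENNReal.mul_inv_cancel hn0 (ENNReal.natCast_ne_top n), one_mul]
  have hlim : Tendsto (fun n : ℕ => (c : ℝ≥0∞) ^ 2 / n) atTop (𝓝 0) := by
    simpa using ENNReal.Tendsto.const_div ENNReal.tendsto_nat_nhds_top
      (Or.inr (ENNReal.pow_ne_top ENNReal.coe_ne_top))
  exact le_antisymm (ge_of_tendsto hlim ((eventually_gt_atTop 0).mono hbound)) zero_le

end Counts

section Plane

variable {Ω : Type*} [MeasurableSpace Ω] {μ : Measure Ω} [IsProbabilityMeasure μ] {lam : ℝ}
  {X : ℕ → Ω → Plane}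

lemma intensity_closedBall (hlam : 0 ≤ lam) (t : Plane) {r : ℝ} (hr : 0 ≤ r) :
    (ENNReal.ofReal lam • volume : Measure Plane) (Metric.closedBall t r) =
      ENNReal.ofReal (Real.pi * lam * r ^ 2) := by
  rw [Measure.smul_apply, EuclideanSpace.volume_closedBall_fin_two, smul_eq_mul,
    ← ENNReal.ofReal_pow hr, ← ENNReal.ofReal_mul (by positivity), ← ENNReal.ofReal_mul hlam]
  congr 1
  ring

lemma intensity_annulus (hlam : 0 ≤ lam) (t : Plane) {a b : ℝ} (ha : 0 ≤ a) (hab : a ≤ b) :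
    (ENNReal.ofReal lam • volume : Measure Plane) (Metric.closedBall t b \ Metric.closedBall t a) =
      ENNReal.ofReal (Real.pi * lam * (b ^ 2 - a ^ 2)) := by
  rw [measure_sdiff (Metric.closedBall_subset_closedBall hab)
    Metric.isClosed_closedBall.nullMeasurableSet
    (by rw [intensity_closedBall hlam t ha]; exact ENNReal.ofReal_ne_top),
    intensity_closedBall hlam t ha, intensity_closedBall hlam t (ha.trans hab),
    ← ENNReal.ofReal_sub _ (by positivity)]
  congr 1
  ring

lemma intensity_setOf_sq_dist_mem_Ioc (hlam : 0 ≤ lam) (t : Plane) {a b : ℝ} (ha : 0 ≤ a)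
    (hab : a ≤ b) :
    (ENNReal.ofReal lam • volume : Measure Plane) {x | dist x t ^ 2 ∈ Ioc a b} =
      ENNReal.ofReal (Real.pi * lam * (b - a)) := by
  have hset : {x | dist x t ^ 2 ∈ Ioc a b} =
      Metric.closedBall t (√b) \ Metric.closedBall t (√a) := by
    ext x
    simp only [mem_ofPred_eq, mem_Ioc, Set.mem_sdiff, Metric.mem_closedBall,
      Real.le_sqrt dist_nonneg ha, Real.le_sqrt dist_nonneg (ha.trans hab), not_le, and_comm]
  rw [hset, intensity_annulus hlam t (Real.sqrt_nonneg a) (Real.sqrt_le_sqrt hab),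
    Real.sq_sqrt ha, Real.sq_sqrt (ha.trans hab)]

lemma exists_mem_Ioc_div {c x : ℝ} (hx : x ∈ Ioc 0 c) {n : ℕ} (hn : 0 < n) :
    ∃ j < n, x ∈ Ioc (c * j / n) (c * (j + 1) / n) := by
  have hn' : (0 : ℝ) < n := Nat.cast_pos.2 hn
  have hc : 0 < c := hx.1.trans_le hx.2
  obtain ⟨j, hj⟩ := Nat.exists_eq_add_of_le' (Nat.ceil_pos.2 (by have := hx.1; positivity) :
    0 < ⌈x * n / c⌉₊)
  have hle : ⌈x * n / c⌉₊ ≤ n := Nat.ceil_le.2 ((div_le_iff₀ hc).2 (by nlinarith [hx.2]))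
  have hlower : (j : ℝ) < x * n / c := Nat.lt_ceil.1 (by omega)
  have hupper : x * n / c ≤ j + 1 := by exact_mod_cast hj ▸ Nat.le_ceil (x * n / c)
  rw [lt_div_iff₀ hc] at hlower
  rw [div_le_iff₀ hc] at hupper
  exact ⟨j, by omega, (div_lt_iff₀ hn').2 (by linarith), (le_div_iff₀ hn').2 (by linarith)⟩

/-- Cut the disc into `n` annuli of equal area: two points at the same distance from `t` would lie
in the same annulus. -/
lemma IsPoissonPointProcess.ae_no_ties (hlam : 0 ≤ lam)
    (hX : IsPoissonPointProcess μ (ENNReal.ofReal lam • volume) X) (t : Plane) (c : ℕ) :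
    ∀ᵐ ω ∂μ, ∀ i j, dist (X i ω) t = dist (X j ω) t → dist (X i ω) t ^ 2 ∈ Ioc 0 (c : ℝ) →
      i = j := by
  let A : ℕ → ℕ → Set Plane := fun n j =>
    {x | dist x t ^ 2 ∈ Ioc ((c : ℝ) * j / n) (c * (j + 1) / n)}
  have hA : ∀ n j, MeasurableSet (A n j) := fun n j =>
    measurableSet_Ioc.preimage ((measurable_id.dist measurable_const).pow_const 2)
  have hΛ : ∀ n j, 0 < n → (ENNReal.ofReal lam • volume : Measure Plane) (A n j) ≤
      (Real.pi * lam * c).toNNReal / n := fun n j hn => by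
    rw [intensity_setOf_sq_dist_mem_Ioc hlam t (by positivity) (by gcongr; linarith),
      ← ENNReal.ofReal, ← ENNReal.ofReal_natCast n, ← ENNReal.ofReal_div_of_pos (by positivity)]
    exact ENNReal.ofReal_le_ofReal (by ring_nf; rfl)
  filter_upwards [hX.ae_exists_forall_pointCount_lt_two hA _ hΛ] with ω ⟨n, hn, h⟩ i j hij hc
  obtain ⟨k, hk, hik⟩ := exists_mem_Ioc_div hc hn
  by_contra hne
  refine (h k hk).not_ge ((Set.encard_pair hne).symm.trans_le (Set.encard_le_encard ?_))
  rintro l (rfl | rfl)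
  · exact hik
  · exact (hij ▸ hik : dist (X l ω) t ^ 2 ∈ _)

lemma IsPoissonPointProcess.ae_isGeneric (hlam : 0 ≤ lam)
    (hX : IsPoissonPointProcess μ (ENNReal.ofReal lam • volume) X) (t : Plane) :
    ∀ᵐ ω ∂μ, IsGeneric X t ω := by
  have hfin : ∀ᵐ ω ∂μ, ∀ k : ℕ, pointCount X (Metric.closedBall t k) ω ≠ ⊤ :=
    ae_all_iff.2 fun k => hX.ae_pointCount_ne_top measurableSet_closedBall
      (by rw [intensity_closedBall hlam t k.cast_nonneg]; exact ENNReal.ofReal_ne_top)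
  have hcenter : ∀ᵐ ω ∂μ, pointCount X {t} ω = 0 :=
    hX.ae_pointCount_eq_zero (measurableSet_singleton t) (by simp)
  filter_upwards [hfin, hcenter, ae_all_iff.2 (hX.ae_no_ties hlam t)] with ω hfin hcenter hties
  have hne : ∀ i, X i ω ≠ t := fun i hi =>
    eq_empty_iff_forall_notMem.1 (Set.encard_eq_zero.1 hcenter) i hi
  refine ⟨fun r => ?_, fun i j hij => ?_, hne⟩
  · obtain ⟨k, hk⟩ := exists_nat_ge r
    exact ne_top_of_le_ne_top (hfin k)
      (pointCount_mono X (Metric.closedBall_subset_closedBall hk) ω)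
  · obtain ⟨c, hc⟩ := exists_nat_ge (dist (X i ω) t ^ 2)
    exact hties c i j hij ⟨pow_pos (dist_pos.2 (hne i)) 2, hc⟩

/-- `R₁ > a` says that the disc of radius `a` is empty, and then `Rₙ > b` is a condition on the
annulus between the radii `a` and `b` only. -/
lemma IsPoissonPointProcess.measure_nthDist_gt (hlam : 0 ≤ lam)
    (hX : IsPoissonPointProcess μ (ENNReal.ofReal lam • volume) X) (t : Plane) (n : ℕ)
    {a b : ℝ} (ha : 0 ≤ a) (hab : a ≤ b) :
    μ {ω | a < nthDist X t 1 ω ∧ b < nthDist X t n ω} =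
      ENNReal.ofReal (Real.exp (-(Real.pi * lam * a ^ 2)) *
        poissonBelow n (Real.pi * lam * (b ^ 2 - a ^ 2))) := by
  set A := Metric.closedBall t a
  set B := Metric.closedBall t b \ A
  have hA : MeasurableSet A := measurableSet_closedBall
  have hB : MeasurableSet B := measurableSet_closedBall.diff hA
  have hΛA := intensity_closedBall hlam t ha
  have hΛB := intensity_annulus hlam t ha hab
  have hΛA' := hΛA.trans_ne ENNReal.ofReal_ne_top
  have hΛB' := hΛB.trans_ne ENNReal.ofReal_ne_top
  have hab2 : 0 ≤ b ^ 2 - a ^ 2 := by nlinarith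
  have hind : IndepFun (pointCount X A) (pointCount X B) μ :=
    (hX.indepFun_pointCount_of_disjoint (A := fun _ : Unit => A) (B := fun _ : Unit => B)
      (fun _ => hA) (fun _ => hB) (fun _ => hΛA') (fun _ => hΛB')
      fun _ _ => disjoint_sdiff_right).comp (measurable_pi_apply ()) (measurable_pi_apply ())
  have hset : ({ω | a < nthDist X t 1 ω ∧ b < nthDist X t n ω} : Set Ω) =ᵐ[μ]
      (pointCount X A ⁻¹' Iio ((1 : ℕ) : ℕ∞) ∩ pointCount X B ⁻¹' Iio (n : ℕ∞) : Set Ω) := by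
    filter_upwards [hX.ae_isGeneric hlam t] with ω hω
    refine propext ?_
    change (a < _ ∧ b < _) ↔ (pointCount X A ω < _ ∧ pointCount X B ω < _)
    rw [← not_le, ← not_le (b := b), hω.nthDist_le_iff ha, hω.nthDist_le_iff (ha.trans hab),
      not_le, not_le]
    refine and_congr_right fun h => ?_
    rw [pointCount_sdiff_of_eq_zero (Order.lt_one_iff.1 (by exact_mod_cast h))]
  have hcountA := hX.measure_pointCount_lt hA hΛA' 1
  have hcountB := hX.measure_pointCount_lt hB hΛB' n
  rw [hΛA, ENNReal.toReal_ofReal (by positivity), poissonBelow_one] at hcountA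
  rw [hΛB, ENNReal.toReal_ofReal (by positivity)] at hcountB
  rw [measure_congr hset, hind.measure_inter_preimage_eq_mul _ _ .of_discrete .of_discrete,
    ENNReal.ofReal_mul (Real.exp_nonneg _), ← hcountA, ← hcountB]
  rfl

end Plane

lemma exp_neg_le_poissonBelow_succ (n : ℕ) {m : ℝ} (hm : 0 ≤ m) :
    Real.exp (-m) ≤ poissonBelow (n + 1) m := by
  have h := Finset.single_le_sum (f := fun k => Real.exp (-m) * m ^ k / (k.factorial : ℝ))
    (fun k _ => by positivity) (Finset.mem_range.2 n.succ_pos)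
  simpa [poissonBelow] using h

lemma hasDerivAt_poissonBelow_succ (n : ℕ) (m : ℝ) :
    HasDerivAt (poissonBelow (n + 1)) (-(Real.exp (-m) * m ^ n / (n.factorial : ℝ))) m := by
  have hexp : HasDerivAt (fun m : ℝ => Real.exp (-m)) (-Real.exp (-m)) m := by
    simpa using (hasDerivAt_neg m).exp
  induction n with
  | zero => simpa using hexp.congr_of_eventuallyEq (.of_forall poissonBelow_one)
  | succ n ih =>
    have hterm := (hexp.mul (hasDerivAt_pow (n + 1) m)).div_const ((n + 1).factorial : ℝ)
    refine ((ih.add hterm).congr_of_eventuallyEq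
      (.of_forall (poissonBelow_succ (n + 1)))).congr_deriv ?_
    rw [Nat.factorial_succ]
    push_cast
    field_simp
    ring

lemma tendsto_poissonBelow_atTop (n : ℕ) : Tendsto (poissonBelow n) atTop (𝓝 0) := by
  have h : Tendsto (fun m : ℝ => ∑ k ∈ Finset.range n, Real.exp (-m) * m ^ k / (k.factorial : ℝ))
      atTop (𝓝 (∑ _k ∈ Finset.range n, (0 : ℝ))) := tendsto_finsetSum _ fun k _ => by
    simpa [mul_comm] using
      (Real.tendsto_pow_mul_exp_neg_atTop_nhds_zero k).div_const (k.factorial : ℝ)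
  rwa [Finset.sum_const_zero] at h

lemma hasDerivAt_exp_mul_poissonBelow (n : ℕ) (c b r : ℝ) :
    HasDerivAt (fun r => -(Real.exp (-(c * r ^ 2)) * poissonBelow (n + 1) (c * (b ^ 2 - r ^ 2))))
      (2 * c * r * Real.exp (-(c * r ^ 2)) * poissonBelow n (c * (b ^ 2 - r ^ 2))) r := by
  have hmean : HasDerivAt (fun r : ℝ => c * (b ^ 2 - r ^ 2)) (c * (-(2 * r))) r := by
    simpa using ((hasDerivAt_pow 2 r).const_sub (b ^ 2)).const_mul c
  have hexp : HasDerivAt (fun r : ℝ => Real.exp (-(c * r ^ 2)))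
      (Real.exp (-(c * r ^ 2)) * (-(c * (2 * r)))) r := by
    simpa using (((hasDerivAt_pow 2 r).const_mul c).neg).exp
  refine (hexp.mul ((hasDerivAt_poissonBelow_succ n _).comp r hmean)).neg.congr_deriv ?_
  simp only [Function.comp_apply, poissonBelow_succ]
  ring

section Density

variable (p : Params)

lemma measurable_condDensity (n : ℕ) : Measurable (Function.uncurry (condDensity p n)) := by
  unfold condDensity Function.uncurry
  refine Measurable.ite (measurableSet_le measurable_fst measurable_snd) ?_ measurable_const
  fun_prop

lemma condDensity_nonneg (n : ℕ) {r : ℝ} (hr : 0 ≤ r) (ρ : ℝ) : 0 ≤ condDensity p n r ρ := by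
  unfold condDensity
  split_ifs with h
  · have hsq : 0 ≤ ρ ^ 2 - r ^ 2 := by nlinarith
    have hlam := p.lamBS_pos
    have hρ : 0 ≤ ρ := hr.trans h
    positivity
  · exact le_rfl

lemma condDensity_of_lt (n : ℕ) {r ρ : ℝ} (h : ρ < r) : condDensity p n r ρ = 0 :=
  if_neg h.not_ge

lemma condDensity_one_zero {r : ℝ} (hr : 0 ≤ r) :
    condDensity p 1 0 r =
      2 * (Real.pi * p.lamBS) * r * Real.exp (-(Real.pi * p.lamBS * r ^ 2)) := by
  simp [condDensity, hr]

lemma setLIntegral_condDensity_Ioi_of_le {n : ℕ} (hn : 1 ≤ n) {r c : ℝ} (hr : 0 ≤ r)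
    (hrc : r ≤ c) :
    ∫⁻ ρ in Ioi c, ENNReal.ofReal (condDensity p n r ρ) =
      ENNReal.ofReal (poissonBelow n (Real.pi * p.lamBS * (c ^ 2 - r ^ 2))) := by
  obtain ⟨n, rfl⟩ := Nat.exists_eq_add_of_le' hn
  have hlam := p.lamBS_pos
  have hderiv : ∀ ρ ∈ Ici c, HasDerivAt
      (fun ρ => -poissonBelow (n + 1) (Real.pi * p.lamBS * (ρ ^ 2 - r ^ 2)))
      (condDensity p (n + 1) r ρ) ρ := fun ρ hρ => by
    have hmean : HasDerivAt (fun ρ : ℝ => Real.pi * p.lamBS * (ρ ^ 2 - r ^ 2))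
        (Real.pi * p.lamBS * (2 * ρ)) ρ := by
      simpa using ((hasDerivAt_pow 2 ρ).sub_const (r ^ 2)).const_mul (Real.pi * p.lamBS)
    refine ((hasDerivAt_poissonBelow_succ n _).comp ρ hmean).neg.congr_deriv ?_
    rw [condDensity, if_pos (hrc.trans hρ), Nat.add_sub_cancel, mul_pow]
    ring
  have hlim : Tendsto (fun ρ => -poissonBelow (n + 1) (Real.pi * p.lamBS * (ρ ^ 2 - r ^ 2)))
      atTop (𝓝 0) := by
    have hmean : Tendsto (fun ρ : ℝ => Real.pi * p.lamBS * (ρ ^ 2 - r ^ 2)) atTop atTop :=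
      Tendsto.const_mul_atTop (by positivity)
        (tendsto_atTop_add_const_right _ _ (tendsto_pow_atTop two_ne_zero))
    simpa using ((tendsto_poissonBelow_atTop (n + 1)).comp hmean).neg
  have hnonneg := condDensity_nonneg p (n + 1) hr
  rw [← ofReal_integral_eq_lintegral_ofReal
      (integrableOn_Ioi_deriv_of_nonneg' hderiv (fun ρ _ => hnonneg ρ) hlim)
      (.of_forall hnonneg),
    integral_Ioi_of_hasDerivAt_of_nonneg' hderiv (fun ρ _ => hnonneg ρ) hlim, zero_sub, neg_neg]

lemma setLIntegral_condDensity_Ioi {n : ℕ} (hn : 1 ≤ n) {r : ℝ} (hr : 0 ≤ r) (b : ℝ) :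
    ∫⁻ ρ in Ioi b, ENNReal.ofReal (condDensity p n r ρ) =
      ENNReal.ofReal (poissonBelow n (Real.pi * p.lamBS * (max b r ^ 2 - r ^ 2))) := by
  rw [← setLIntegral_condDensity_Ioi_of_le p hn hr (le_max_right b r),
    ← lintegral_indicator measurableSet_Ioi, ← lintegral_indicator measurableSet_Ioi]
  refine lintegral_congr_ae ?_
  filter_upwards [compl_mem_ae_iff.2 (measure_singleton r)] with ρ hρ
  rcases (show ρ ≠ r from hρ).lt_or_gt with h | h
  · simp only [indicator_apply, condDensity_of_lt p n h, ENNReal.ofReal_zero, ite_self]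
  · simp only [indicator_apply, mem_Ioi, max_lt_iff, h, and_true]

/-- The conditional law of the exclusion radius, as a kernel. For negative arguments, which do not
occur as distances, it is the one at `0`. -/
def radiusKernel (n : ℕ) : Kernel ℝ ℝ :=
  (Kernel.const ℝ volume).withDensity fun r ρ => ENNReal.ofReal (condDensity p n (max r 0) ρ)

lemma radiusKernel_apply (n : ℕ) (r : ℝ) : radiusKernel p n r =
    volume.withDensity fun ρ => ENNReal.ofReal (condDensity p n (max r 0) ρ) := by
  have hmeas : Measurable (Function.uncurry fun r ρ =>
      ENNReal.ofReal (condDensity p n (max r 0) ρ)) :=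
    ENNReal.measurable_ofReal.comp ((measurable_condDensity p n).comp
      ((measurable_fst.max measurable_const).prodMk measurable_snd))
  rw [radiusKernel, Kernel.withDensity_apply _ hmeas, Kernel.const_apply]

lemma radiusKernel_of_nonneg (n : ℕ) {r : ℝ} (hr : 0 ≤ r) :
    radiusKernel p n r = volume.withDensity fun ρ => ENNReal.ofReal (condDensity p n r ρ) := by
  rw [radiusKernel_apply, max_eq_left hr]

lemma isProbabilityMeasure_withDensity_condDensity {n : ℕ} (hn : 1 ≤ n) {r : ℝ} (hr : 0 ≤ r) :
    IsProbabilityMeasure (volume.withDensity fun ρ => ENNReal.ofReal (condDensity p n r ρ)) := by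
  have hsupp : (Function.support fun ρ => ENNReal.ofReal (condDensity p n r ρ)) ⊆ Ioi (r - 1) :=
    fun ρ hρ => by
      by_contra hle
      exact hρ (by simp [condDensity_of_lt p n ((not_lt.1 hle).trans_lt (sub_one_lt r))])
  refine ⟨?_⟩
  rw [withDensity_apply _ MeasurableSet.univ, setLIntegral_univ,
    ← setLIntegral_eq_of_support_subset hsupp, setLIntegral_condDensity_Ioi p hn hr,
    max_eq_right (sub_one_lt r).le, sub_self, mul_zero, poissonBelow_zero_right hn,
    ENNReal.ofReal_one]

lemma isMarkovKernel_radiusKernel {n : ℕ} (hn : 1 ≤ n) : IsMarkovKernel (radiusKernel p n) :=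
  ⟨fun r => radiusKernel_apply p n r ▸
    isProbabilityMeasure_withDensity_condDensity p hn (le_max_right r 0)⟩

lemma radiusKernel_Ioi {n : ℕ} (hn : 1 ≤ n) {r : ℝ} (hr : 0 ≤ r) (b : ℝ) :
    radiusKernel p n r (Ioi b) =
      ENNReal.ofReal (poissonBelow n (Real.pi * p.lamBS * (max b r ^ 2 - r ^ 2))) := by
  rw [radiusKernel_of_nonneg p n hr, withDensity_apply _ measurableSet_Ioi,
    setLIntegral_condDensity_Ioi p hn hr]

lemma setLIntegral_radiusKernel_Ioc {n : ℕ} (hn : 1 ≤ n) {a b : ℝ} (ha : 0 ≤ a) (hab : a ≤ b) :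
    ∫⁻ r in Ioc a b, ENNReal.ofReal (condDensity p 1 0 r) * radiusKernel p n r (Ioi b) =
      ENNReal.ofReal (Real.exp (-(Real.pi * p.lamBS * a ^ 2)) *
        poissonBelow (n + 1) (Real.pi * p.lamBS * (b ^ 2 - a ^ 2)) -
          Real.exp (-(Real.pi * p.lamBS * b ^ 2))) := by
  have hlam := p.lamBS_pos
  set c := Real.pi * p.lamBS
  set h : ℝ → ℝ := fun r =>
    2 * c * r * Real.exp (-(c * r ^ 2)) * poissonBelow n (c * (b ^ 2 - r ^ 2)) with hh
  have hnonneg : ∀ r ∈ Ioc a b, 0 ≤ h r := fun r hr => by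
    have hr0 := ha.trans hr.1.le
    have hmean : 0 ≤ c * (b ^ 2 - r ^ 2) := mul_nonneg (by positivity) (by nlinarith [hr.2])
    have := poissonBelow_nonneg n hmean
    positivity
  have hintegrable : IntervalIntegrable h volume a b := by
    refine Continuous.intervalIntegrable ?_ a b
    unfold h poissonBelow
    fun_prop
  calc ∫⁻ r in Ioc a b, ENNReal.ofReal (condDensity p 1 0 r) * radiusKernel p n r (Ioi b)
      = ∫⁻ r in Ioc a b, ENNReal.ofReal (h r) := by
        refine setLIntegral_congr_fun measurableSet_Ioc fun r hr => ?_
        have hr0 := ha.trans hr.1.le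
        simp only [hh, radiusKernel_Ioi p hn hr0, max_eq_left hr.2, condDensity_one_zero p hr0]
        exact (ENNReal.ofReal_mul (by positivity)).symm
    _ = ENNReal.ofReal (∫ r in a..b, h r) := by
        rw [intervalIntegral.integral_of_le hab, ofReal_integral_eq_lintegral_ofReal
          ((intervalIntegrable_iff_integrableOn_Ioc_of_le hab).1 hintegrable)
          ((ae_restrict_iff' measurableSet_Ioc).2 (.of_forall hnonneg))]
    _ = _ := by
        rw [intervalIntegral.integral_eq_sub_of_hasDerivAt
          (fun r _ => hasDerivAt_exp_mul_poissonBelow n c b r) hintegrable, sub_self, mul_zero,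
          poissonBelow_zero_right n.succ_pos, mul_one, neg_sub_neg]

lemma setLIntegral_radiusKernel_Ioi_of_le {n : ℕ} (hn : 1 ≤ n) {a b : ℝ} (hb : 0 ≤ b)
    (hba : b ≤ a) :
    ∫⁻ r in Ioi a, ENNReal.ofReal (condDensity p 1 0 r) * radiusKernel p n r (Ioi b) =
      ENNReal.ofReal (Real.exp (-(Real.pi * p.lamBS * a ^ 2))) := by
  calc ∫⁻ r in Ioi a, ENNReal.ofReal (condDensity p 1 0 r) * radiusKernel p n r (Ioi b)
      = ∫⁻ r in Ioi a, ENNReal.ofReal (condDensity p 1 0 r) := by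
        refine setLIntegral_congr_fun measurableSet_Ioi fun r (hr : a < r) => ?_
        have hbr := hba.trans hr.le
        simp only [radiusKernel_Ioi p hn (hb.trans hbr), max_eq_right hbr, sub_self, mul_zero,
          poissonBelow_zero_right hn, ENNReal.ofReal_one, mul_one]
    _ = _ := by
        rw [setLIntegral_condDensity_Ioi_of_le p le_rfl le_rfl (hb.trans hba), poissonBelow_one,
          zero_pow two_ne_zero, sub_zero]

lemma setLIntegral_radiusKernel_Ioi {n : ℕ} (hn : 1 ≤ n) {a b : ℝ} (ha : 0 ≤ a) (hab : a ≤ b) :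
    ∫⁻ r in Ioi a, ENNReal.ofReal (condDensity p 1 0 r) * radiusKernel p n r (Ioi b) =
      ENNReal.ofReal (Real.exp (-(Real.pi * p.lamBS * a ^ 2)) *
        poissonBelow (n + 1) (Real.pi * p.lamBS * (b ^ 2 - a ^ 2))) := by
  have hlam := p.lamBS_pos
  have hmean : 0 ≤ Real.pi * p.lamBS * (b ^ 2 - a ^ 2) :=
    mul_nonneg (by positivity) (by nlinarith)
  have hnonneg : 0 ≤ Real.exp (-(Real.pi * p.lamBS * a ^ 2)) *
      poissonBelow (n + 1) (Real.pi * p.lamBS * (b ^ 2 - a ^ 2)) -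
        Real.exp (-(Real.pi * p.lamBS * b ^ 2)) := by
    refine sub_nonneg.2 (le_trans (le_of_eq ?_) (mul_le_mul_of_nonneg_left
      (exp_neg_le_poissonBelow_succ n hmean) (Real.exp_nonneg _)))
    rw [← Real.exp_add]
    ring_nf
  rw [← Ioc_union_Ioi_eq_Ioi hab, lintegral_union measurableSet_Ioi Ioc_disjoint_Ioi_same,
    setLIntegral_radiusKernel_Ioc p hn ha hab,
    setLIntegral_radiusKernel_Ioi_of_le p hn (ha.trans hab) le_rfl,
    ← ENNReal.ofReal_add hnonneg (Real.exp_nonneg _), sub_add_cancel]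

lemma setLIntegral_radiusKernel_Ioi_max {n : ℕ} (hn : 1 ≤ n) (a b : ℝ) :
    ∫⁻ r in Ioi (max a 0), ENNReal.ofReal (condDensity p 1 0 r) *
        radiusKernel p n r (Ioi (max b (max a 0))) =
      ∫⁻ r in Ioi a, ENNReal.ofReal (condDensity p 1 0 r) * radiusKernel p n r (Ioi b) := by
  rw [← lintegral_indicator measurableSet_Ioi, ← lintegral_indicator measurableSet_Ioi]
  refine lintegral_congr_ae ?_
  filter_upwards [compl_mem_ae_iff.2 (measure_singleton (0 : ℝ))] with r hr0
  rcases (show r ≠ 0 from hr0).lt_or_gt with hr | hr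
  · simp only [indicator_apply, condDensity_of_lt p 1 hr, ENNReal.ofReal_zero, zero_mul, ite_self]
  · by_cases har : a < r
    · simp only [indicator_apply, mem_Ioi, max_lt_iff, har, hr, and_self, if_true,
        radiusKernel_Ioi p hn hr.le, max_assoc, max_eq_right hr.le, max_eq_right har.le]
    · simp only [indicator_apply, mem_Ioi, max_lt_iff, har, false_and, if_false]

end Density

lemma ext_of_Ioi_prod_Ioi {ν ν' : Measure (ℝ × ℝ)} [IsProbabilityMeasure ν]
    [IsProbabilityMeasure ν'] (h : ∀ a b : ℝ, ν (Ioi a ×ˢ Ioi b) = ν' (Ioi a ×ˢ Ioi b)) :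
    ν = ν' := by
  have hborel : MeasurableSpace.generateFrom (range (Ioi : ℝ → Set ℝ)) = Real.measurableSpace :=
    (borel_eq_generateFrom_Ioi ℝ).symm.trans (BorelSpace.measurable_eq (α := ℝ)).symm
  have hspan : IsCountablySpanning (range (Ioi : ℝ → Set ℝ)) := by
    refine ⟨fun n => Ioi (-n), fun n => ⟨_, rfl⟩, eq_univ_of_forall fun x => mem_iUnion.2 ?_⟩
    obtain ⟨n, hn⟩ := exists_nat_gt (-x)
    exact ⟨n, neg_lt.1 hn⟩
  refine ext_of_generate_finite _ (generateFrom_eq_prod hborel hborel hspan hspan).symm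
    (isPiSystem_Ioi.prod isPiSystem_Ioi) ?_ (by simp)
  rintro _ ⟨_, ⟨a, rfl⟩, _, ⟨b, rfl⟩, rfl⟩
  exact h a b

section JointLaw

variable {Ω : Type*} [MeasurableSpace Ω] {μ : Measure Ω} [IsProbabilityMeasure μ] {p : Params}
  {X : ℕ → Ω → Plane}

lemma IsPoissonPointProcess.measure_nthDist_gt_max {lam : ℝ} (hlam : 0 ≤ lam)
    (hX : IsPoissonPointProcess μ (ENNReal.ofReal lam • volume) X) (t : Plane) {n : ℕ}
    (hn : 2 ≤ n) (a b : ℝ) :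
    μ {ω | max a 0 < nthDist X t 1 ω ∧ max b (max a 0) < nthDist X t n ω} =
      μ {ω | a < nthDist X t 1 ω ∧ b < nthDist X t n ω} := by
  refine measure_congr ?_
  filter_upwards [hX.ae_isGeneric hlam t] with ω hω
  have hpos := hω.nthDist_pos le_rfl
  have hlt := hω.nthDist_one_lt hn
  refine propext (?_ : (_ < _ ∧ _ < _) ↔ (_ < _ ∧ _ < _))
  simp only [max_lt_iff]
  exact ⟨fun h => ⟨h.1.1, h.2.1⟩, fun h => ⟨⟨h.1, hpos⟩, h.2, h.1.trans hlt, hpos.trans hlt⟩⟩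

lemma IsPoissonPointProcess.map_nthDist_prod
    (hX : IsPoissonPointProcess μ (ENNReal.ofReal p.lamBS • volume) X) (t : Plane) {n : ℕ}
    (hn : 1 ≤ n) :
    μ.map (fun ω => (nthDist X t 1 ω, nthDist X t (n + 1) ω)) =
      (volume.withDensity fun r => ENNReal.ofReal (condDensity p 1 0 r)) ⊗ₘ radiusKernel p n := by
  have hlam := p.lamBS_pos.le
  have hmeas := (measurable_nthDist hX.measurable t 1).prodMk
    (measurable_nthDist hX.measurable t (n + 1))
  have hdensity : Measurable fun r => ENNReal.ofReal (condDensity p 1 0 r) :=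
    ENNReal.measurable_ofReal.comp ((measurable_condDensity p 1).comp measurable_prodMk_left)
  have := isMarkovKernel_radiusKernel p hn
  have := isProbabilityMeasure_withDensity_condDensity p le_rfl (le_refl 0)
  have := Measure.isProbabilityMeasure_map (μ := μ) hmeas.aemeasurable
  refine ext_of_Ioi_prod_Ioi fun a b => ?_
  rw [Measure.map_apply hmeas (measurableSet_Ioi.prod measurableSet_Ioi),
    Measure.compProd_apply_prod measurableSet_Ioi measurableSet_Ioi,
    setLIntegral_withDensity_eq_setLIntegral_mul _ hdensity
      (Kernel.measurable_coe _ measurableSet_Ioi) measurableSet_Ioi]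
  calc μ {ω | a < nthDist X t 1 ω ∧ b < nthDist X t (n + 1) ω}
      = μ {ω | max a 0 < nthDist X t 1 ω ∧ max b (max a 0) < nthDist X t (n + 1) ω} :=
        (hX.measure_nthDist_gt_max hlam t (Nat.succ_le_succ hn) a b).symm
    _ = ∫⁻ r in Ioi (max a 0), ENNReal.ofReal (condDensity p 1 0 r) *
          radiusKernel p n r (Ioi (max b (max a 0))) := by
        rw [hX.measure_nthDist_gt hlam t (n + 1) (le_max_right a 0) (le_max_right _ _),
          setLIntegral_radiusKernel_Ioi p hn (le_max_right a 0) (le_max_right _ _)]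
    _ = ∫⁻ r in Ioi a, ENNReal.ofReal (condDensity p 1 0 r) * radiusKernel p n r (Ioi b) :=
        setLIntegral_radiusKernel_Ioi_max p hn a b

theorem IsPoissonPointProcess.map_nthDist_eq_compProd
    (hX : IsPoissonPointProcess μ (ENNReal.ofReal p.lamBS • volume) X) (t : Plane) {n : ℕ}
    (hn : 1 ≤ n) :
    μ.map (fun ω => (nthDist X t 1 ω, nthDist X t (n + 1) ω)) =
      μ.map (nthDist X t 1) ⊗ₘ radiusKernel p n := by
  have := isMarkovKernel_radiusKernel p hn
  have hfst := congrArg Measure.fst (hX.map_nthDist_prod t hn)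
  rw [Measure.fst_map_prodMk (measurable_nthDist hX.measurable t (n + 1)),
    Measure.fst_compProd] at hfst
  rw [hfst, hX.map_nthDist_prod t hn]

end JointLaw

/-- The smallest multiple of `2⁻ᵏ` that is greater than `x`, for `x ≥ 0`. -/
def dyadicAbove (k : ℕ) (x : ℝ) : ℝ := ((⌊2 ^ k * x⌋₊ : ℝ) + 1) / 2 ^ k

lemma lt_dyadicAbove (k : ℕ) (x : ℝ) : x < dyadicAbove k x := by
  rw [dyadicAbove, lt_div_iff₀ (by positivity), mul_comm]
  exact Nat.lt_floor_add_one _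

lemma dyadicAbove_le (k : ℕ) {x : ℝ} (hx : 0 ≤ x) : dyadicAbove k x ≤ x + (1 / 2) ^ k := by
  rw [dyadicAbove, add_div, one_div_pow]
  gcongr
  rw [div_le_iff₀ (by positivity), mul_comm]
  exact Nat.floor_le (by positivity)

lemma antitone_dyadicAbove {x : ℝ} (hx : 0 ≤ x) : Antitone fun k => dyadicAbove k x := by
  refine antitone_nat_of_succ_le fun k => ?_
  have hfloor : ⌊2 ^ (k + 1) * x⌋₊ < 2 * (⌊2 ^ k * x⌋₊ + 1) := by
    rw [Nat.floor_lt (by positivity), pow_succ']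
    push_cast
    linarith [Nat.lt_floor_add_one (2 ^ k * x)]
  have hfloor' : (⌊2 ^ (k + 1) * x⌋₊ : ℝ) + 1 ≤ 2 * (⌊2 ^ k * x⌋₊ + 1) := by exact_mod_cast hfloor
  rw [dyadicAbove, dyadicAbove, ← mul_div_mul_left _ ((2 : ℝ) ^ k) two_ne_zero, ← pow_succ']
  gcongr

lemma tendsto_dyadicAbove {x : ℝ} (hx : 0 ≤ x) :
    Tendsto (fun k => dyadicAbove k x) atTop (𝓝 x) := by
  have hlim : Tendsto (fun k : ℕ => x + (1 / 2 : ℝ) ^ k) atTop (𝓝 x) := by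
    simpa only [add_zero] using
      (tendsto_pow_atTop_nhds_zero_of_lt_one (by norm_num) one_half_lt_one).const_add x
  exact tendsto_of_tendsto_of_tendsto_of_le_of_le tendsto_const_nhds hlim
    (fun k => (lt_dyadicAbove k x).le) fun k => dyadicAbove_le k hx

lemma measurable_dyadicAbove (k : ℕ) : Measurable (dyadicAbove k) := by
  unfold dyadicAbove
  fun_prop

lemma tendsto_lintegral_indicator_Ioi {α : Type*} [MeasurableSpace α] {ν : Measure α} {d : α → ℝ}
    (hd : Measurable d) {g : ℝ → ℝ≥0∞} (hg : Measurable g) {r : ℕ → ℝ} (hr : Antitone r) {ρ : ℝ}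
    (hρ : ∀ k, ρ ≤ r k) (hlim : Tendsto r atTop (𝓝 ρ)) :
    Tendsto (fun k => ∫⁻ x, (Ioi (r k)).indicator g (d x) ∂ν) atTop
      (𝓝 (∫⁻ x, (Ioi ρ).indicator g (d x) ∂ν)) := by
  refine lintegral_tendsto_of_tendsto_of_monotone
    (fun k => ((hg.indicator measurableSet_Ioi).comp hd).aemeasurable)
    (Eventually.of_forall fun x k l hkl => indicator_le_indicator_of_subset
      (Ioi_subset_Ioi (hr hkl)) (fun _ => zero_le) _)
    (Eventually.of_forall fun x => tendsto_const_nhds.congr' ?_)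
  rcases le_or_gt (d x) ρ with hx | hx
  · refine Eventually.of_forall fun k => ?_
    simp [hx, hx.trans (hρ k)]
  · filter_upwards [hlim.eventually_lt_const hx] with k hk
    simp [hx, hk]

lemma lintegral_congr_of_fibers {Ω ι : Type*} [MeasurableSpace Ω] {μ : Measure Ω} [Countable ι]
    [MeasurableSpace ι] [MeasurableSingletonClass ι] {N : Ω → ι} (hN : Measurable N)
    {F G : Ω → ℝ≥0∞} (hFG : ∀ i, ∫⁻ ω in N ⁻¹' {i}, F ω ∂μ = ∫⁻ ω in N ⁻¹' {i}, G ω ∂μ) :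
    ∫⁻ ω, F ω ∂μ = ∫⁻ ω, G ω ∂μ := by
  have hU : ⋃ i, N ⁻¹' {i} = univ := by
    rw [← preimage_iUnion, iUnion_of_singleton, preimage_univ]
  have hd : Pairwise fun i j => Disjoint (N ⁻¹' {i}) (N ⁻¹' {j}) := fun i j hij =>
    (disjoint_singleton.2 hij).preimage N
  have hm : ∀ i, MeasurableSet (N ⁻¹' {i}) := fun i => hN (measurableSet_singleton i)
  rw [← setLIntegral_univ F, ← setLIntegral_univ G, ← hU, lintegral_iUnion hm hd,
    lintegral_iUnion hm hd]
  exact tsum_congr hFG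

section Tail

/-- The function `x ↦ g (dist x t)`, cut off to the exterior of the closed disc of radius `ρ`
around `t`. -/
def radialTail (t : Plane) (g : ℝ → ℝ≥0∞) (ρ : ℝ) (x : Plane) : ℝ≥0∞ :=
  (Ioi ρ).indicator g (dist x t)

/-- The exponent in the Laplace functional of a Poisson process with intensity measure `Λ` at the
function `radialTail t g ρ`. -/
def tailExponent (Λ : Measure Plane) (t : Plane) (g : ℝ → ℝ≥0∞) (ρ : ℝ) : ℝ≥0∞ :=
  ∫⁻ x, (Ioi ρ).indicator (fun d => 1 - expNeg (g d)) (dist x t) ∂Λ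

variable {t : Plane} {g : ℝ → ℝ≥0∞} {Λ : Measure Plane}

lemma radialTail_eq_indicator (t : Plane) (g : ℝ → ℝ≥0∞) (ρ : ℝ) :
    radialTail t g ρ = (Metric.closedBall t ρ)ᶜ.indicator fun x => g (dist x t) := by
  ext x
  by_cases hx : ρ < dist x t <;> simp [radialTail, hx]

lemma lintegral_one_sub_expNeg_radialTail (Λ : Measure Plane) (t : Plane) (g : ℝ → ℝ≥0∞)
    (ρ : ℝ) : ∫⁻ x, (1 - expNeg (radialTail t g ρ x)) ∂Λ = tailExponent Λ t g ρ := by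
  refine lintegral_congr fun x => ?_
  by_cases hx : ρ < dist x t <;> simp [radialTail, hx]

lemma measurable_tailExponent (Λ : Measure Plane) (t : Plane) (g : ℝ → ℝ≥0∞) :
    Measurable (tailExponent Λ t g) :=
  Antitone.measurable fun _ _ h => lintegral_mono fun _ =>
    indicator_le_indicator_of_subset (Ioi_subset_Ioi h) (fun _ => zero_le) _

lemma IsGeneric.pointSum_indicator_Ici {Ω : Type*} {X : ℕ → Ω → Plane} {ω : Ω}
    (h : IsGeneric X t ω) {n : ℕ} (hn : 1 ≤ n) (g : ℝ → ℝ≥0∞) :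
    pointSum X (fun x => (Ici (nthDist X t n ω)).indicator g (dist x t)) ω =
      g (nthDist X t n ω) + pointSum X (radialTail t g (nthDist X t n ω)) ω := by
  obtain ⟨i, hi⟩ := h.exists_dist_eq_nthDist hn
  rw [pointSum, pointSum, ← tsum_ite_eq i fun _ => g (nthDist X t n ω), ← ENNReal.tsum_add]
  refine tsum_congr fun j => ?_
  rw [← hi, radialTail]
  by_cases hj : j = i
  · simp [hj]
  · have hne : dist (X i ω) t ≠ dist (X j ω) t := fun h' => hj (h.injective h'.symm)
    simp [indicator_apply, hj, hne.le_iff_lt]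

variable {Ω : Type*} [MeasurableSpace Ω] {μ : Measure Ω} {X : ℕ → Ω → Plane} {n : ℕ}

lemma measurable_pointSum_radialTail (hX : ∀ i, Measurable (X i)) (hg : Measurable g) {R : Ω → ℝ}
    (hR : Measurable R) : Measurable fun ω => pointSum X (radialTail t g (R ω)) ω := by
  refine Measurable.tsum fun i => ?_
  have hd : Measurable fun ω => dist (X i ω) t := (hX i).dist measurable_const
  exact (hg.comp hd).indicator (measurableSet_lt hR hd)

variable [IsProbabilityMeasure μ] [IsLocallyFiniteMeasure Λ]

-- The weight `φ (R₁, Rₙ)` depends only on the points within distance `r`, since it is zero when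
-- `Rₙ` is at least `r`.
lemma IsPoissonPointProcess.lintegral_mul_expNeg_pointSum_of_forall_le_eq_zero
    (hX : IsPoissonPointProcess μ Λ X) (hn : 1 ≤ n) (hg : Measurable g) {φ : ℝ × ℝ → ℝ≥0∞}
    (hφ : Measurable φ) {r : ℝ} (hφ0 : ∀ a ρ, r ≤ ρ → φ (a, ρ) = 0) :
    ∫⁻ ω, φ (nthDist X t 1 ω, nthDist X t n ω) * expNeg (pointSum X (radialTail t g r) ω) ∂μ =
      ∫⁻ ω, φ (nthDist X t 1 ω, nthDist X t n ω) * expNeg (tailExponent Λ t g r) ∂μ := by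
  have hloc : (fun ω => φ (nthDist X t 1 ω, nthDist X t n ω)) =
      fun ω => φ (min (nthDist X t 1 ω) r, min (nthDist X t n ω) r) := by
    ext ω
    rcases le_or_gt r (nthDist X t n ω) with h | h
    · rw [hφ0 _ _ h, min_eq_right h, hφ0 _ _ le_rfl]
    · rw [min_eq_left h.le, min_eq_left ((nthDist_mono X t ω hn).trans h.le)]
  have hmeas : Measurable[countAlgebra Λ X (Metric.closedBall t r)]
      fun ω => φ (nthDist X t 1 ω, nthDist X t n ω) := by
    rw [hloc]
    exact hφ.comp ((measurable_countAlgebra_min_nthDist X t 1 r).prodMk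
      (measurable_countAlgebra_min_nthDist X t n r))
  have hout : MeasurableSet (Metric.closedBall t r)ᶜ :=
    Metric.isClosed_closedBall.measurableSet.compl
  have hgd : Measurable fun x => g (dist x t) := hg.comp (measurable_id.dist measurable_const)
  rw [lintegral_mul_const' _ _ (expNeg_ne_top _), radialTail_eq_indicator,
    hX.lintegral_mul_expNeg_pointSum_of_disjoint disjoint_compl_right hout hmeas hgd,
    hX.lintegral_expNeg_pointSum (hgd.indicator hout), ← radialTail_eq_indicator,
    lintegral_one_sub_expNeg_radialTail]

lemma IsPoissonPointProcess.lintegral_mul_expNeg_pointSum_dyadicAbove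
    (hX : IsPoissonPointProcess μ Λ X) (hn : 1 ≤ n) (hg : Measurable g) {φ : ℝ × ℝ → ℝ≥0∞}
    (hφ : Measurable φ) (k : ℕ) :
    ∫⁻ ω, φ (nthDist X t 1 ω, nthDist X t n ω) *
        expNeg (pointSum X (radialTail t g (dyadicAbove k (nthDist X t n ω))) ω) ∂μ =
      ∫⁻ ω, φ (nthDist X t 1 ω, nthDist X t n ω) *
        expNeg (tailExponent Λ t g (dyadicAbove k (nthDist X t n ω))) ∂μ := by
  have hfloor : Measurable fun ρ : ℝ => ⌊2 ^ k * ρ⌋₊ := by fun_prop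
  have hR := measurable_nthDist hX.measurable t n
  refine lintegral_congr_of_fibers (hfloor.comp hR) fun j => ?_
  let B : Set (ℝ × ℝ) := {z | ⌊2 ^ k * z.2⌋₊ = j}
  have hB : MeasurableSet B := hfloor.comp measurable_snd (measurableSet_singleton j)
  have hB0 (a ρ : ℝ) (hρ : (j + 1) / 2 ^ k ≤ ρ) : B.indicator φ (a, ρ) = 0 := by
    have hnot : (a, ρ) ∉ B := fun h =>
      absurd (lt_dyadicAbove k ρ) (not_lt.2 (by rwa [dyadicAbove, show ⌊2 ^ k * ρ⌋₊ = j from h]))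
    exact indicator_of_notMem hnot φ
  have hstep := hX.lintegral_mul_expNeg_pointSum_of_forall_le_eq_zero (t := t) hn hg
    (hφ.indicator hB) hB0
  have hfiber : MeasurableSet ((fun ω => ⌊2 ^ k * nthDist X t n ω⌋₊) ⁻¹' {j}) :=
    hfloor.comp hR (measurableSet_singleton j)
  rw [Function.comp_def, ← lintegral_indicator hfiber, ← lintegral_indicator hfiber]
  convert hstep using 3 with ω ω <;>
  by_cases hω : ⌊2 ^ k * nthDist X t n ω⌋₊ = j <;> simp [B, dyadicAbove, hω]

theorem IsPoissonPointProcess.lintegral_mul_expNeg_pointSum_radialTail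
    (hX : IsPoissonPointProcess μ Λ X) (hn : 1 ≤ n) (hg : Measurable g) {φ : ℝ × ℝ → ℝ≥0∞}
    (hφ : Measurable φ) (hφ1 : ∀ z, φ z ≤ 1) :
    ∫⁻ ω, φ (nthDist X t 1 ω, nthDist X t n ω) *
        expNeg (pointSum X (radialTail t g (nthDist X t n ω)) ω) ∂μ =
      ∫⁻ ω, φ (nthDist X t 1 ω, nthDist X t n ω) *
        expNeg (tailExponent Λ t g (nthDist X t n ω)) ∂μ := by
  have hR := measurable_nthDist hX.measurable t n
  have hRk := fun k => (measurable_dyadicAbove k).comp hR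
  have hZ := hφ.comp ((measurable_nthDist hX.measurable t 1).prodMk hR)
  have hlim {α : Type} [MeasurableSpace α] (ν : Measure α) {d : α → ℝ} (hd : Measurable d)
      {h : ℝ → ℝ≥0∞} (hh : Measurable h) (ω : Ω) :=
    tendsto_lintegral_indicator_Ioi (ν := ν) hd hh
      (antitone_dyadicAbove (nthDist_nonneg X t n ω)) (fun k => (lt_dyadicAbove k _).le)
      (tendsto_dyadicAbove (nthDist_nonneg X t n ω))
  refine tendsto_nhds_unique
    (tendsto_lintegral_mul_expNeg hZ (fun _ => hφ1 _)
      (fun k => measurable_pointSum_radialTail hX.measurable hg (hRk k))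
      (Eventually.of_forall fun ω => ?_))
    ((tendsto_lintegral_mul_expNeg hZ (fun _ => hφ1 _)
      (fun k => (measurable_tailExponent Λ t g).comp (hRk k))
      (Eventually.of_forall fun ω => ?_)).congr fun k =>
        (hX.lintegral_mul_expNeg_pointSum_dyadicAbove hn hg hφ k).symm)
  · have hsum := hlim Measure.count (measurable_of_countable fun i => dist (X i ω) t) hg ω
    simp only [lintegral_count] at hsum
    exact hsum
  · exact hlim Λ (measurable_id.dist measurable_const)
      (measurable_const.sub (measurable_expNeg.comp hg)) ω

lemma IsPoissonPointProcess.lintegral_mul_expNeg_pointSum_indicator_Ici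
    (hX : IsPoissonPointProcess μ Λ X) (hgen : ∀ᵐ ω ∂μ, IsGeneric X t ω) (hn : 1 ≤ n)
    (hg : Measurable g) {φ : ℝ × ℝ → ℝ≥0∞} (hφ : Measurable φ) (hφ1 : ∀ z, φ z ≤ 1) :
    ∫⁻ ω, φ (nthDist X t 1 ω, nthDist X t n ω) *
        expNeg (pointSum X (fun x => (Ici (nthDist X t n ω)).indicator g (dist x t)) ω) ∂μ =
      ∫⁻ ω, φ (nthDist X t 1 ω, nthDist X t n ω) * (expNeg (g (nthDist X t n ω)) *
        expNeg (tailExponent Λ t g (nthDist X t n ω))) ∂μ := by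
  have htail := hX.lintegral_mul_expNeg_pointSum_radialTail (t := t) hn hg
    (φ := fun z => φ z * expNeg (g z.2))
    (hφ.mul (measurable_expNeg.comp (hg.comp measurable_snd)))
    fun z => mul_le_one' (hφ1 z) (expNeg_le_one _)
  simp only [mul_assoc] at htail
  rw [← htail]
  refine lintegral_congr_ae (hgen.mono fun ω hω => ?_)
  simp only [hω.pointSum_indicator_Ici hn g, expNeg_add]

end Tail

section MarkLaw

variable (p : Params)

lemma losProb_nonneg (r : ℝ) : 0 ≤ losProb p r := Real.exp_nonneg _

lemma losProb_le_one {r : ℝ} (hr : 0 ≤ r) : losProb p r ≤ 1 :=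
  Real.exp_le_one_iff.2 (by nlinarith [p.etaB_pos])

lemma measurable_losProb : Measurable (losProb p) := by
  unfold losProb
  fun_prop

lemma beamProb_nonneg : 0 ≤ beamProb p := by
  have := p.thetaB_pos
  unfold beamProb
  positivity

lemma beamProb_le_one : beamProb p ≤ 1 := by
  rw [beamProb, div_le_one (by positivity)]
  exact p.beams_le

lemma lintegral_bernoulliMeasure_projIcc {q : ℝ} (hq0 : 0 ≤ q) (hq1 : q ≤ 1) (f : Bool → ℝ≥0∞) :
    ∫⁻ b, f b ∂(bernoulliMeasure true false (projIcc (0 : ℝ) 1 zero_le_one q)) =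
      ENNReal.ofReal q * f true + ENNReal.ofReal (1 - q) * f false := by
  rw [bernoulliMeasure_def, lintegral_add_measure, projIcc_of_mem _ ⟨hq0, hq1⟩]
  simp only [lintegral_smul_measure, lintegral_dirac]
  rw [ENNReal.ofReal_eq_coe_nnreal hq0, ENNReal.ofReal_eq_coe_nnreal (sub_nonneg.2 hq1)]
  rfl

instance isProbabilityMeasure_expMeasure_sigmaAv :
    IsProbabilityMeasure (expMeasure p.sigmaAv⁻¹) :=
  isProbabilityMeasure_expMeasure (inv_pos.2 p.sigmaAv_pos)

instance isProbabilityMeasure_markLaw (t x : Plane) : IsProbabilityMeasure (markLaw p t x) := by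
  unfold markLaw
  infer_instance

lemma lintegral_markLaw (t x : Plane) {f : Mark → ℝ≥0∞} (hf : Measurable f) :
    ∫⁻ m, f m ∂markLaw p t x =
      ENNReal.ofReal (losProb p (dist x t)) *
          (ENNReal.ofReal (beamProb p) * ∫⁻ σ, f (true, true, σ) ∂expMeasure p.sigmaAv⁻¹ +
            ENNReal.ofReal (1 - beamProb p) * ∫⁻ σ, f (true, false, σ) ∂expMeasure p.sigmaAv⁻¹) +
        ENNReal.ofReal (1 - losProb p (dist x t)) *
          (ENNReal.ofReal (beamProb p) * ∫⁻ σ, f (false, true, σ) ∂expMeasure p.sigmaAv⁻¹ +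
            ENNReal.ofReal (1 - beamProb p) *
              ∫⁻ σ, f (false, false, σ) ∂expMeasure p.sigmaAv⁻¹) := by
  have hbeam (b : Bool) : ∫⁻ z, f (b, z) ∂((bernoulliMeasure true false
      (projIcc (0 : ℝ) 1 zero_le_one (beamProb p))).prod (expMeasure p.sigmaAv⁻¹)) =
      ENNReal.ofReal (beamProb p) * ∫⁻ σ, f (b, true, σ) ∂expMeasure p.sigmaAv⁻¹ +
        ENNReal.ofReal (1 - beamProb p) * ∫⁻ σ, f (b, false, σ) ∂expMeasure p.sigmaAv⁻¹ := by
    rw [lintegral_prod (fun z => f (b, z)) (hf.comp measurable_prodMk_left).aemeasurable,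
      lintegral_bernoulliMeasure_projIcc (beamProb_nonneg p) (beamProb_le_one p)
        fun b' => ∫⁻ σ, f (b, b', σ) ∂expMeasure p.sigmaAv⁻¹]
  rw [markLaw, lintegral_prod _ hf.aemeasurable, lintegral_bernoulliMeasure_projIcc
    (losProb_nonneg p _) (losProb_le_one p dist_nonneg) fun b => ∫⁻ z, f (b, z)
      ∂((bernoulliMeasure true false
      (projIcc (0 : ℝ) 1 zero_le_one (beamProb p))).prod (expMeasure p.sigmaAv⁻¹)), hbeam, hbeam]

/-- The law of the marks as a Markov kernel, from the position of a base station to its marks. -/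
def markLawKernel (t : Plane) : Kernel Plane Mark where
  toFun := markLaw p t
  measurable' := by
    refine Measure.measurable_of_measurable_coe _ fun B hB => ?_
    have := measurable_losProb p
    simp_rw [← lintegral_indicator_one hB, lintegral_markLaw p t _ (measurable_one.indicator hB)]
    fun_prop

instance isMarkovKernel_markLawKernel (t : Plane) : IsMarkovKernel (markLawKernel p t) :=
  ⟨fun x => isProbabilityMeasure_markLaw p t x⟩

lemma lintegral_markLaw_of_forall_eq_one (t x : Plane) {f : Mark → ℝ≥0∞} (hf : Measurable f)
    (hf1 : ∀ m : Mark, ¬(m.1 = true ∧ m.2.1 = true) → f m = 1) {v : ℝ} (hv : 0 ≤ v)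
    (hfv : ∫⁻ σ, f (true, true, σ) ∂expMeasure p.sigmaAv⁻¹ = ENNReal.ofReal v) :
    ∫⁻ m, f m ∂markLaw p t x =
      ENNReal.ofReal (1 - beamProb p * losProb p (dist x t) * (1 - v)) := by
  have hone (b b' : Bool) (hb : ¬(b = true ∧ b' = true)) :
      ∫⁻ σ, f (b, b', σ) ∂expMeasure p.sigmaAv⁻¹ = ENNReal.ofReal 1 := by
    simp [hf1 (b, b', _) hb]
  have hb0 := beamProb_nonneg p
  have hb1 := sub_nonneg.2 (beamProb_le_one p)
  have hl0 := losProb_nonneg p (dist x t)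
  have hl1 := sub_nonneg.2 (losProb_le_one p (dist_nonneg (x := x) (y := t)))
  rw [lintegral_markLaw p t x hf, hfv, hone true false (by decide), hone false true (by decide),
    hone false false (by decide), ← ENNReal.ofReal_mul hb0, ← ENNReal.ofReal_mul hb0,
    ← ENNReal.ofReal_mul hb1, ← ENNReal.ofReal_add (by positivity) (by positivity),
    ← ENNReal.ofReal_add (by positivity) (by positivity), ← ENNReal.ofReal_mul hl0,
    ← ENNReal.ofReal_mul hl1, ← ENNReal.ofReal_add (by positivity) (by positivity)]
  congr 1
  ring

lemma lintegral_expMeasure_expNeg {r c : ℝ} (hr : 0 < r) (hc : 0 ≤ c) :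
    ∫⁻ σ, expNeg (ENNReal.ofReal (c * σ)) ∂expMeasure r = ENNReal.ofReal (r / (r + c)) := by
  have hrc : 0 < r + c := by linarith
  have hpdf (r : ℝ) : Measurable (exponentialPDF r) :=
    (measurable_exponentialPDFReal r).ennreal_ofReal
  have htilt (σ : ℝ) : (exponentialPDF r * fun σ => expNeg (ENNReal.ofReal (c * σ))) σ =
      ENNReal.ofReal (r / (r + c)) * exponentialPDF (r + c) σ := by
    rw [Pi.mul_apply, exponentialPDF_eq, exponentialPDF_eq]
    split_ifs with h
    · rw [expNeg_ofReal (mul_nonneg hc h), ← ENNReal.ofReal_mul (by positivity),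
        ← ENNReal.ofReal_mul (by positivity), mul_assoc, ← Real.exp_add, ← mul_assoc,
        div_mul_cancel₀ _ hrc.ne']
      congr 3
      ring
    · simp
  have hf : Measurable fun σ : ℝ => expNeg (ENNReal.ofReal (c * σ)) :=
    measurable_expNeg.comp (by fun_prop)
  rw [show expMeasure r = volume.withDensity (exponentialPDF r) from rfl,
    lintegral_withDensity_eq_lintegral_mul _ (hpdf r) hf,
    lintegral_congr htilt, lintegral_const_mul _ (hpdf _), lintegral_exponentialPDF_eq_one hrc,
    mul_one]

lemma ae_nonneg_expMeasure (r : ℝ) : ∀ᵐ σ ∂expMeasure r, 0 ≤ σ := by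
  have hpdf : Measurable (exponentialPDF r) := (measurable_exponentialPDFReal r).ennreal_ofReal
  rw [show expMeasure r = volume.withDensity (exponentialPDF r) from rfl, ae_withDensity_iff hpdf]
  refine Eventually.of_forall fun σ hσ => ?_
  by_contra! hneg
  exact hσ (exponentialPDF_of_neg hneg)

lemma ae_nonneg_markLaw (t x : Plane) : ∀ᵐ m ∂markLaw p t x, 0 ≤ m.2.2 :=
  Measure.quasiMeasurePreserving_snd.ae
    (Measure.quasiMeasurePreserving_snd.ae (ae_nonneg_expMeasure _))

end MarkLaw

section Loss

variable (p : Params)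

/-- The contribution `σ d ^ (-α)` to the echo of the target of a base station at `x` with mark `m`,
as in `echoTerm`. -/
def echo (t : Plane) (D : Set ℝ) (x : Plane) (m : Mark) : ℝ :=
  open Classical in
  if m.1 = true ∧ m.2.1 = true ∧ dist x t ∈ D then m.2.2 * dist x t ^ (-p.alphaL) else 0

/-- The expected loss `1 - 𝔼 exp (-c e)`, where `e` is the contribution to the echo of a base
station at distance `d`: `σ d ^ (-α)` or, if it is blocked or does not illuminate, `0`. -/
def markLoss (c d : ℝ) : ℝ :=
  beamProb p * losProb p d * (1 - 1 / (1 + c * d ^ (-p.alphaL) * p.sigmaAv))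

/-- The number `h` with `exp (-h) = 1 - markLoss p c d`: a marked base station contributes to
Laplace transforms like an unmarked one with the deterministic cost `h`. -/
def markCost (c d : ℝ) : ℝ≥0∞ := ENNReal.ofReal (-Real.log (1 - markLoss p c d))

lemma measurable_markLoss : Measurable (Function.uncurry (markLoss p)) := by
  unfold markLoss losProb Function.uncurry
  fun_prop

lemma measurable_markCost : Measurable (Function.uncurry (markCost p)) :=
  ENNReal.measurable_ofReal.comp
    ((Real.measurable_log.comp (measurable_const.sub (measurable_markLoss p))).neg)

variable {p} {c d : ℝ}

lemma measurable_echo {α : Type*} [MeasurableSpace α] {t : Plane} {D : α → Set ℝ}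
    (hD : MeasurableSet {z : α × ℝ | z.2 ∈ D z.1}) {x : α → Plane} (hx : Measurable x)
    {m : α → Mark} (hm : Measurable m) : Measurable fun a => echo p t (D a) (x a) (m a) := by
  have hlos : MeasurableSet {a | (m a).1 = true} := hm.fst (measurableSet_singleton true)
  have hbeam : MeasurableSet {a | (m a).2.1 = true} := hm.snd.fst (measurableSet_singleton true)
  have hdist : MeasurableSet {a | dist (x a) t ∈ D a} :=
    (measurable_id.prodMk (hx.dist measurable_const)) hD
  exact Measurable.ite (hlos.inter (hbeam.inter hdist)) (by fun_prop) measurable_const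

lemma losArg_nonneg (hc : 0 ≤ c) (hd : 0 ≤ d) : 0 ≤ c * d ^ (-p.alphaL) * p.sigmaAv := by
  have := p.sigmaAv_pos
  positivity

lemma markLoss_nonneg (hc : 0 ≤ c) (hd : 0 ≤ d) : 0 ≤ markLoss p c d := by
  have harg := losArg_nonneg (p := p) hc hd
  refine mul_nonneg (mul_nonneg (beamProb_nonneg p) (losProb_nonneg p d)) ?_
  rw [sub_nonneg, div_le_one (by positivity)]
  linarith

lemma markLoss_lt_one (hc : 0 ≤ c) (hd : 0 ≤ d) : markLoss p c d < 1 := by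
  have harg := losArg_nonneg (p := p) hc hd
  have hprob : beamProb p * losProb p d ≤ 1 :=
    mul_le_one₀ (beamProb_le_one p) (losProb_nonneg p d) (losProb_le_one p hd)
  have hinv : 0 < 1 / (1 + c * d ^ (-p.alphaL) * p.sigmaAv) := by positivity
  have hinv1 : 1 / (1 + c * d ^ (-p.alphaL) * p.sigmaAv) ≤ 1 := by
    rw [div_le_one (by positivity)]
    linarith
  exact (mul_le_of_le_one_left (sub_nonneg.2 hinv1) hprob).trans_lt (sub_lt_self 1 hinv)

lemma markLoss_mono {c' : ℝ} (hc : 0 ≤ c) (hcc : c ≤ c') (hd : 0 ≤ d) :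
    markLoss p c d ≤ markLoss p c' d := by
  have := losArg_nonneg (p := p) hc hd
  have := mul_nonneg (beamProb_nonneg p) (losProb_nonneg p d)
  have := p.sigmaAv_pos
  unfold markLoss
  gcongr

lemma markLoss_le_losProb (hc : 0 ≤ c) (hd : 0 ≤ d) : markLoss p c d ≤ losProb p d := by
  have hprob : beamProb p * losProb p d ≤ losProb p d :=
    mul_le_of_le_one_left (losProb_nonneg p d) (beamProb_le_one p)
  have := losArg_nonneg (p := p) hc hd
  refine (mul_le_of_le_one_right ?_ (sub_le_self 1 (by positivity))).trans hprob
  exact mul_nonneg (beamProb_nonneg p) (losProb_nonneg p d)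

lemma expNeg_markCost (hc : 0 ≤ c) (hd : 0 ≤ d) :
    expNeg (markCost p c d) = ENNReal.ofReal (1 - markLoss p c d) := by
  have hpos : 0 < 1 - markLoss p c d := sub_pos.2 (markLoss_lt_one hc hd)
  have hlog : Real.log (1 - markLoss p c d) ≤ 0 :=
    Real.log_nonpos hpos.le (sub_le_self 1 (markLoss_nonneg hc hd))
  rw [markCost, expNeg_ofReal (neg_nonneg.2 hlog), neg_neg, Real.exp_log hpos]

lemma one_sub_expNeg_markCost (hc : 0 ≤ c) (hd : 0 ≤ d) :
    1 - expNeg (markCost p c d) = ENNReal.ofReal (markLoss p c d) := by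
  rw [expNeg_markCost hc hd, ← ENNReal.ofReal_one,
    ← ENNReal.ofReal_sub _ (sub_nonneg.2 (markLoss_lt_one hc hd).le), sub_sub_cancel]

lemma lintegral_markLaw_expNeg_echo (t x : Plane) (D : Set ℝ) (hc : 0 ≤ c) :
    ∫⁻ m, expNeg (ENNReal.ofReal c * ENNReal.ofReal (echo p t D x m)) ∂markLaw p t x =
      expNeg (D.indicator (markCost p c) (dist x t)) := by
  by_cases hD : dist x t ∈ D
  swap
  · simp [echo, hD]
  have harg := losArg_nonneg (p := p) hc (dist_nonneg (x := x) (y := t))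
  have huniv : echo p t D x = echo p t univ x := by
    ext m
    simp [echo, hD]
  have hecho : Measurable (echo p t D x) := huniv ▸
    measurable_echo (D := fun _ => univ) MeasurableSet.univ measurable_const measurable_id
  have hmeas : Measurable fun m => expNeg (ENNReal.ofReal c * ENNReal.ofReal (echo p t D x m)) :=
    measurable_expNeg.comp (by fun_prop)
  have hexp : ∫⁻ σ, expNeg (ENNReal.ofReal c * ENNReal.ofReal (echo p t D x (true, true, σ)))
      ∂expMeasure p.sigmaAv⁻¹ =
      ENNReal.ofReal (1 / (1 + c * dist x t ^ (-p.alphaL) * p.sigmaAv)) := by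
    have hσ := p.sigmaAv_pos
    have hterm (σ : ℝ) : ENNReal.ofReal c * ENNReal.ofReal (echo p t D x (true, true, σ)) =
        ENNReal.ofReal (c * dist x t ^ (-p.alphaL) * σ) := by
      rw [echo, if_pos ⟨rfl, rfl, hD⟩, ← ENNReal.ofReal_mul hc, mul_assoc, mul_comm σ]
    simp_rw [hterm]
    rw [lintegral_expMeasure_expNeg (inv_pos.2 hσ) (by positivity)]
    congr 1
    field_simp
  rw [indicator_of_mem hD, expNeg_markCost hc dist_nonneg]
  refine lintegral_markLaw_of_forall_eq_one p t x hmeas (fun m hm => ?_) (by positivity) hexp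
  rw [echo, if_neg fun h => hm ⟨h.1, h.2.1⟩, ENNReal.ofReal_zero, mul_zero, expNeg_zero]

end Loss

section Radial

lemma lintegral_ofReal_dist (t : Plane) {g : ℝ → ℝ} (hg : ∀ r, 0 ≤ r → 0 ≤ g r)
    (hintegrable : IntegrableOn (fun r => g r * r) (Ioi 0)) :
    ∫⁻ x, ENNReal.ofReal (g (dist x t)) =
      ENNReal.ofReal (2 * Real.pi * ∫ r in Ioi 0, g r * r) := by
  have hdim : Module.finrank ℝ Plane = 2 := by simp
  have hball : (volume : Measure Plane).real (Metric.ball 0 1) = Real.pi := by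
    simp [Measure.real, EuclideanSpace.volume_ball_fin_two, Real.pi_pos.le]
  have hnorm : Integrable (fun x : Plane => g ‖x‖) := by
    rw [integrable_fun_norm_addHaar, hdim]
    simpa [mul_comm] using hintegrable
  have hpolar : ∫ x : Plane, g ‖x‖ = 2 * Real.pi * ∫ r in Ioi 0, g r * r := by
    rw [integral_fun_norm_addHaar, hdim, hball]
    simp [mul_comm, mul_assoc, mul_left_comm]
  calc ∫⁻ x, ENNReal.ofReal (g (dist x t)) = ∫⁻ x : Plane, ENNReal.ofReal (g ‖x‖) := by
        simp_rw [dist_eq_norm]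
        exact lintegral_sub_right_eq_self (fun x : Plane => ENNReal.ofReal (g ‖x‖)) t
    _ = ENNReal.ofReal (2 * Real.pi * ∫ r in Ioi 0, g r * r) := by
        rw [← hpolar, ofReal_integral_eq_lintegral_ofReal hnorm
          (Eventually.of_forall fun x => hg _ (norm_nonneg x))]

variable (p : Params)

lemma integrableOn_losProb_mul : IntegrableOn (fun r => losProb p r * r) (Ioi 0) := by
  have h := integrableOn_rpow_mul_exp_neg_mul_rpow (s := 1) (p := 1) (b := p.etaB) (by norm_num)
    one_pos p.etaB_pos
  refine h.congr_fun (fun r _ => ?_) measurableSet_Ioi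
  simp [losProb, mul_comm]

/-- The Laplace transform at `c` of the sum of the echoes of the base stations at distance more
than `ρ` from the target. -/
def echoLaplace (c ρ : ℝ) : ℝ :=
  Real.exp (-(p.lamBS * (2 * Real.pi * ∫ r in Ioi ρ, markLoss p c r * r)))

lemma echoLaplace_nonneg (c ρ : ℝ) : 0 ≤ echoLaplace p c ρ := Real.exp_nonneg _

lemma measurable_echoLaplace : Measurable (Function.uncurry (echoLaplace p)) := by
  have hset : MeasurableSet {z : (ℝ × ℝ) × ℝ | z.1.2 < z.2} :=
    measurableSet_lt (by fun_prop) (by fun_prop)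
  have hloss : Measurable fun z : (ℝ × ℝ) × ℝ => markLoss p z.1.1 z.2 * z.2 :=
    ((measurable_markLoss p).comp (f := fun z : (ℝ × ℝ) × ℝ => (z.1.1, z.2)) (by fun_prop)).mul
      measurable_snd
  have hintegral : Measurable fun z : ℝ × ℝ => ∫ r in Ioi z.2, markLoss p z.1 r * r := by
    simp_rw [← integral_indicator measurableSet_Ioi]
    exact (hloss.indicator hset).stronglyMeasurable.integral_prod_right'.measurable
  exact Real.measurable_exp.comp ((hintegral.const_mul _).const_mul _).neg

variable {p} {c ρ : ℝ}

lemma integrableOn_markLoss_mul (hc : 0 ≤ c) (hρ : 0 ≤ ρ) :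
    IntegrableOn (fun r => markLoss p c r * r) (Ioi ρ) := by
  refine ((integrableOn_losProb_mul p).mono_set (Ioi_subset_Ioi hρ)).mono' ?_ ?_
  · exact (((measurable_markLoss p).comp measurable_prodMk_left).mul measurable_id
      ).aestronglyMeasurable
  · refine ae_restrict_of_forall_mem measurableSet_Ioi fun r (hr : ρ < r) => ?_
    have hr0 := hρ.trans hr.le
    rw [Real.norm_of_nonneg (mul_nonneg (markLoss_nonneg hc hr0) hr0)]
    exact mul_le_mul_of_nonneg_right (markLoss_le_losProb hc hr0) hr0

lemma echoLaplace_anti {c' : ℝ} (hc : 0 ≤ c) (hcc : c ≤ c') (hρ : 0 ≤ ρ) :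
    echoLaplace p c' ρ ≤ echoLaplace p c ρ := by
  have hintegral : ∫ r in Ioi ρ, markLoss p c r * r ≤ ∫ r in Ioi ρ, markLoss p c' r * r :=
    setIntegral_mono_on (integrableOn_markLoss_mul hc hρ)
      (integrableOn_markLoss_mul (hc.trans hcc) hρ) measurableSet_Ioi fun r (hr : ρ < r) =>
        mul_le_mul_of_nonneg_right (markLoss_mono hc hcc (hρ.trans hr.le)) (hρ.trans hr.le)
  have := p.lamBS_pos
  unfold echoLaplace
  gcongr

lemma tendsto_echoLaplace_zero (hρ : 0 ≤ ρ) :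
    Tendsto (fun c => echoLaplace p c ρ) (𝓝[>] 0) (𝓝 1) := by
  have hintegral : Tendsto (fun c => ∫ r in Ioi ρ, markLoss p c r * r) (𝓝[>] 0)
      (𝓝 (∫ _ in Ioi ρ, 0)) := by
    refine tendsto_integral_filter_of_dominated_convergence (fun r => losProb p r * r)
      (eventually_nhdsWithin_of_forall fun c hc =>
        (integrableOn_markLoss_mul (le_of_lt hc) hρ).aestronglyMeasurable)
      (eventually_nhdsWithin_of_forall fun c hc => ?_)
      ((integrableOn_losProb_mul p).mono_set (Ioi_subset_Ioi hρ)) ?_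
    · refine ae_restrict_of_forall_mem measurableSet_Ioi fun r (hr : ρ < r) => ?_
      have hr0 := hρ.trans hr.le
      rw [Real.norm_of_nonneg (mul_nonneg (markLoss_nonneg (le_of_lt hc) hr0) hr0)]
      exact mul_le_mul_of_nonneg_right (markLoss_le_losProb (le_of_lt hc) hr0) hr0
    · refine Eventually.of_forall fun r => ?_
      have hcont : ContinuousAt (fun c => markLoss p c r * r) 0 := by
        unfold markLoss
        refine ContinuousAt.mul (continuousAt_const.mul (continuousAt_const.sub
          (continuousAt_const.div (by fun_prop) (by simp)))) continuousAt_const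
      simpa [markLoss] using hcont.tendsto.mono_left nhdsWithin_le_nhds
  have h := Real.continuous_exp.continuousAt.tendsto.comp
    ((hintegral.const_mul (2 * Real.pi)).const_mul p.lamBS).neg
  simpa [echoLaplace, Function.comp_def] using h

lemma expNeg_lintegral_indicator_one_sub_expNeg_markCost (t : Plane) (hc : 0 ≤ c) (hρ : 0 ≤ ρ)
    {D : Set ℝ} (hDm : MeasurableSet D) (hD : D =ᵐ[volume] Ioi ρ) :
    expNeg (∫⁻ x, D.indicator (fun d => 1 - expNeg (markCost p c d)) (dist x t)
      ∂(ENNReal.ofReal p.lamBS • volume : Measure Plane)) = ENNReal.ofReal (echoLaplace p c ρ) := by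
  have hcost (x : Plane) : D.indicator (fun d => 1 - expNeg (markCost p c d)) (dist x t) =
      ENNReal.ofReal (D.indicator (markLoss p c) (dist x t)) := by
    by_cases hx : dist x t ∈ D
    · rw [indicator_of_mem hx, indicator_of_mem hx, one_sub_expNeg_markCost hc dist_nonneg]
    · rw [indicator_of_notMem hx, indicator_of_notMem hx, ENNReal.ofReal_zero]
  have hmul : (fun r => D.indicator (markLoss p c) r * r) =
      D.indicator fun r => markLoss p c r * r := by
    ext r
    rw [indicator_mul_left]
  have hset : (Ioi 0 ∩ D : Set ℝ) =ᵐ[volume] Ioi ρ := by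
    simpa [Ioi_inter_Ioi, max_eq_right hρ] using (ae_eq_refl (Ioi (0 : ℝ))).inter hD
  have hintegral : 0 ≤ ∫ r in Ioi ρ, markLoss p c r * r :=
    setIntegral_nonneg measurableSet_Ioi fun r (hr : ρ < r) =>
      mul_nonneg (markLoss_nonneg hc (hρ.trans hr.le)) (hρ.trans hr.le)
  have hlam := p.lamBS_pos.le
  rw [lintegral_congr hcost, lintegral_smul_measure, lintegral_ofReal_dist t
      (fun r hr => indicator_apply_nonneg fun _ => markLoss_nonneg hc hr)
      (by rw [hmul]; exact (integrableOn_markLoss_mul hc le_rfl).indicator hDm),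
    hmul, setIntegral_indicator hDm, setIntegral_congr_set hset, smul_eq_mul,
    ← ENNReal.ofReal_mul hlam, expNeg_ofReal (by positivity), echoLaplace]

end Radial

section Explicit

variable (p : Params)

/-- The factor in front of the sum of the echoes in `reflectedPower`. -/
def echoGain (r₁ : ℝ) : ℝ :=
  p.Ps * p.Gm ^ 2 * p.wavelength ^ 2 / ((4 * Real.pi) ^ 3 * r₁ ^ p.alphaL)

lemma echoGain_nonneg {r₁ : ℝ} (h : 0 ≤ r₁) : 0 ≤ echoGain p r₁ := by
  have := p.Ps_nonneg
  unfold echoGain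
  positivity

lemma measurable_echoGain : Measurable (echoGain p) := by
  unfold echoGain
  fun_prop

lemma markLoss_mul_echoGain (r₁ s : ℝ) {r : ℝ} (hr : 0 ≤ r) :
    markLoss p (s * echoGain p r₁) r = beamProb p * losProb p r * lossFactor p r₁ s r := by
  rw [markLoss, lossFactor, echoGain, Real.rpow_neg hr]
  congr 4
  simp only [div_eq_mul_inv, mul_inv]
  ring

lemma echoLaplace_mul_echoGain (r₁ s : ℝ) {ρ : ℝ} (hρ : 0 ≤ ρ) :
    echoLaplace p (s * echoGain p r₁) ρ = pgflFactor p r₁ s ρ := by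
  have hintegral : ∫ r in Ioi ρ, markLoss p (s * echoGain p r₁) r * r =
      beamProb p * ∫ r in Ioi ρ, losProb p r * lossFactor p r₁ s r * r := by
    rw [← integral_const_mul]
    refine setIntegral_congr_fun measurableSet_Ioi fun r (hr : ρ < r) => ?_
    rw [markLoss_mul_echoGain p r₁ s (hρ.trans hr.le)]
    ring
  rw [echoLaplace, pgflFactor, hintegral, beamProb]
  have := Real.pi_pos
  field_simp

lemma ae_le_radiusKernel (n : ℕ) {r : ℝ} (hr : 0 ≤ r) : ∀ᵐ ρ ∂radiusKernel p n r, r ≤ ρ := by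
  have hdens : Measurable fun ρ => ENNReal.ofReal (condDensity p n r ρ) :=
    ((measurable_condDensity p n).comp measurable_prodMk_left).ennreal_ofReal
  rw [radiusKernel_of_nonneg p n hr, ae_withDensity_iff hdens]
  refine Eventually.of_forall fun ρ hρ => ?_
  by_contra! hlt
  exact hρ (by rw [condDensity_of_lt p n hlt, ENNReal.ofReal_zero])

lemma toReal_lintegral_radiusKernel (n : ℕ) {r : ℝ} (hr : 0 ≤ r) {f : ℝ → ℝ} (hf : Measurable f)
    (hf0 : ∀ ρ, r < ρ → 0 ≤ f ρ) :
    (∫⁻ ρ, ENNReal.ofReal (f ρ) ∂radiusKernel p n r).toReal =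
      ∫ ρ in Ioi r, f ρ * condDensity p n r ρ := by
  have hdens : Measurable (condDensity p n r) :=
    (measurable_condDensity p n).comp measurable_prodMk_left
  have hsupp : (Function.support fun ρ =>
      ENNReal.ofReal (condDensity p n r ρ) * ENNReal.ofReal (f ρ)) ⊆ Ici r := fun ρ hρ => by
    by_contra hlt
    exact hρ (by simp [condDensity_of_lt p n (not_le.1 hlt)])
  rw [integral_eq_lintegral_of_nonneg_ae
    (ae_restrict_of_forall_mem measurableSet_Ioi fun ρ hρ =>
      mul_nonneg (hf0 ρ hρ) (condDensity_nonneg p n hr ρ))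
    (hf.mul hdens).aestronglyMeasurable, radiusKernel_of_nonneg p n hr,
    lintegral_withDensity_eq_lintegral_mul _ hdens.ennreal_ofReal hf.ennreal_ofReal]
  congr 1
  simp_rw [Pi.mul_apply]
  rw [← setLIntegral_eq_of_support_subset hsupp, setLIntegral_congr Ioi_ae_eq_Ici.symm]
  refine setLIntegral_congr_fun measurableSet_Ioi fun ρ hρ => ?_
  rw [ENNReal.ofReal_mul (hf0 ρ hρ), mul_comm]

end Explicit

section Echo

instance isLocallyFiniteMeasure_ofReal_smul_volume (lam : ℝ) :
    IsLocallyFiniteMeasure (ENNReal.ofReal lam • volume : Measure Plane) :=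
  inferInstanceAs (IsLocallyFiniteMeasure (lam.toNNReal • volume))

variable {Ω : Type*} {p : Params} {t : Plane} {X : ℕ → Ω → Plane} {M : ℕ → Ω → Mark}

/-- The sum of the echoes of the base stations at a distance in `D`, in `[0, ∞]`. -/
def totalEcho (p : Params) (t : Plane) (X : ℕ → Ω → Plane) (M : ℕ → Ω → Mark) (D : Set ℝ)
    (ω : Ω) : ℝ≥0∞ := ∑' i, ENNReal.ofReal (echoTerm p t X M D i ω)

section Pathwise

variable {D : Set ℝ} {ω : Ω} (hσ : ∀ i, 0 ≤ (M i ω).2.2)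
include hσ

lemma echoTerm_nonneg (i : ℕ) : 0 ≤ echoTerm p t X M D i ω := by
  unfold echoTerm
  split_ifs
  · exact mul_nonneg (hσ i) (Real.rpow_nonneg dist_nonneg _)
  · exact le_rfl

lemma totalEcho_mono {D' : Set ℝ} (hD : D ⊆ D') :
    totalEcho p t X M D ω ≤ totalEcho p t X M D' ω := by
  refine ENNReal.tsum_le_tsum fun i => ENNReal.ofReal_le_ofReal ?_
  by_cases hi : (M i ω).1 = true ∧ (M i ω).2.1 = true ∧ dist (X i ω) t ∈ D
  · rw [echoTerm, echoTerm, if_pos hi, if_pos ⟨hi.1, hi.2.1, hD hi.2.2⟩]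
  · rw [echoTerm, if_neg hi]
    exact echoTerm_nonneg hσ i

lemma summable_echoTerm (hfin : totalEcho p t X M D ω ≠ ∞) :
    Summable fun i => echoTerm p t X M D i ω :=
  (ENNReal.summable_toReal hfin).congr fun i => ENNReal.toReal_ofReal (echoTerm_nonneg hσ i)

lemma reflectedPower_eq (r₁ : ℝ) :
    reflectedPower p t X M r₁ D ω = echoGain p r₁ * (totalEcho p t X M D ω).toReal := by
  rw [reflectedPower, echoGain, totalEcho, ENNReal.tsum_toReal_eq fun _ => ENNReal.ofReal_ne_top]
  simp_rw [ENNReal.toReal_ofReal (echoTerm_nonneg hσ _)]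

end Pathwise

variable [MeasurableSpace Ω] {μ : Measure Ω}

lemma measurable_totalEcho (hX : ∀ i, Measurable (X i)) (hM : ∀ i, Measurable (M i))
    {D : Ω → Set ℝ} (hD : MeasurableSet {z : Ω × ℝ | z.2 ∈ D z.1}) :
    Measurable fun ω => totalEcho p t X M (D ω) ω :=
  Measurable.tsum fun i => ENNReal.measurable_ofReal.comp (measurable_echo hD (hX i) (hM i))

variable [IsProbabilityMeasure μ]

lemma ae_ne_top_of_tendsto_lintegral_expNeg {T : Ω → ℝ≥0∞} (hT : Measurable T)
    (hlim : Tendsto (fun c : ℝ => ∫⁻ ω, expNeg (ENNReal.ofReal c * T ω) ∂μ) (𝓝[>] 0) (𝓝 1)) :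
    ∀ᵐ ω ∂μ, T ω ≠ ∞ := by
  have hfin : MeasurableSet {ω | T ω ≠ ∞} := (hT (measurableSet_singleton ∞)).compl
  have hle (c : ℝ) (hc : 0 < c) :
      ∫⁻ ω, expNeg (ENNReal.ofReal c * T ω) ∂μ ≤ μ {ω | T ω ≠ ∞} := by
    rw [← lintegral_indicator_one hfin]
    refine lintegral_mono fun ω => ?_
    by_cases hω : T ω = ∞
    · simp [hω, ENNReal.mul_top (ENNReal.ofReal_pos.2 hc).ne']
    · simpa [hω] using expNeg_le_one _
  exact (prob_compl_eq_zero_iff hfin).2 (le_antisymm prob_le_one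
    (le_of_tendsto hlim (eventually_nhdsWithin_of_forall hle)))

lemma IsIndependentMarking.ae_nonneg (hM : IsIndependentMarking μ X (markLaw p t) M) :
    ∀ᵐ ω ∂μ, ∀ i, 0 ≤ (M i ω).2.2 := by
  refine ae_all_iff.2 fun i => ?_
  have hσ : MeasurableSet {m : Mark | 0 ≤ m.2.2} := measurableSet_le measurable_const (by fun_prop)
  have hlaw (x : Plane) : markLaw p t x {m : Mark | 0 ≤ m.2.2} = 1 :=
    (prob_compl_eq_zero_iff hσ).1 (ae_nonneg_markLaw p t x)
  have hprob : μ {ω | 0 ≤ (M i ω).2.2} = 1 := by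
    simpa [hlaw] using hM.joint_law univ MeasurableSet.univ {i} (fun _ => _) fun _ => hσ
  exact (prob_compl_eq_zero_iff (hM.measurable i hσ)).2 hprob

lemma aemeasurable_reflectedPower (hX : ∀ i, Measurable (X i))
    (hM : IsIndependentMarking μ X (markLaw p t) M) {r₁ : Ω → ℝ} (hr₁ : Measurable r₁)
    {D : Ω → Set ℝ} (hD : MeasurableSet {z : Ω × ℝ | z.2 ∈ D z.1}) :
    AEMeasurable (fun ω => reflectedPower p t X M (r₁ ω) (D ω) ω) μ := by
  have hecho : Measurable fun ω => totalEcho p t X M (D ω) ω :=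
    measurable_totalEcho hX hM.measurable hD
  refine ⟨fun ω => echoGain p (r₁ ω) * (totalEcho p t X M (D ω) ω).toReal,
    ((measurable_echoGain p).comp hr₁).mul hecho.ennreal_toReal, ?_⟩
  filter_upwards [hM.ae_nonneg] with ω hσ using reflectedPower_eq hσ _

-- Replacing the marks by deterministic costs reduces Laplace transforms of echoes to Laplace
-- functionals of the point process alone.
lemma IsIndependentMarking.lintegral_mul_expNeg_totalEcho (hX : ∀ i, Measurable (X i))
    (hM : IsIndependentMarking μ X (markLaw p t) M) {F : (ℕ → Plane) → ℝ≥0∞} (hF : Measurable F)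
    (hF1 : ∀ x, F x ≤ 1) {c : ℝ} (hc : 0 ≤ c) {D : (ℕ → Plane) → Set ℝ}
    (hD : MeasurableSet {z : (ℕ → Plane) × ℝ | z.2 ∈ D z.1}) :
    ∫⁻ ω, F (fun j => X j ω) *
        expNeg (ENNReal.ofReal c * totalEcho p t X M (D fun j => X j ω) ω) ∂μ =
      ∫⁻ ω, F (fun j => X j ω) *
        expNeg (pointSum X (fun x => (D fun j => X j ω).indicator (markCost p c) (dist x t)) ω)
        ∂μ := by
  have hM' : IsIndependentMarking μ X (markLawKernel p t) M := hM
  have hcost : Measurable (markCost p c) := (measurable_markCost p).of_uncurry_left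
  have hdist (i : ℕ) : Measurable fun x : ℕ → Plane => dist (x i) t := by fun_prop
  have hD' : MeasurableSet {z : ((ℕ → Plane) × Mark) × ℝ | z.2 ∈ D z.1.1} :=
    (measurable_fst.fst.prodMk measurable_snd) hD
  have key := hM'.lintegral_mul_expNeg_tsum hX hF hF1
    (a := fun i x m => ENNReal.ofReal c * ENNReal.ofReal (echo p t (D x) (x i) m))
    (h := fun i x => (D x).indicator (markCost p c) (dist (x i) t))
    (fun i => (ENNReal.measurable_ofReal.comp (measurable_echo (D := fun z => D z.1) hD'
      ((measurable_pi_apply i).comp measurable_fst) measurable_snd)).const_mul _)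
    (fun i => (hcost.comp (hdist i)).indicator ((measurable_id.prodMk (hdist i)) hD))
    fun i x => lintegral_markLaw_expNeg_echo t (x i) (D x) hc
  simp_rw [ENNReal.tsum_mul_left] at key
  exact key

variable (hX : IsPoissonPointProcess μ (ENNReal.ofReal p.lamBS • volume) X)
  (hM : IsIndependentMarking μ X (markLaw p t) M)
include hX hM

lemma lintegral_expNeg_totalEcho {c ρ : ℝ} (hc : 0 ≤ c) (hρ : 0 ≤ ρ) {D : Set ℝ}
    (hDm : MeasurableSet D) (hD : D =ᵐ[volume] Ioi ρ) :
    ∫⁻ ω, expNeg (ENNReal.ofReal c * totalEcho p t X M D ω) ∂μ =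
      ENNReal.ofReal (echoLaplace p c ρ) := by
  have hcost : Measurable (markCost p c) := (measurable_markCost p).of_uncurry_left
  have hmark := hM.lintegral_mul_expNeg_totalEcho hX.measurable (F := fun _ => 1) measurable_const
    (fun _ => le_rfl) hc (D := fun _ => D) (measurable_snd hDm)
  have hpgfl := hX.lintegral_expNeg_pointSum (f := fun x => D.indicator (markCost p c) (dist x t))
    ((hcost.indicator hDm).comp (by fun_prop))
  have hcompl (x : Plane) : 1 - expNeg (D.indicator (markCost p c) (dist x t)) =
      D.indicator (fun d => 1 - expNeg (markCost p c d)) (dist x t) := by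
    by_cases hx : dist x t ∈ D <;> simp [hx]
  simp only [one_mul] at hmark
  rw [hmark, hpgfl, lintegral_congr hcompl,
    expNeg_lintegral_indicator_one_sub_expNeg_markCost t hc hρ hDm hD]

lemma ae_totalEcho_ne_top :
    ∀ᵐ ω ∂μ, ∀ D : Set ℝ, D ⊆ Ioi 0 → totalEcho p t X M D ω ≠ ∞ := by
  have hmeas : Measurable fun ω => totalEcho p t X M (Ioi 0) ω :=
    measurable_totalEcho hX.measurable hM.measurable (D := fun _ => Ioi 0)
      (measurable_snd measurableSet_Ioi)
  have hlim : Tendsto (fun c : ℝ => ∫⁻ ω, expNeg (ENNReal.ofReal c * totalEcho p t X M (Ioi 0) ω)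
      ∂μ) (𝓝[>] 0) (𝓝 1) := by
    rw [← ENNReal.ofReal_one]
    refine (ENNReal.tendsto_ofReal (tendsto_echoLaplace_zero (p := p) le_rfl)).congr' ?_
    exact eventually_nhdsWithin_of_forall fun c hc =>
      (lintegral_expNeg_totalEcho hX hM (le_of_lt hc) le_rfl measurableSet_Ioi ae_eq_rfl).symm
  filter_upwards [hM.ae_nonneg, ae_ne_top_of_tendsto_lintegral_expNeg hmeas hlim]
    with ω hσ hfin D hD
  exact ne_top_of_le_ne_top hfin (totalEcho_mono hσ hD)

lemma ae_ofReal_reflectedPower_eq : ∀ᵐ ω ∂μ, ∀ r₁ : ℝ, 0 ≤ r₁ → ∀ D : Set ℝ, D ⊆ Ioi 0 →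
    ENNReal.ofReal (reflectedPower p t X M r₁ D ω) =
      ENNReal.ofReal (echoGain p r₁) * totalEcho p t X M D ω := by
  filter_upwards [hM.ae_nonneg, ae_totalEcho_ne_top hX hM] with ω hσ hfin r₁ hr₁ D hD
  rw [reflectedPower_eq hσ, ENNReal.ofReal_mul (echoGain_nonneg p hr₁),
    ENNReal.ofReal_toReal (hfin D hD)]

lemma integral_exp_reflectedPower_Ici {r₁ ρ s : ℝ} (hr₁ : 0 ≤ r₁) (hρ : 0 < ρ) (hs : 0 ≤ s) :
    ∫ ω, Real.exp (-(s * reflectedPower p t X M r₁ (Ici ρ) ω)) ∂μ = pgflFactor p r₁ s ρ := by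
  have hgain := mul_nonneg hs (echoGain_nonneg p hr₁)
  have hmeas : Measurable fun ω =>
      expNeg (ENNReal.ofReal (s * echoGain p r₁) * totalEcho p t X M (Ici ρ) ω) :=
    measurable_expNeg.comp ((measurable_totalEcho hX.measurable hM.measurable (D := fun _ => Ici ρ)
      (measurable_snd measurableSet_Ici)).const_mul _)
  have hexp : (fun ω => Real.exp (-(s * reflectedPower p t X M r₁ (Ici ρ) ω))) =ᵐ[μ]
      fun ω => (expNeg (ENNReal.ofReal (s * echoGain p r₁) * totalEcho p t X M (Ici ρ) ω)).toReal
      := by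
    filter_upwards [hM.ae_nonneg, ae_totalEcho_ne_top hX hM] with ω hσ hfin
    have hne := hfin (Ici ρ) fun r hr => hρ.trans_le hr
    rw [expNeg_of_ne_top (ENNReal.mul_ne_top ENNReal.ofReal_ne_top hne),
      ENNReal.toReal_ofReal (Real.exp_nonneg _), ENNReal.toReal_mul, ENNReal.toReal_ofReal hgain,
      reflectedPower_eq hσ, mul_assoc]
  rw [integral_congr_ae hexp, integral_toReal hmeas.aemeasurable
      (Eventually.of_forall fun ω => (expNeg_ne_top _).lt_top),
    lintegral_expNeg_totalEcho hX hM hgain hρ.le measurableSet_Ici Ioi_ae_eq_Ici.symm,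
    ENNReal.toReal_ofReal (echoLaplace_nonneg p _ _), echoLaplace_mul_echoGain p r₁ s hρ.le]

end Echo

section CondLaplace

lemma eq_of_continuousOn_of_antitoneOn_of_forall_rat {β : Type*} [TopologicalSpace β]
    [LinearOrder β] [OrderClosedTopology β] {L J : ℝ → β} (hL : ContinuousOn L (Ioi 0))
    (hJ : AntitoneOn J (Ici 0)) (heq : ∀ q : ℚ, 0 ≤ q → L q = J q) {s : ℝ} (hs : 0 ≤ s) :
    L s = J s := by
  rcases hs.eq_or_lt with rfl | hs0
  · simpa using heq 0 le_rfl
  have hcont := (hL.continuousAt (Ioi_mem_nhds hs0)).tendsto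
  obtain ⟨u, -, hsu, hu⟩ := Real.exists_seq_rat_strictAnti_tendsto s
  obtain ⟨v, -, hvs, hv⟩ := Real.exists_seq_rat_strictMono_tendsto s
  refine le_antisymm (le_of_tendsto (hcont.comp hu) (Eventually.of_forall fun k => ?_))
    (ge_of_tendsto (hcont.comp hv) ((hv.eventually (Ioi_mem_nhds hs0)).mono fun k hk => ?_))
  · have hu0 : (0 : ℝ) ≤ u k := hs.trans (hsu k).le
    exact (heq _ (by exact_mod_cast hu0)).trans_le (hJ hs hu0 (hsu k).le)
  · have hv0 : (0 : ℝ) ≤ v k := le_of_lt hk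
    exact (hJ hv0 hs (hvs k).le).trans_eq (heq _ (by exact_mod_cast hv0)).symm

lemma continuousOn_lintegral_expNeg_mul {β : Type*} [MeasurableSpace β] (ν : Measure β)
    [IsFiniteMeasure ν] {g : β → ℝ≥0∞} (hg : Measurable g) :
    ContinuousOn (fun c : ℝ => ∫⁻ y, expNeg (ENNReal.ofReal c * g y) ∂ν) (Ioi 0) := by
  refine continuousOn_of_forall_continuousAt fun c hc => ?_
  refine tendsto_lintegral_filter_of_dominated_convergence (fun _ => 1)
    (Eventually.of_forall fun c => measurable_expNeg.comp (hg.const_mul _))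
    (Eventually.of_forall fun c => Eventually.of_forall fun y => expNeg_le_one _) (by simp)
    (Eventually.of_forall fun y => (continuous_expNeg.tendsto _).comp ?_)
  exact ENNReal.Tendsto.mul_const (ENNReal.continuous_ofReal.tendsto c)
    (Or.inl (ENNReal.ofReal_pos.2 hc).ne')

variable {Ω α : Type*} [MeasurableSpace Ω] [MeasurableSpace α] {μ : Measure Ω}

/-- The Laplace transform at `c` of `Y` given `Z` is `J c Z`, in the sense of conditional
expectations, for each fixed `c ≥ 0`. -/
def IsCondLaplace (μ : Measure Ω) (Z : Ω → α) (Y : Ω → ℝ≥0∞) (J : ℝ → α → ℝ≥0∞) : Prop :=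
  ∀ c : ℝ, 0 ≤ c → ∀ φ : α → ℝ≥0∞, Measurable φ → (∀ z, φ z ≤ 1) →
    ∫⁻ ω, φ (Z ω) * expNeg (ENNReal.ofReal c * Y ω) ∂μ = ∫⁻ ω, φ (Z ω) * J c (Z ω) ∂μ

variable [IsFiniteMeasure μ]

section Disintegration

variable {β : Type*} [MeasurableSpace β] [StandardBorelSpace β] [Nonempty β]
  {Z : Ω → α} {Y : Ω → β} (hZ : Measurable Z) (hY : AEMeasurable Y μ)
include hZ hY

lemma lintegral_lintegral_condDistrib {F : α × β → ℝ≥0∞} (hF : Measurable F) :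
    ∫⁻ ω, ∫⁻ y, F (Z ω, y) ∂condDistrib Y Z μ (Z ω) ∂μ = ∫⁻ ω, F (Z ω, Y ω) ∂μ := by
  rw [← lintegral_map' hF.aemeasurable (hZ.aemeasurable.prodMk hY), ← compProd_map_condDistrib hY,
    Measure.lintegral_compProd hF, lintegral_map hF.lintegral_kernel_prod_right' hZ]

lemma ae_lintegral_condDistrib_eq {f : β → ℝ≥0∞} (hf : Measurable f) {J : α → ℝ≥0∞}
    (hJ : Measurable J) (h : ∀ A : Set α, MeasurableSet A →
      ∫⁻ ω in Z ⁻¹' A, f (Y ω) ∂μ = ∫⁻ ω in Z ⁻¹' A, J (Z ω) ∂μ) :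
    ∀ᵐ ω ∂μ, ∫⁻ y, f y ∂condDistrib Y Z μ (Z ω) = J (Z ω) := by
  refine ae_of_ae_map hZ.aemeasurable (p := fun z => ∫⁻ y, f y ∂condDistrib Y Z μ z = J z) ?_
  have hL : Measurable fun z => ∫⁻ y, f y ∂condDistrib Y Z μ z := hf.lintegral_kernel
  refine ae_eq_of_forall_setLIntegral_eq_of_sigmaFinite hL hJ fun A hA _ => ?_
  have htest := lintegral_lintegral_condDistrib hZ hY (F := fun z => A.indicator 1 z.1 * f z.2)
    (((measurable_one.indicator hA).comp measurable_fst).mul (hf.comp measurable_snd))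
  have hind (G : Ω → ℝ≥0∞) :
      ∫⁻ ω, A.indicator 1 (Z ω) * G ω ∂μ = ∫⁻ ω in Z ⁻¹' A, G ω ∂μ := by
    rw [← lintegral_indicator (hZ hA)]
    refine lintegral_congr fun ω => ?_
    by_cases hω : Z ω ∈ A <;> simp [hω]
  simp only [lintegral_const_mul _ hf, hind] at htest
  rw [setLIntegral_map hA hL hZ, setLIntegral_map hA hJ hZ, htest, h A hA]

variable {g : β → ℝ≥0∞} (hg : Measurable g) {J : ℝ → α → ℝ≥0∞}
  (hJ : ∀ c, 0 ≤ c → Measurable (J c)) (hanti : ∀ ω, AntitoneOn (fun c => J c (Z ω)) (Ici 0))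
include hg hJ hanti

-- Almost every fibre satisfies the identity at the rationals; monotonicity extends it to all `c`.
theorem IsCondLaplace.ae_forall_lintegral_condDistrib
    (h : IsCondLaplace μ Z (fun ω => g (Y ω)) J) :
    ∀ᵐ ω ∂μ, ∀ c : ℝ, 0 ≤ c →
      ∫⁻ y, expNeg (ENNReal.ofReal c * g y) ∂condDistrib Y Z μ (Z ω) = J c (Z ω) := by
  have hrat : ∀ᵐ ω ∂μ, ∀ q : ℚ, 0 ≤ q →
      ∫⁻ y, expNeg (ENNReal.ofReal q * g y) ∂condDistrib Y Z μ (Z ω) = J q (Z ω) := by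
    refine ae_all_iff.2 fun q => eventually_imp_distrib_left.2 fun hq => ?_
    have hq' : (0 : ℝ) ≤ q := by exact_mod_cast hq
    refine ae_lintegral_condDistrib_eq hZ hY (measurable_expNeg.comp (hg.const_mul _)) (hJ q hq')
      fun A hA => ?_
    have htest := h q hq' (A.indicator 1) (measurable_one.indicator hA)
      (indicator_le_self' fun _ _ => zero_le)
    rw [← lintegral_indicator (hZ hA), ← lintegral_indicator (hZ hA)]
    convert htest using 3 with ω ω <;> by_cases hω : Z ω ∈ A <;> simp [hω]
  filter_upwards [hrat] with ω hω c hc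
  exact eq_of_continuousOn_of_antitoneOn_of_forall_rat
    (continuousOn_lintegral_expNeg_mul (condDistrib Y Z μ (Z ω)) hg) (hanti ω) hω hc

theorem IsCondLaplace.lintegral_mul_expNeg_mul (h : IsCondLaplace μ Z (fun ω => g (Y ω)) J)
    {φ : α → ℝ≥0∞} (hφ : Measurable φ) {c : α → ℝ} (hc : Measurable c) (hc0 : ∀ ω, 0 ≤ c (Z ω)) :
    ∫⁻ ω, φ (Z ω) * expNeg (ENNReal.ofReal (c (Z ω)) * g (Y ω)) ∂μ =
      ∫⁻ ω, φ (Z ω) * J (c (Z ω)) (Z ω) ∂μ := by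
  have hexp : Measurable fun z : α × β => expNeg (ENNReal.ofReal (c z.1) * g z.2) :=
    measurable_expNeg.comp (by fun_prop)
  rw [← lintegral_lintegral_condDistrib hZ hY
    (F := fun z => φ z.1 * expNeg (ENNReal.ofReal (c z.1) * g z.2)) (by fun_prop)]
  refine lintegral_congr_ae ?_
  filter_upwards [h.ae_forall_lintegral_condDistrib hZ hY hg hJ hanti] with ω hω
  have hfiber : Measurable fun y => expNeg (ENNReal.ofReal (c (Z ω)) * g y) :=
    hexp.comp measurable_prodMk_left
  rw [lintegral_const_mul _ hfiber, hω _ (hc0 ω)]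

end Disintegration

theorem IsCondLaplace.ae_forall_integral_exp_condDistrib {Z : Ω → α} (hZ : Measurable Z)
    {Y : Ω → ℝ} (hY : AEMeasurable Y μ) (hY0 : ∀ᵐ ω ∂μ, 0 ≤ Y ω) {J : ℝ → α → ℝ≥0∞}
    (hJ : ∀ c, 0 ≤ c → Measurable (J c)) (hanti : ∀ ω, AntitoneOn (fun c => J c (Z ω)) (Ici 0))
    (h : IsCondLaplace μ Z (fun ω => ENNReal.ofReal (Y ω)) J) :
    ∀ᵐ ω ∂μ, ∀ s : ℝ, 0 ≤ s →
      ∫ y, Real.exp (-(s * y)) ∂condDistrib Y Z μ (Z ω) = (J s (Z ω)).toReal := by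
  have hpos : ∀ᵐ z ∂(μ.map Z ⊗ₘ condDistrib Y Z μ), 0 ≤ z.2 := by
    rw [compProd_map_condDistrib hY, ae_map_iff (hZ.aemeasurable.prodMk hY)
      (measurableSet_le measurable_const measurable_snd)]
    exact hY0
  filter_upwards [h.ae_forall_lintegral_condDistrib hZ hY ENNReal.measurable_ofReal hJ hanti,
    ae_of_ae_map hZ.aemeasurable (Measure.ae_ae_of_ae_compProd hpos)] with ω hlap hω s hs
  rw [← hlap s hs, integral_eq_lintegral_of_nonneg_ae
    (Eventually.of_forall fun y => Real.exp_nonneg _) (by fun_prop)]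
  congr 1
  refine lintegral_congr_ae (hω.mono fun y hy => ?_)
  simp only [← ENNReal.ofReal_mul hs, expNeg_ofReal (mul_nonneg hs hy)]

end CondLaplace

section Interference

variable {Ω : Type*} [MeasurableSpace Ω] {μ : Measure Ω} [IsProbabilityMeasure μ] {p : Params}
  {t : Plane} {X : ℕ → Ω → Plane} {M : ℕ → Ω → Mark} {n : ℕ}

lemma IsIndependentMarking.lintegral_mul_expNeg_totalEcho_nthDist (hX : ∀ i, Measurable (X i))
    (hM : IsIndependentMarking μ X (markLaw p t) M) (m n : ℕ) {φ : ℝ × ℝ → ℝ≥0∞}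
    (hφ : Measurable φ) (hφ1 : ∀ z, φ z ≤ 1) {c : ℝ} (hc : 0 ≤ c) {D : ℝ → Set ℝ}
    (hD : MeasurableSet {z : ℝ × ℝ | z.2 ∈ D z.1}) :
    ∫⁻ ω, φ (nthDist X t m ω, nthDist X t n ω) *
        expNeg (ENNReal.ofReal c * totalEcho p t X M (D (nthDist X t n ω)) ω) ∂μ =
      ∫⁻ ω, φ (nthDist X t m ω, nthDist X t n ω) *
        expNeg (pointSum X (fun x => (D (nthDist X t n ω)).indicator (markCost p c) (dist x t)) ω)
        ∂μ := by
  let Y (i : ℕ) (x : ℕ → Plane) : Plane := x i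
  have hY := measurable_nthDist (X := Y) measurable_pi_apply t
  exact hM.lintegral_mul_expNeg_totalEcho hX (F := fun x => φ (nthDist Y t m x, nthDist Y t n x))
    (hφ.comp ((hY m).prodMk (hY n))) (fun _ => hφ1 _) hc (D := fun x => D (nthDist Y t n x))
    ((((hY n).comp measurable_fst).prodMk measurable_snd) hD)

variable (hX : IsPoissonPointProcess μ (ENNReal.ofReal p.lamBS • volume) X)
include hX

lemma IsPoissonPointProcess.lintegral_nthDist_nthDist (hn : 1 ≤ n) {f : ℝ × ℝ → ℝ≥0∞}
    (hf : Measurable f) :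
    ∫⁻ ω, f (nthDist X t 1 ω, nthDist X t (n + 1) ω) ∂μ =
      ∫⁻ ω, ∫⁻ ρ, f (nthDist X t 1 ω, ρ) ∂radiusKernel p n (nthDist X t 1 ω) ∂μ := by
  have hR₁ := measurable_nthDist hX.measurable t 1
  have hR := measurable_nthDist hX.measurable t (n + 1)
  have := isMarkovKernel_radiusKernel p hn
  have := Measure.isProbabilityMeasure_map (μ := μ) hR₁.aemeasurable
  rw [← lintegral_map hf (hR₁.prodMk hR), hX.map_nthDist_eq_compProd t hn,
    Measure.lintegral_compProd hf, lintegral_map hf.lintegral_kernel_prod_right' hR₁]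

lemma ae_condDistrib_nthDist (hn : 1 ≤ n) :
    ∀ᵐ ω ∂μ, condDistrib (nthDist X t (n + 1)) (nthDist X t 1) μ (nthDist X t 1 ω) =
      volume.withDensity fun ρ => ENNReal.ofReal (condDensity p n (nthDist X t 1 ω) ρ) := by
  have hR₁ := measurable_nthDist hX.measurable t 1
  have hR := measurable_nthDist hX.measurable t (n + 1)
  have := isMarkovKernel_radiusKernel p hn
  filter_upwards [ae_of_ae_map hR₁.aemeasurable (condDistrib_ae_eq_of_measure_eq_compProd
    (nthDist X t 1) hR.aemeasurable (hX.map_nthDist_eq_compProd t hn))] with ω hω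
  rw [hω, radiusKernel_of_nonneg p n (nthDist_nonneg X t 1 ω)]

variable (hM : IsIndependentMarking μ X (markLaw p t) M)
include hM

lemma isCondLaplace_totalEcho_Ioi (hn : 1 ≤ n) :
    IsCondLaplace μ (fun ω => (nthDist X t 1 ω, nthDist X t n ω))
      (fun ω => totalEcho p t X M (Ioi (nthDist X t n ω)) ω)
      (fun c z => ENNReal.ofReal (echoLaplace p c z.2)) := by
  intro c hc φ hφ hφ1
  have hcost : Measurable (markCost p c) := (measurable_markCost p).of_uncurry_left
  have htail := hX.lintegral_mul_expNeg_pointSum_radialTail (t := t) hn hcost hφ hφ1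
  refine (hM.lintegral_mul_expNeg_totalEcho_nthDist hX.measurable 1 n hφ hφ1 hc (D := Ioi)
    (measurableSet_lt measurable_fst measurable_snd)).trans (htail.trans ?_)
  refine lintegral_congr fun ω => ?_
  rw [tailExponent, expNeg_lintegral_indicator_one_sub_expNeg_markCost t hc
    (nthDist_nonneg X t n ω) measurableSet_Ioi ae_eq_rfl]

lemma isCondLaplace_totalEcho_Ici (hn : 1 ≤ n) :
    IsCondLaplace μ (fun ω => (nthDist X t 1 ω, nthDist X t n ω))
      (fun ω => totalEcho p t X M (Ici (nthDist X t n ω)) ω)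
      (fun c z => ENNReal.ofReal ((1 - markLoss p c z.2) * echoLaplace p c z.2)) := by
  intro c hc φ hφ hφ1
  have hcost : Measurable (markCost p c) := (measurable_markCost p).of_uncurry_left
  have htail := hX.lintegral_mul_expNeg_pointSum_indicator_Ici
    (hX.ae_isGeneric p.lamBS_pos.le t) hn hcost hφ hφ1
  refine (hM.lintegral_mul_expNeg_totalEcho_nthDist hX.measurable 1 n hφ hφ1 hc (D := Ici)
    (measurableSet_le measurable_fst measurable_snd)).trans (htail.trans ?_)
  refine lintegral_congr fun ω => ?_
  have hR := nthDist_nonneg X t n ω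
  rw [tailExponent, expNeg_lintegral_indicator_one_sub_expNeg_markCost t hc hR measurableSet_Ioi
    ae_eq_rfl, expNeg_markCost hc hR,
    ← ENNReal.ofReal_mul (sub_nonneg.2 (markLoss_lt_one hc hR).le)]

section Averaging

variable {D : ℝ → Set ℝ} (hDm : MeasurableSet {z : ℝ × ℝ | z.2 ∈ D z.1})
  (hD : ∀ ρ, D ρ ⊆ Ici ρ) {ℓ : ℝ → ℝ → ℝ} (hℓ : Measurable (Function.uncurry ℓ))
  (hanti : ∀ ρ, 0 ≤ ρ → AntitoneOn (fun c => ℓ c ρ) (Ici 0)) (hn : 1 ≤ n)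
  (hlap : IsCondLaplace μ (fun ω => (nthDist X t 1 ω, nthDist X t (n + 1) ω))
    (fun ω => totalEcho p t X M (D (nthDist X t (n + 1) ω)) ω)
    (fun c z => ENNReal.ofReal (ℓ c z.2)))
include hDm hD hℓ hanti hn hlap

lemma isCondLaplace_reflectedPower :
    IsCondLaplace μ (nthDist X t 1) (fun ω => ENNReal.ofReal
        (reflectedPower p t X M (nthDist X t 1 ω) (D (nthDist X t (n + 1) ω)) ω))
      (fun s r => ∫⁻ ρ, ENNReal.ofReal (ℓ (s * echoGain p r) ρ) ∂radiusKernel p n r) := by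
  intro s hs φ hφ _
  have hR₁ := measurable_nthDist hX.measurable t 1
  have hR := measurable_nthDist hX.measurable t (n + 1)
  have hgain := measurable_echoGain p
  have hecho : Measurable fun ω => totalEcho p t X M (D (nthDist X t (n + 1) ω)) ω :=
    measurable_totalEcho hX.measurable hM.measurable
      (((hR.comp measurable_fst).prodMk measurable_snd) hDm)
  have hJ : Measurable fun z : ℝ × ℝ => ENNReal.ofReal (ℓ (s * echoGain p z.1) z.2) :=
    (hℓ.comp (f := fun z : ℝ × ℝ => (s * echoGain p z.1, z.2)) (by fun_prop)).ennreal_ofReal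
  calc
    _ = ∫⁻ ω, φ (nthDist X t 1 ω) * expNeg (ENNReal.ofReal (s * echoGain p (nthDist X t 1 ω)) *
          totalEcho p t X M (D (nthDist X t (n + 1) ω)) ω) ∂μ := by
      refine lintegral_congr_ae ?_
      filter_upwards [ae_ofReal_reflectedPower_eq hX hM, hX.ae_isGeneric p.lamBS_pos.le t]
        with ω hpower hgen
      have hsub : D (nthDist X t (n + 1) ω) ⊆ Ioi 0 := fun r hr =>
        (hgen.nthDist_pos (by omega)).trans_le (hD _ hr)
      rw [hpower _ (nthDist_nonneg X t 1 ω) _ hsub, ← mul_assoc, ← ENNReal.ofReal_mul hs]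
    _ = ∫⁻ ω, φ (nthDist X t 1 ω) * ENNReal.ofReal
          (ℓ (s * echoGain p (nthDist X t 1 ω)) (nthDist X t (n + 1) ω)) ∂μ :=
      hlap.lintegral_mul_expNeg_mul (hR₁.prodMk hR) hecho.aemeasurable (g := id) measurable_id
        (fun c _ => (hℓ.comp (f := fun z : ℝ × ℝ => (c, z.2)) (by fun_prop)).ennreal_ofReal)
        (fun ω _ hc _ hc' hcc => ENNReal.ofReal_le_ofReal
          (hanti _ (nthDist_nonneg X t (n + 1) ω) hc hc' hcc))
        (hφ.comp measurable_fst) (c := fun z => s * echoGain p z.1) (by fun_prop)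
        fun ω => mul_nonneg hs (echoGain_nonneg p (nthDist_nonneg X t 1 ω))
    _ = ∫⁻ ω, ∫⁻ ρ, φ (nthDist X t 1 ω) * ENNReal.ofReal
          (ℓ (s * echoGain p (nthDist X t 1 ω)) ρ) ∂radiusKernel p n (nthDist X t 1 ω) ∂μ :=
      hX.lintegral_nthDist_nthDist hn
        (f := fun z => φ z.1 * ENNReal.ofReal (ℓ (s * echoGain p z.1) z.2))
        ((hφ.comp measurable_fst).mul hJ)
    _ = ∫⁻ ω, φ (nthDist X t 1 ω) * ∫⁻ ρ, ENNReal.ofReal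
          (ℓ (s * echoGain p (nthDist X t 1 ω)) ρ) ∂radiusKernel p n (nthDist X t 1 ω) ∂μ :=
      lintegral_congr fun ω => by
        have hfiber : Measurable fun ρ => ENNReal.ofReal (ℓ (s * echoGain p (nthDist X t 1 ω)) ρ) :=
          hℓ.of_uncurry_left.ennreal_ofReal
        rw [lintegral_const_mul _ hfiber]

lemma ae_integral_exp_condDistrib_reflectedPower (hℓ0 : ∀ c ρ, 0 ≤ c → 0 ≤ ρ → 0 ≤ ℓ c ρ) :
    ∀ᵐ ω ∂μ, ∀ s : ℝ, 0 ≤ s →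
      ∫ y, Real.exp (-(s * y)) ∂condDistrib (fun ω => reflectedPower p t X M (nthDist X t 1 ω)
          (D (nthDist X t (n + 1) ω)) ω) (nthDist X t 1) μ (nthDist X t 1 ω) =
        ∫ ρ in Ioi (nthDist X t 1 ω), ℓ (s * echoGain p (nthDist X t 1 ω)) ρ *
          condDensity p n (nthDist X t 1 ω) ρ := by
  have hR₁ := measurable_nthDist hX.measurable t 1
  have hR := measurable_nthDist hX.measurable t (n + 1)
  have hkernel := isMarkovKernel_radiusKernel p hn
  have hgain := measurable_echoGain p
  have hpower0 : ∀ᵐ ω ∂μ,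
      0 ≤ reflectedPower p t X M (nthDist X t 1 ω) (D (nthDist X t (n + 1) ω)) ω := by
    filter_upwards [hM.ae_nonneg] with ω hσ
    rw [reflectedPower_eq hσ]
    exact mul_nonneg (echoGain_nonneg p (nthDist_nonneg X t 1 ω)) ENNReal.toReal_nonneg
  have hmono (ω : Ω) : AntitoneOn (fun s => ∫⁻ ρ, ENNReal.ofReal
      (ℓ (s * echoGain p (nthDist X t 1 ω)) ρ) ∂radiusKernel p n (nthDist X t 1 ω)) (Ici 0) := by
    intro s (hs : 0 ≤ s) s' (hs' : 0 ≤ s') hss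
    have hr := nthDist_nonneg X t 1 ω
    have hr' := echoGain_nonneg p hr
    refine lintegral_mono_ae ((ae_le_radiusKernel p n hr).mono fun ρ hρ => ?_)
    exact ENNReal.ofReal_le_ofReal (hanti ρ (hr.trans hρ) (mul_nonneg hs hr')
      (mul_nonneg hs' hr') (mul_le_mul_of_nonneg_right hss hr'))
  have hJ (s : ℝ) : Measurable fun z : ℝ × ℝ => ENNReal.ofReal (ℓ (s * echoGain p z.1) z.2) :=
    (hℓ.comp (f := fun z : ℝ × ℝ => (s * echoGain p z.1, z.2)) (by fun_prop)).ennreal_ofReal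
  have hpower := aemeasurable_reflectedPower hX.measurable hM hR₁
    (D := fun ω => D (nthDist X t (n + 1) ω))
    (((hR.comp measurable_fst).prodMk measurable_snd) hDm)
  have hcond := isCondLaplace_reflectedPower hX hM hDm hD hℓ hanti hn hlap
  filter_upwards [hcond.ae_forall_integral_exp_condDistrib hR₁ hpower hpower0
    (fun s _ => (hJ s).lintegral_kernel_prod_right') hmono] with ω hω s hs
  have hr := nthDist_nonneg X t 1 ω
  rw [hω s hs, toReal_lintegral_radiusKernel p n hr hℓ.of_uncurry_left fun ρ hρ =>
    hℓ0 _ ρ (mul_nonneg hs (echoGain_nonneg p hr)) (hr.trans hρ.le)]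

end Averaging

lemma ae_nthDist_pos_lt_and_summable (hn : 1 ≤ n) :
    ∀ᵐ ω ∂μ, 0 < nthDist X t 1 ω ∧ nthDist X t 1 ω < nthDist X t (n + 1) ω ∧
      ∀ ρ : ℝ, 0 < ρ → Summable fun i => echoTerm p t X M (Ici ρ) i ω := by
  filter_upwards [hX.ae_isGeneric p.lamBS_pos.le t, hM.ae_nonneg, ae_totalEcho_ne_top hX hM]
    with ω hgen hσ hfin
  exact ⟨hgen.nthDist_pos le_rfl, hgen.nthDist_one_lt (by omega),
    fun ρ hρ => summable_echoTerm hσ (hfin _ fun r hr => hρ.trans_le hr)⟩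

theorem ae_integral_exp_condDistrib_interferenceExterior (hn : 1 ≤ n) :
    ∀ᵐ ω ∂μ, ∀ s : ℝ, 0 ≤ s →
      ∫ y, Real.exp (-(s * y)) ∂condDistrib (interferenceExterior p t n X M) (nthDist X t 1) μ
        (nthDist X t 1 ω) = explicitLT p n (nthDist X t 1 ω) s := by
  filter_upwards [ae_integral_exp_condDistrib_reflectedPower hX hM (D := Ioi)
    (measurableSet_lt measurable_fst measurable_snd) (fun _ => Ioi_subset_Ici_self)
    (measurable_echoLaplace p) (fun ρ hρ c hc c' _ hcc => echoLaplace_anti hc hcc hρ) hn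
    (isCondLaplace_totalEcho_Ioi hX hM (by omega)) fun c ρ _ _ => echoLaplace_nonneg p c ρ]
    with ω hω s hs
  refine (hω s hs).trans (setIntegral_congr_fun measurableSet_Ioi fun ρ (hρ : _ < ρ) => ?_)
  rw [echoLaplace_mul_echoGain p _ s ((nthDist_nonneg X t 1 ω).trans hρ.le)]

theorem ae_integral_exp_condDistrib_interferenceWithRim (hn : 1 ≤ n) :
    ∀ᵐ ω ∂μ, ∀ s : ℝ, 0 ≤ s →
      ∫ y, Real.exp (-(s * y)) ∂condDistrib (interferenceWithRim p t n X M) (nthDist X t 1) μ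
        (nthDist X t 1 ω) = explicitLTWithRim p n (nthDist X t 1 ω) s := by
  have hloss {c ρ : ℝ} (hc : 0 ≤ c) (hρ : 0 ≤ ρ) : 0 ≤ 1 - markLoss p c ρ :=
    sub_nonneg.2 (markLoss_lt_one hc hρ).le
  have hmeas : Measurable (Function.uncurry fun c ρ => (1 - markLoss p c ρ) * echoLaplace p c ρ) :=
    (measurable_const.sub (measurable_markLoss p)).mul (measurable_echoLaplace p)
  filter_upwards [ae_integral_exp_condDistrib_reflectedPower hX hM (D := Ici)
    (measurableSet_le measurable_fst measurable_snd) (fun _ => subset_rfl) hmeas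
    (fun ρ hρ c hc c' _ hcc => mul_le_mul (sub_le_sub_left (markLoss_mono hc hcc hρ) 1)
      (echoLaplace_anti hc hcc hρ) (echoLaplace_nonneg p c' ρ) (hloss hc hρ)) hn
    (isCondLaplace_totalEcho_Ici hX hM (by omega))
    fun c ρ hc hρ => mul_nonneg (hloss hc hρ) (echoLaplace_nonneg p c ρ)] with ω hω s hs
  refine (hω s hs).trans (setIntegral_congr_fun measurableSet_Ioi fun ρ (hρ : _ < ρ) => ?_)
  have hρ0 := (nthDist_nonneg X t 1 ω).trans hρ.le
  rw [echoLaplace_mul_echoGain p _ s hρ0, markLoss_mul_echoGain p _ s hρ0]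

end Interference

end ISAC

end

open ISAC in
theorem lemma2 {Ω : Type*} [MeasurableSpace Ω] (μ : Measure Ω) [IsProbabilityMeasure μ]
    (p : Params) (t : Plane) (Nc : ℕ) (hNc : 1 ≤ Nc)
    (X : ℕ → Ω → Plane) (M : ℕ → Ω → Mark)
    (hX : IsPoissonPointProcess μ (ENNReal.ofReal p.lamBS • volume) X)
    (hM : IsIndependentMarking μ X (markLaw p t) M) :
    -- the random variables are well defined
    (AEMeasurable (nthDist X t 1) μ ∧ AEMeasurable (nthDist X t (Nc + 1)) μ ∧
      AEMeasurable (interferenceExterior p t Nc X M) μ ∧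
      AEMeasurable (interferenceWithRim p t Nc X M) μ ∧
      ∀ᵐ ω ∂μ, 0 < nthDist X t 1 ω ∧ nthDist X t 1 ω < nthDist X t (Nc + 1) ω ∧
        ∀ ρ : ℝ, 0 < ρ → Summable (fun i => echoTerm p t X M (Ici ρ) i ω)) ∧
    -- the conditional density of the exclusion radius
    (∀ᵐ ω ∂μ, condDistrib (nthDist X t (Nc + 1)) (nthDist X t 1) μ (nthDist X t 1 ω) =
      volume.withDensity (fun ρ => ENNReal.ofReal (condDensity p Nc (nthDist X t 1 ω) ρ))) ∧
    -- the generating functional over the distances `r ≥ ρ`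
    (∀ r₁ ρ s : ℝ, 0 < r₁ → 0 < ρ → 0 ≤ s →
      ∫ ω, Real.exp (-(s * reflectedPower p t X M r₁ (Ici ρ) ω)) ∂μ = pgflFactor p r₁ s ρ) ∧
    -- the Laplace transform given `R_1`, with the interferers outside the exclusion disc
    (∀ᵐ ω ∂μ, ∀ s : ℝ, 0 ≤ s →
      ∫ y, Real.exp (-(s * y))
          ∂(condDistrib (interferenceExterior p t Nc X M) (nthDist X t 1) μ (nthDist X t 1 ω)) =
        explicitLT p Nc (nthDist X t 1 ω) s) ∧
    -- the same, with the base station on the rim of the exclusion disc as an interferer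
    (∀ᵐ ω ∂μ, ∀ s : ℝ, 0 ≤ s →
      ∫ y, Real.exp (-(s * y))
          ∂(condDistrib (interferenceWithRim p t Nc X M) (nthDist X t 1) μ (nthDist X t 1 ω)) =
        explicitLTWithRim p Nc (nthDist X t 1 ω) s) := by
  have hR₁ := measurable_nthDist hX.measurable t 1
  have hR := measurable_nthDist hX.measurable t (Nc + 1)
  have hfst : Measurable fun z : Ω × ℝ => nthDist X t (Nc + 1) z.1 := hR.comp measurable_fst
  refine ⟨⟨hR₁.aemeasurable, hR.aemeasurable, ?exterior, ?withRim,
    ae_nthDist_pos_lt_and_summable hX hM hNc⟩, ae_condDistrib_nthDist hX hNc,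
    fun r₁ ρ s hr₁ hρ hs => integral_exp_reflectedPower_Ici hX hM hr₁.le hρ hs,
    ae_integral_exp_condDistrib_interferenceExterior hX hM hNc,
    ae_integral_exp_condDistrib_interferenceWithRim hX hM hNc⟩
  case exterior =>
    exact aemeasurable_reflectedPower hX.measurable hM hR₁ (D := fun ω => Ioi (nthDist X t _ ω))
      (measurableSet_lt hfst measurable_snd)
  case withRim =>
    exact aemeasurable_reflectedPower hX.measurable hM hR₁ (D := fun ω => Ici (nthDist X t _ ω))
      (measurableSet_le hfst measurable_snd)
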